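/- **Theorem (online natural gradient update).** Let $A\in\mathbb R^{d_x\times d_x}$, $B\in\mathbb R^{d_x\times d_u}$, $d=\max(d_x,d_u)$, and consider $x_{t+1}=Ax_t+Bu_t+w_t$ for rounds $t=0,\dots,T-1$, with $x_0=0$ and $T\ge 2$. Matrix norms are spectral norms. Let $\kappa\ge 1$, $0<\gamma<1$, $\sigma>0$, $\alpha>0$, $\|B\|\le\kappa_B$, and $\kappa_B(1-\gamma)\ge 2$. A matrix $K$ is *$(\kappa,\gamma)$-diagonal strongly stable* if $A-BK=QLQ^{-1}$ with a complex diagonal $L$ and a non-singular complex $Q$, where $\|L\|\le 1-\gamma$ and $\|K\|,\|Q\|,\|Q^{-1}\|\le\kappa$; let $\mathcal K$ be the set of these matrices, and fix $\mathbb K\in\mathcal K$. Assume that * the $w_t$ are i.i.d. with a law $\mathcal D$ such that $\mathbb E[w_t]=0$, $\mathbb E[w_tw_t^\top]\succeq\sigma^2I$, and $\|w_t\|\le W$ almost surely; * the costs $c_t(x,u)$ are a fixed (deterministic) sequence of differentiable, jointly $\alpha$-strongly convex functions such that, for every $D$, $\|x\|,\|u\|\le D$ implies $\|\nabla_xc_t(x,u)\|,\|\nabla_uc_t(x,u)\|\le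 GD$. Let $H=\lceil\gamma^{-1}\log(T\kappa^2)\rceil$ and $\mathcal M=\{M=(M^{[0]},\dots,M^{[H-1]}),\ M^{[i]}\in\mathbb R^{d_u\times d_x}:\ \|M^{[i-1]}\|\le\kappa^3\kappa_B(1-\gamma)^i,\ 1\le i\le H\}$, and write $M_{\rm vec}$ for the vector of all entries of $M$, with the Euclidean norm. For independent $\xi_0,\dots,\xi_{2H}\sim\mathcal D$ and $\tilde A=A-B\mathbb K$ define the surrogate state, action and cost $$y(M)=\sum_{i=0}^{2H}\Psi_i(M)\,\xi_i,\quad \Psi_i(M)=\tilde A^i\mathbf 1_{i\le H}+\sum_{j=0}^{H}\tilde A^jBM^{[i-j-1]}\mathbf 1_{1\le i-j\le H},\quad v(M)=-\mathbb Ky(M)+\sum_{i=1}^HM^{[i-1]}\xi_{i-1},$$ and $f_t(M)=\mathbb E[c_t(y(M),v(M))]$. Let $J$ be the (random) Jacobian of the affine map $M_{\rm vec}\mapsto(y(M),v(M))$ and $P=\mathbb E[J^\top J]$. Starting from an arbitrary $M_0\in\mathcal M$, the algorithm $\mathcal A$ plays, in round $t$, $$u_t=-\mathbb Kx_t+\sum_{i=1}^HM_t^{[i-1]}w_{t-i}\qquad(w_s=0\text{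 for }s<0)$$ and updates $$M_{t+1}=\Pi_{\mathcal M}\bigl(M_t-\eta_tP^{-1}\nabla f_t(M_t)\bigr),\qquad \eta_t=\frac{a}{\alpha(t+1)},$$ where $a\ge1$ and $\Pi_{\mathcal M}$ is the projection onto $\mathcal M$ in the norm $\|v\|_P=\sqrt{v^\top Pv}$. For a controller $\pi$ let $J_T(\pi)=\mathbb E\bigl[\sum_{t=0}^{T-1}c_t(x_t,u_t)\bigr]$ be the expected cost of its trajectory, and let $J_T(K)$ be the cost of $u_t=-Kx_t$. Then $$J_T(\mathcal A)-\min_{K\in\mathcal K}J_T(K)\ \le\ a\,p(\gamma^{-1},\kappa_B,\kappa,d)\ \frac{GW^2}{\alpha\mu}\,\log^7T,\qquad \mu^{-1}:=\max_{0\le t<T}\ \max_{M\in\mathcal M}\bigl\|P^{-1}\nabla f_t(M)\bigr\|,$$ where $p$ is a universal polynomial (independent of the system, the costs, the noise, $T$ and $a$). -/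

import Mathlib

open MeasureTheory ProbabilityTheory
open scoped Matrix.Norms.L2Operator

namespace OnlineControl

noncomputable section

/-- States and disturbances, `ℝ^dx` with the Euclidean norm; also used for controls, `ℝ^du`. -/
abbrev Vec (n : ℕ) := EuclideanSpace ℝ (Fin n)

/-- Real matrices; `‖·‖` on matrices is the spectral norm throughout. -/
abbrev Mat (m n : ℕ) := Matrix (Fin m) (Fin n) ℝ

/-- Matrix-vector product. -/
def app {m n : ℕ} (S : Mat m n) (x : Vec n) : Vec m := Matrix.toEuclideanLin S x

/-! ### Assumptions on the system -/

/-- `K` is `(κ, γ)`-diagonal strongly stable for the dynamics `(A, B)`. -/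
def DiagStronglyStable {dx du : ℕ} (A : Mat dx dx) (B : Mat dx du) (κ γ : ℝ)
    (K : Mat du dx) : Prop :=
  ∃ (l : Fin dx → ℂ) (Q : Matrix (Fin dx) (Fin dx) ℂ),
    IsUnit Q ∧
    (A - B * K).map (algebraMap ℝ ℂ) = Q * Matrix.diagonal l * Q⁻¹ ∧
    ‖(Matrix.diagonal l : Matrix (Fin dx) (Fin dx) ℂ)‖ ≤ 1 - γ ∧
    ‖K‖ ≤ κ ∧ ‖Q‖ ≤ κ ∧ ‖Q⁻¹‖ ≤ κ

/-- The disturbance law `ν` is bounded by `W`, centred, and has covariance `⪰ σ² I`. -/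
structure NoiseLaw {dx : ℕ} (ν : Measure (Vec dx)) (σ W : ℝ) : Prop where
  isProb : IsProbabilityMeasure ν
  bounded : ∀ᵐ w ∂ν, ‖w‖ ≤ W
  centred : ∫ w, w ∂ν = 0
  covariance : (Matrix.of (fun a b : Fin dx => ∫ w, w a * w b ∂ν)
    - σ ^ 2 • (1 : Mat dx dx)).PosSemidef

/-- The cost `c(x, u)` is differentiable and jointly `α`-strongly convex (Euclidean norm on
state-control pairs), and its partial gradients are bounded by `G D` on `‖x‖, ‖u‖ ≤ D`. -/
structure CostClass {dx du : ℕ} (c : Vec dx → Vec du → ℝ) (α G : ℝ) : Prop where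
  differentiable : Differentiable ℝ (fun z : WithLp 2 (Vec dx × Vec du) => c z.fst z.snd)
  strongConvex : StrongConvexOn Set.univ α
    (fun z : WithLp 2 (Vec dx × Vec du) => c z.fst z.snd)
  grad_bound : ∀ (D : ℝ) (x : Vec dx) (u : Vec du), ‖x‖ ≤ D → ‖u‖ ≤ D →
    ‖gradient (fun x' => c x' u) x‖ ≤ G * D ∧ ‖gradient (fun u' => c x u') u‖ ≤ G * D

/-! ### Trajectories and costs

Rounds are numbered `0, 1, …, T - 1` and the initial state is `x 0 = 0`. -/

/-- A controller: the control as a function of the round `t`, the current state and the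
disturbance sequence. The controllers below only read disturbances of earlier rounds. -/
abbrev Controller (dx du : ℕ) := ℕ → Vec dx → (ℕ → Vec dx) → Vec du

/-- `x (t+1) = A x t + B u t + w t`, started at `0`. -/
def state {dx du : ℕ} (A : Mat dx dx) (B : Mat dx du) (π : Controller dx du)
    (w : ℕ → Vec dx) : ℕ → Vec dx
  | 0 => 0
  | t + 1 => app A (state A B π w t) + app B (π t (state A B π w t) w) + w t

/-- The expected total cost `J_T(π)` under the disturbance process `w`. -/
def totalCost {dx du : ℕ} {Ω : Type*} [MeasurableSpace Ω] (P : Measure Ω)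
    (w : ℕ → Ω → Vec dx) (A : Mat dx dx) (B : Mat dx du) (c : ℕ → Vec dx → Vec du → ℝ)
    (T : ℕ) (π : Controller dx du) : ℝ :=
  ∫ ω, ∑ t ∈ Finset.range T,
    c t (state A B π (fun s => w s ω) t)
      (π t (state A B π (fun s => w s ω) t) (fun s => w s ω)) ∂P

/-- The linear controller `u = -K x`. -/
def linearController {dx du : ℕ} (K : Mat du dx) : Controller dx du :=
  fun _ x _ => - app K x

/-! ### Disturbance-action policies -/

/-- The flattened policy parameter `M_vec` of `M = (M^[0], …, M^[H-1])`, with the Euclidean norm: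
the coordinate `(i, a, b)` is the entry `(a, b)` of `M^[i]`. -/
abbrev Policy (H dx du : ℕ) := EuclideanSpace ℝ (Fin H × Fin du × Fin dx)

/-- The matrix `M^[i]`. -/
def Policy.block {H dx du : ℕ} (M : Policy H dx du) (i : Fin H) : Mat du dx :=
  Matrix.of fun a b => M (i, a, b)

/-- The controller playing, in round `t`,
`u t = -𝕂 x t + ∑_{i=1}^H (M t)^[i-1] w (t-i)`, where disturbances before round `0` are zero. -/
def policyController {H dx du : ℕ} (Kst : Mat du dx) (M : ℕ → Policy H dx du) :
    Controller dx du :=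
  fun t x w => - app Kst x
    + ∑ i : Fin H, if (i : ℕ) + 1 ≤ t then app ((M t).block i) (w (t - (i + 1))) else 0

/-- The set `𝓜`: `‖M^[i-1]‖ ≤ κ³ κ_B (1-γ)^i` for `i = 1, …, H`. -/
def policySet (H dx du : ℕ) (κ κB γ : ℝ) : Set (Policy H dx du) :=
  {M | ∀ i : Fin H, ‖M.block i‖ ≤ κ ^ 3 * κB * (1 - γ) ^ ((i : ℕ) + 1)}

/-! ### Surrogate state, action and cost -/

/-- The disturbance-state transfer matrix at a constant policy `M`, with `Ã = A - B 𝕂`: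
`Ψ_i(M) = Ã^i 1_{i ≤ H} + ∑_{j=0}^H Ã^j B M^[i-j-1] 1_{i-j ∈ [1,H]}`. -/
def transfer {H dx du : ℕ} (A : Mat dx dx) (B : Mat dx du) (Kst : Mat du dx)
    (M : Policy H dx du) (i : ℕ) : Mat dx dx :=
  (if i ≤ H then (A - B * Kst) ^ i else 0)
    + ∑ j ∈ Finset.range (H + 1),
        if h : j + 1 ≤ i ∧ i ≤ j + H then
          (A - B * Kst) ^ j * B * M.block ⟨i - j - 1, by omega⟩
        else 0

/-- The surrogate state. The disturbances are listed backwards in time: `ξ i` is the one that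
occurred `i + 1` steps before the surrogate state. -/
def surrogateState {H dx du : ℕ} (A : Mat dx dx) (B : Mat dx du) (Kst : Mat du dx)
    (M : Policy H dx du) (ξ : Fin (2 * H + 1) → Vec dx) : Vec dx :=
  ∑ i : Fin (2 * H + 1), app (transfer A B Kst M i) (ξ i)

/-- The surrogate action. -/
def surrogateAction {H dx du : ℕ} (A : Mat dx dx) (B : Mat dx du) (Kst : Mat du dx)
    (M : Policy H dx du) (ξ : Fin (2 * H + 1) → Vec dx) : Vec du :=
  - app Kst (surrogateState A B Kst M ξ)
    + ∑ i : Fin H, app (M.block i) (ξ (Fin.castLE (by omega) i))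

/-- The stacked vector `z(M) = (y(M), v(M))`. -/
def surrogatePair {H dx du : ℕ} (A : Mat dx dx) (B : Mat dx du) (Kst : Mat du dx)
    (M : Policy H dx du) (ξ : Fin (2 * H + 1) → Vec dx) : WithLp 2 (Vec dx × Vec du) :=
  WithLp.toLp 2 (surrogateState A B Kst M ξ, surrogateAction A B Kst M ξ)

/-- The surrogate cost `f(M) = 𝔼[c(y(M), v(M))]`, over independent disturbances of law `ν`. -/
def surrogateCost {H dx du : ℕ} (ν : Measure (Vec dx)) (A : Mat dx dx) (B : Mat dx du)
    (Kst : Mat du dx) (c : Vec dx → Vec du → ℝ) (M : Policy H dx du) : ℝ :=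
  ∫ ξ, c (surrogateState A B Kst M ξ) (surrogateAction A B Kst M ξ)
    ∂(Measure.pi fun _ : Fin (2 * H + 1) => ν)

/-- The `p`-th column of the Jacobian `J` of `M_vec ↦ z(M)`; since `z` is affine in `M_vec`, it is
the increment of `z` along the `p`-th basis vector. -/
def jacobianCol {H dx du : ℕ} (A : Mat dx dx) (B : Mat dx du) (Kst : Mat du dx)
    (ξ : Fin (2 * H + 1) → Vec dx) (p : Fin H × Fin du × Fin dx) :
    WithLp 2 (Vec dx × Vec du) :=
  surrogatePair A B Kst (EuclideanSpace.single p (1 : ℝ)) ξ - surrogatePair A B Kst 0 ξ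

/-- The preconditioner `𝔼[Jᵀ J]`. -/
def gram (H : ℕ) {dx du : ℕ} (ν : Measure (Vec dx)) (A : Mat dx dx) (B : Mat dx du)
    (Kst : Mat du dx) : Matrix (Fin H × Fin du × Fin dx) (Fin H × Fin du × Fin dx) ℝ :=
  Matrix.of fun p q => ∫ ξ, inner ℝ (jacobianCol A B Kst ξ p) (jacobianCol A B Kst ξ q)
    ∂(Measure.pi fun _ : Fin (2 * H + 1) => ν)

/-- The natural gradient `(𝔼[Jᵀ J])⁻¹ ∇f(M)`. -/
def naturalGradient {H dx du : ℕ} (ν : Measure (Vec dx)) (A : Mat dx dx) (B : Mat dx du)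
    (Kst : Mat du dx) (c : Vec dx → Vec du → ℝ) (M : Policy H dx du) : Policy H dx du :=
  Matrix.toEuclideanLin (gram H ν A B Kst)⁻¹ (gradient (surrogateCost ν A B Kst c) M)

/-! ### The algorithm -/

/-- `‖v‖²_S = vᵀ S v`. -/
def weightedSq {ι : Type*} [Fintype ι] (S : Matrix ι ι ℝ) (v : EuclideanSpace ℝ ι) : ℝ :=
  dotProduct v.ofLp (S.mulVec v.ofLp)

/-- `q` is a projection of `p` onto `C` in the norm `‖·‖_S`. -/
def IsProjection {ι : Type*} [Fintype ι] (S : Matrix ι ι ℝ) (C : Set (EuclideanSpace ℝ ι))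
    (p q : EuclideanSpace ℝ ι) : Prop :=
  q ∈ C ∧ ∀ r ∈ C, weightedSq S (q - p) ≤ weightedSq S (r - p)

/-- The memory length `H = γ⁻¹ log(T κ²)`, rounded up. -/
def memory (κ γ : ℝ) (T : ℕ) : ℕ := ⌈γ⁻¹ * Real.log (T * κ ^ 2)⌉₊

/-- `M 0, M 1, …` are the policies of a run of the online natural gradient algorithm over `T`
rounds with step sizes `η`: arbitrary start in `𝓜`, then
`M (t+1) = Π_𝓜 (M t - η t (𝔼[JᵀJ])⁻¹ ∇f_t(M t))`, with the projection taken in the norm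
of the preconditioner. -/
def IsNaturalGradientRun {H dx du : ℕ} (ν : Measure (Vec dx)) (A : Mat dx dx) (B : Mat dx du)
    (Kst : Mat du dx) (c : ℕ → Vec dx → Vec du → ℝ) (κ κB γ : ℝ) (T : ℕ) (η : ℕ → ℝ)
    (M : ℕ → Policy H dx du) : Prop :=
  M 0 ∈ policySet H dx du κ κB γ ∧
  ∀ t < T, IsProjection (gram H ν A B Kst) (policySet H dx du κ κB γ)
    (M t - η t • naturalGradient ν A B Kst (c t) (M t)) (M (t + 1))

/-- `μ⁻¹`: the largest norm of the natural gradient over `𝓜` and over the `T` rounds. -/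
def muInv (H : ℕ) {dx du : ℕ} (ν : Measure (Vec dx)) (A : Mat dx dx) (B : Mat dx du)
    (Kst : Mat du dx) (c : ℕ → Vec dx → Vec du → ℝ) (κ κB γ : ℝ) (T : ℕ) : ℝ :=
  sSup {r | ∃ t < T, ∃ M ∈ policySet H dx du κ κB γ, r = ‖naturalGradient ν A B Kst (c t) M‖}

end

end OnlineControl

open OnlineControl

/-!
Unrolling the dynamics of an exponentially stable gain writes every state as a geometrically
decaying sum of past inputs. Hence a linear controller is imitated, up to an error
`(1 - γ) ^ H ≤ 1 / T` per round, by a single disturbance-action policy in `𝓜`, and after the first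
`2 H + 1` rounds the expected cost of a round is close to the surrogate cost of the current policy:
the discrepancy is a truncation error of the same size plus the drift of the policy over the last
`H` rounds, which is of the order of the step sizes.

For the surrogate costs, `E‖J N‖²` is exactly the square of the `P`-norm of `N`, so a jointly
`α`-strongly convex cost gives a surrogate that is `α`-strongly convex in the `P`-norm. In that
norm the algorithm is projected gradient descent with steps of order `1 / (α t)`, and its regret
is logarithmic.

Two kinds of error do not contain `μ⁻¹`: the early rounds and the truncation. They are absorbed
because strong convexity forces the natural gradient to vary by at least `α ‖Δ‖` along a segment
of direction `Δ`; as `𝓜` contains a unit vector, `α` is at most a polynomial multiple of `μ⁻¹`.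
-/

namespace OnlineControl

section Probability

variable {Ω : Type*} [MeasurableSpace Ω] {P : Measure Ω}

theorem integrable_comp_of_ae_mem_isCompact {E F : Type*} [IsFiniteMeasure P]
    [TopologicalSpace E] [TopologicalSpace.PseudoMetrizableSpace E] [SecondCountableTopology E]
    [MeasurableSpace E] [OpensMeasurableSpace E] [NormedAddCommGroup F] {X : Ω → E}
    (hX : Measurable X) {S : Set E} (hS : IsCompact S) (hXS : ∀ᵐ ω ∂P, X ω ∈ S) {g : E → F}
    (hg : Continuous g) : Integrable (fun ω => g (X ω)) P := by
  obtain ⟨C, hC⟩ := hS.exists_bound_of_continuousOn hg.continuousOn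
  refine Integrable.of_bound (hg.comp_aestronglyMeasurable hX.aestronglyMeasurable) C ?_
  filter_upwards [hXS] with ω hω
  exact hC _ hω

theorem integral_norm_le_sqrt_integral_norm_sq {E : Type*} [IsProbabilityMeasure P]
    [NormedAddCommGroup E] {X : Ω → E} (h1 : Integrable (fun ω => ‖X ω‖) P)
    (h2 : Integrable (fun ω => ‖X ω‖ ^ 2) P) :
    ∫ ω, ‖X ω‖ ∂P ≤ √(∫ ω, ‖X ω‖ ^ 2 ∂P) :=
  Real.le_sqrt_of_sq_le <| even_two.convexOn_pow.map_integral_le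
    (continuous_pow 2).continuousOn isClosed_univ (by simp) h1 h2

/-- The family `X` is independent and identically distributed with law `ν`. -/
structure IsIID {ι E : Type*} [MeasurableSpace E] (X : ι → Ω → E) (ν : Measure E)
    (P : Measure Ω) : Prop where
  measurable : ∀ i, Measurable (X i)
  map_eq : ∀ i, P.map (X i) = ν
  indep : iIndepFun X P

namespace IsIID

variable {ι ι' E : Type*} [MeasurableSpace E] {X : ι → Ω → E} {ν : Measure E}

theorem precomp (h : IsIID X ν P) {r : ι' → ι} (hr : r.Injective) :
    IsIID (fun i => X (r i)) ν P :=
  ⟨fun i => h.measurable (r i), fun i => h.map_eq (r i), h.indep.precomp hr⟩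

theorem ae_of_ae (h : IsIID X ν P) {p : E → Prop} (hp : ∀ᵐ x ∂ν, p x) (i : ι) :
    ∀ᵐ ω ∂P, p (X i ω) :=
  ae_of_ae_map (h.measurable i).aemeasurable ((h.map_eq i).symm ▸ hp)

theorem integral_comp {F : Type*} [NormedAddCommGroup F] [NormedSpace ℝ F] (h : IsIID X ν P)
    (i : ι) {g : E → F} (hg : AEStronglyMeasurable g ν) :
    ∫ ω, g (X i ω) ∂P = ∫ x, g x ∂ν := by
  rw [← h.map_eq i] at hg ⊢
  exact (integral_map (h.measurable i).aemeasurable hg).symm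

theorem map_pi_eq [Fintype ι] [IsProbabilityMeasure P] (h : IsIID X ν P) :
    P.map (fun ω i => X i ω) = Measure.pi fun _ => ν := by
  simpa only [h.map_eq] using
    (iIndepFun_iff_map_fun_eq_pi_map fun i => (h.measurable i).aemeasurable).1 h.indep

theorem eval_pi [Fintype ι] (ν : Measure E) [IsProbabilityMeasure ν] :
    IsIID (fun (i : ι) (ξ : ι → E) => ξ i) ν (Measure.pi fun _ => ν) where
  measurable := measurable_pi_apply
  map_eq i := (measurePreserving_eval (fun _ => ν) i).map_eq
  indep := iIndepFun_pi (X := fun (_ : ι) (x : E) => x) fun _ => aemeasurable_id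

end IsIID

end Probability

section Matrix

variable {l m n : ℕ}

theorem app_apply (S : Mat m n) (x : Vec n) (a : Fin m) : app S x a = ∑ b, S a b * x b := by
  simp [app, Matrix.toLpLin_apply, Matrix.mulVec, dotProduct]

@[simp] theorem app_zero (S : Mat m n) : app S 0 = 0 := map_zero _

@[simp] theorem zero_app (x : Vec n) : app (0 : Mat m n) x = 0 := by simp [app]

theorem app_add (S : Mat m n) (x y : Vec n) : app S (x + y) = app S x + app S y := map_add _ x y

theorem app_sub (S : Mat m n) (x y : Vec n) : app S (x - y) = app S x - app S y := map_sub _ x y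

theorem app_sum {ι : Type*} (s : Finset ι) (S : Mat m n) (x : ι → Vec n) :
    app S (∑ i ∈ s, x i) = ∑ i ∈ s, app S (x i) := map_sum _ x s

theorem add_app (S R : Mat m n) (x : Vec n) : app (S + R) x = app S x + app R x := by simp [app]

theorem sub_app (S R : Mat m n) (x : Vec n) : app (S - R) x = app S x - app R x := by simp [app]

theorem smul_app (r : ℝ) (S : Mat m n) (x : Vec n) : app (r • S) x = r • app S x := by simp [app]

theorem sum_app {ι : Type*} (s : Finset ι) (S : ι → Mat m n) (x : Vec n) :
    app (∑ i ∈ s, S i) x = ∑ i ∈ s, app (S i) x := by simp [app]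

theorem mul_app (S : Mat l m) (R : Mat m n) (x : Vec n) : app (S * R) x = app S (app R x) := by
  simp [app, Matrix.toLpLin_apply, Matrix.mulVec_mulVec]

@[simp] theorem one_app (x : Vec n) : app (1 : Mat n n) x = x := by simp [app]

theorem norm_app_le (S : Mat m n) (x : Vec n) : ‖app S x‖ ≤ ‖S‖ * ‖x‖ :=
  Matrix.l2_opNorm_mulVec S x

theorem continuous_app (S : Mat m n) : Continuous (app S) :=
  LinearMap.continuous_of_finiteDimensional (Matrix.toEuclideanLin S)

@[fun_prop] theorem continuous_app_comp {X : Type*} [TopologicalSpace X] (S : Mat m n)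
    {f : X → Vec n} (hf : Continuous f) : Continuous fun x => app S (f x) :=
  (continuous_app S).comp hf

theorem norm_le_of_forall_norm_app_le (S : Mat m n) {C : ℝ} (hC : 0 ≤ C)
    (h : ∀ x, ‖app S x‖ ≤ C * ‖x‖) : ‖S‖ ≤ C := by
  rw [Matrix.l2_opNorm_def]
  exact ContinuousLinearMap.opNorm_le_bound _ hC h

theorem norm_le_norm_map_complex (S : Mat m n) : ‖S‖ ≤ ‖S.map (algebraMap ℝ ℂ)‖ := by
  refine norm_le_of_forall_norm_app_le S (norm_nonneg _) fun x => ?_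
  have hx : ‖(WithLp.toLp 2 fun b => (x b : ℂ) : EuclideanSpace ℂ (Fin n))‖ = ‖x‖ := by
    simp [EuclideanSpace.norm_eq]
  have hSx : (EuclideanSpace.equiv (Fin m) ℂ).symm ((S.map (algebraMap ℝ ℂ)).mulVec
      (WithLp.toLp 2 fun b => (x b : ℂ) : EuclideanSpace ℂ (Fin n)).ofLp)
      = WithLp.toLp 2 fun a => (app S x a : ℂ) := by
    ext a
    simp [app_apply, Matrix.mulVec, dotProduct]
  have h := Matrix.l2_opNorm_mulVec (S.map (algebraMap ℝ ℂ))
    (WithLp.toLp 2 fun b => (x b : ℂ))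
  rwa [hx, hSx, show ‖(WithLp.toLp 2 fun a => (app S x a : ℂ) : EuclideanSpace ℂ (Fin m))‖
    = ‖app S x‖ by simp [EuclideanSpace.norm_eq]] at h

theorem norm_app_sq_le_sum_sq (S : Mat m n) (x : Vec n) :
    ‖app S x‖ ^ 2 ≤ (∑ a, ∑ b, S a b ^ 2) * ‖x‖ ^ 2 := by
  rw [EuclideanSpace.real_norm_sq_eq, EuclideanSpace.real_norm_sq_eq, Finset.sum_mul]
  refine Finset.sum_le_sum fun a _ => ?_
  rw [app_apply]
  exact Finset.sum_mul_sq_le_sq_mul_sq _ _ _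

theorem norm_conj_diagonal_pow_le {Q : Matrix (Fin n) (Fin n) ℂ} (hQ : IsUnit Q)
    (d : Fin n → ℂ) (j : ℕ) :
    ‖(Q * Matrix.diagonal d * Q⁻¹) ^ j‖ ≤ ‖Q‖ * ‖Matrix.diagonal d‖ ^ j * ‖Q⁻¹‖ := by
  obtain ⟨u, rfl⟩ := hQ
  have hpow : ‖(Matrix.diagonal d) ^ j‖ ≤ ‖Matrix.diagonal d‖ ^ j := by
    rw [Matrix.diagonal_pow, Matrix.l2_opNorm_diagonal, Matrix.l2_opNorm_diagonal]
    refine (pi_norm_le_iff_of_nonneg (by positivity)).2 fun i => ?_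
    rw [Pi.pow_apply, norm_pow]
    gcongr
    exact norm_le_pi_norm d i
  rw [← Matrix.coe_units_inv, Units.conj_pow]
  calc _ ≤ ‖(u : Matrix (Fin n) (Fin n) ℂ)‖ * ‖(Matrix.diagonal d) ^ j‖ * ‖(u⁻¹).val‖ :=
        norm_mul₃_le
    _ ≤ _ := by gcongr

end Matrix

/-- The gain `K` is bounded and the powers of the closed loop `A - B K` decay geometrically: the
part of `(κ, γ)`-diagonal strong stability that the regret analysis uses. -/
structure ExponentiallyStable {dx du : ℕ} (A : Mat dx dx) (B : Mat dx du) (κ γ : ℝ)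
    (K : Mat du dx) : Prop where
  norm_le : ‖K‖ ≤ κ
  norm_pow_le : ∀ j : ℕ, ‖(A - B * K) ^ j‖ ≤ κ ^ 2 * (1 - γ) ^ j

theorem DiagStronglyStable.exponentiallyStable {dx du : ℕ} {A : Mat dx dx} {B : Mat dx du}
    {κ γ : ℝ} {K : Mat du dx} (h : DiagStronglyStable A B κ γ K) :
    ExponentiallyStable A B κ γ K := by
  obtain ⟨d, Q, hQ, hA, hd, hK, hQn, hQi⟩ := h
  refine ⟨hK, fun j => ?_⟩
  have hκ : 0 ≤ κ := (norm_nonneg _).trans hK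
  have hγ : 0 ≤ 1 - γ := (norm_nonneg _).trans hd
  calc ‖(A - B * K) ^ j‖ ≤ ‖((A - B * K) ^ j).map (algebraMap ℝ ℂ)‖ := norm_le_norm_map_complex _
    _ = ‖(Q * Matrix.diagonal d * Q⁻¹) ^ j‖ := by rw [← hA, Matrix.map_pow]
    _ ≤ ‖Q‖ * ‖Matrix.diagonal d‖ ^ j * ‖Q⁻¹‖ := norm_conj_diagonal_pow_le hQ d j
    _ ≤ κ * (1 - γ) ^ j * κ := by gcongr
    _ = κ ^ 2 * (1 - γ) ^ j := by ring

theorem sum_range_one_sub_pow_le {γ : ℝ} (hγ : 0 < γ) (hγ1 : γ < 1) (n : ℕ) :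
    ∑ j ∈ Finset.range n, (1 - γ) ^ j ≤ γ⁻¹ := by
  rw [Finset.range_eq_Ico]
  simpa using geom_sum_Ico_le_of_lt_one (m := 0) (n := n) (sub_nonneg.2 hγ1.le) (sub_lt_self 1 hγ)

/-! ### Second moments of linear functions of the disturbances -/

namespace NoiseLaw

variable {dx m : ℕ} {ν : Measure (Vec dx)} {σ W : ℝ}

theorem bound_nonneg (h : NoiseLaw ν σ W) : 0 ≤ W := by
  have := h.isProb
  obtain ⟨w, hw⟩ := h.bounded.exists
  exact (norm_nonneg w).trans hw

theorem integrable (h : NoiseLaw ν σ W) {F : Type*} [NormedAddCommGroup F] {g : Vec dx → F}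
    (hg : Continuous g) : Integrable g ν := by
  have := h.isProb
  exact integrable_comp_of_ae_mem_isCompact measurable_id (isCompact_closedBall 0 W)
    (by simpa using h.bounded) hg

theorem integral_app (h : NoiseLaw ν σ W) (N : Mat m dx) : ∫ w, app N w ∂ν = 0 := by
  have := (Matrix.toEuclideanLin N).toContinuousLinearMap.integral_comp_comm
    (h.integrable continuous_id)
  simp only [id, h.centred, map_zero] at this
  exact this

theorem integral_norm_sq_le (h : NoiseLaw ν σ W) : ∫ w, ‖w‖ ^ 2 ∂ν ≤ W ^ 2 := by
  have := h.isProb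
  calc ∫ w, ‖w‖ ^ 2 ∂ν ≤ ∫ _, W ^ 2 ∂ν := by
        refine integral_mono_ae (h.integrable (by fun_prop)) (integrable_const _) ?_
        filter_upwards [h.bounded] with w hw
        gcongr
    _ = W ^ 2 := by simp

theorem integral_sq_eq_dotProduct_mulVec (h : NoiseLaw ν σ W) (v : Fin dx → ℝ) :
    ∫ w, (∑ b, v b * w b) ^ 2 ∂ν
      = v ⬝ᵥ (Matrix.of fun a b : Fin dx => ∫ w, w a * w b ∂ν).mulVec v := by
  have hsq : ∀ w : Vec dx, (∑ b, v b * w b) ^ 2 = ∑ a, ∑ b, v a * v b * (w a * w b) := fun w => by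
    rw [sq, Finset.sum_mul_sum]
    exact Finset.sum_congr rfl fun a _ => Finset.sum_congr rfl fun b _ => by ring
  simp only [hsq, dotProduct, Matrix.mulVec, Matrix.of_apply, Finset.mul_sum]
  rw [integral_finsetSum _ fun a _ => h.integrable (by fun_prop)]
  refine Finset.sum_congr rfl fun a _ => ?_
  rw [integral_finsetSum _ fun b _ => h.integrable (by fun_prop)]
  refine Finset.sum_congr rfl fun b _ => ?_
  rw [integral_const_mul]
  ring

theorem sq_mul_sum_sq_le_integral_sq (h : NoiseLaw ν σ W) (v : Fin dx → ℝ) :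
    σ ^ 2 * ∑ b, v b ^ 2 ≤ ∫ w, (∑ b, v b * w b) ^ 2 ∂ν := by
  have hcov := h.covariance.dotProduct_mulVec_nonneg v
  rw [star_trivial, Matrix.sub_mulVec, dotProduct_sub, Matrix.smul_mulVec, Matrix.one_mulVec,
    dotProduct_smul, ← h.integral_sq_eq_dotProduct_mulVec, sub_nonneg] at hcov
  simpa only [dotProduct, ← sq, smul_eq_mul] using hcov

theorem sq_mul_sum_sq_le_integral_norm_app_sq (h : NoiseLaw ν σ W) (N : Mat m dx) :
    σ ^ 2 * ∑ a, ∑ b, N a b ^ 2 ≤ ∫ w, ‖app N w‖ ^ 2 ∂ν := by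
  simp_rw [EuclideanSpace.real_norm_sq_eq, app_apply]
  rw [integral_finsetSum _ fun a _ => h.integrable (by fun_prop), Finset.mul_sum]
  exact Finset.sum_le_sum fun a _ => h.sq_mul_sum_sq_le_integral_sq _

theorem integral_norm_app_sq_le (h : NoiseLaw ν σ W) (N : Mat m dx) :
    ∫ w, ‖app N w‖ ^ 2 ∂ν ≤ (∑ a, ∑ b, N a b ^ 2) * ∫ w, ‖w‖ ^ 2 ∂ν := by
  rw [← integral_const_mul]
  exact integral_mono (h.integrable (by fun_prop)) (h.integrable (by fun_prop))
    fun w => norm_app_sq_le_sum_sq N w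

section Independent

variable {Ω : Type*} [MeasurableSpace Ω] {P : Measure Ω} {ι : Type*}
  {X : ι → Ω → Vec dx}

theorem integral_inner_app_of_ne (h : NoiseLaw ν σ W) (hX : IsIID X ν P) (N R : Mat m dx)
    {i j : ι} (hij : i ≠ j) : ∫ ω, inner ℝ (app N (X i ω)) (app R (X j ω)) ∂P = 0 := by
  have hprod : ∫ ω, inner ℝ (app N (X i ω)) (app R (X j ω)) ∂P
      = inner ℝ (∫ ω, app N (X i ω) ∂P) (∫ ω, app R (X j ω) ∂P) :=
    (hX.indep.indepFun hij).integral_bilin_comp_comp (f := app N) (g := app R)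
      (hX.measurable i).aemeasurable (hX.measurable j).aemeasurable
      (by rw [hX.map_eq]; exact h.integrable (continuous_app _))
      (by rw [hX.map_eq]; exact h.integrable (continuous_app _)) (innerSL ℝ)
  rw [hprod, hX.integral_comp i (continuous_app N).aestronglyMeasurable, h.integral_app,
    inner_zero_left]

theorem ae_forall_norm_le [Countable ι] (h : NoiseLaw ν σ W) (hX : IsIID X ν P) :
    ∀ᵐ ω ∂P, ∀ i, ‖X i ω‖ ≤ W :=
  ae_all_iff.2 (hX.ae_of_ae h.bounded)

-- By Tychonoff's theorem the disturbances stay in a compact set, even if there are infinitely many.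
theorem integrable_comp [Countable ι] [IsFiniteMeasure P] (h : NoiseLaw ν σ W) (hX : IsIID X ν P)
    {F : Type*} [NormedAddCommGroup F] {g : (ι → Vec dx) → F} (hg : Continuous g) :
    Integrable (fun ω => g fun i => X i ω) P :=
  integrable_comp_of_ae_mem_isCompact (measurable_pi_iff.2 hX.measurable)
    (isCompact_univ_pi fun _ => isCompact_closedBall 0 W)
    ((h.ae_forall_norm_le hX).mono fun _ hω i _ => mem_closedBall_zero_iff.2 (hω i)) hg

variable [Fintype ι]

theorem integral_norm_sum_app_sq [IsFiniteMeasure P] (h : NoiseLaw ν σ W) (hX : IsIID X ν P)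
    (N : ι → Mat m dx) :
    ∫ ω, ‖∑ i, app (N i) (X i ω)‖ ^ 2 ∂P = ∑ i, ∫ w, ‖app (N i) w‖ ^ 2 ∂ν := by
  have hint : ∀ i j, Integrable (fun ω => inner ℝ (app (N i) (X i ω)) (app (N j) (X j ω))) P :=
    fun i j => h.integrable_comp hX
      (g := fun ξ => inner ℝ (app (N i) (ξ i)) (app (N j) (ξ j))) (by fun_prop)
  simp_rw [← real_inner_self_eq_norm_sq, sum_inner, inner_sum]
  rw [integral_finsetSum _ fun i _ => integrable_finsetSum _ fun j _ => hint i j]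
  refine Finset.sum_congr rfl fun i _ => ?_
  rw [integral_finsetSum _ fun j _ => hint i j, Finset.sum_eq_single i
    (fun j _ hji => h.integral_inner_app_of_ne hX _ _ hji.symm) (by simp)]
  exact hX.integral_comp i (g := fun w => inner ℝ (app (N i) w) (app (N i) w))
    (Continuous.aestronglyMeasurable (by fun_prop))

end Independent

theorem integrable_pi {ι : Type*} [Fintype ι] (h : NoiseLaw ν σ W) {F : Type*}
    [NormedAddCommGroup F] {g : (ι → Vec dx) → F} (hg : Continuous g) :
    Integrable g (Measure.pi fun _ => ν) := by
  have := h.isProb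
  exact h.integrable_comp (IsIID.eval_pi ν) hg

theorem ae_pi_norm_le {ι : Type*} [Fintype ι] (h : NoiseLaw ν σ W) :
    ∀ᵐ ξ ∂(Measure.pi fun _ : ι => ν), ‖ξ‖ ≤ W := by
  have := h.isProb
  filter_upwards [h.ae_forall_norm_le (IsIID.eval_pi ν)] with ξ hξ
  exact (pi_norm_le_iff_of_nonneg h.bound_nonneg).2 hξ

theorem integral_pi_norm_sum_app_sq (h : NoiseLaw ν σ W) {ι ι' : Type*} [Fintype ι] [Fintype ι']
    {r : ι' → ι} (hr : r.Injective) (N : ι' → Mat m dx) :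
    ∫ ξ, ‖∑ i, app (N i) (ξ (r i))‖ ^ 2 ∂(Measure.pi fun _ : ι => ν)
      = ∑ i, ∫ w, ‖app (N i) w‖ ^ 2 ∂ν := by
  have := h.isProb
  exact h.integral_norm_sum_app_sq ((IsIID.eval_pi ν).precomp hr) N

end NoiseLaw

/-! ### The surrogate as an affine function of the policy -/

section Surrogate

variable {H dx du : ℕ}

namespace Policy

theorem block_apply (M : Policy H dx du) (i : Fin H) (a : Fin du) (b : Fin dx) :
    M.block i a b = M (i, a, b) := rfl

@[simp] theorem block_zero (i : Fin H) : (0 : Policy H dx du).block i = 0 := by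
  ext; simp [block_apply]

theorem block_add (M N : Policy H dx du) (i : Fin H) :
    (M + N).block i = M.block i + N.block i := by
  ext a b; simp [block_apply]

theorem block_smul (r : ℝ) (M : Policy H dx du) (i : Fin H) :
    (r • M).block i = r • M.block i := by
  ext a b; simp [block_apply]

theorem norm_sq_eq (M : Policy H dx du) : ‖M‖ ^ 2 = ∑ i, ∑ a, ∑ b, M.block i a b ^ 2 := by
  rw [EuclideanSpace.real_norm_sq_eq, Fintype.sum_prod_type]
  refine Finset.sum_congr rfl fun i _ => ?_
  rw [Fintype.sum_prod_type]
  rfl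

/-- The control `∑_k M^[k] ζ_k` that a policy `M` adds to the stabilizing feedback when the last
`H` disturbances are `ζ`, as a linear map in `M`. -/
noncomputable def act (ζ : Fin H → Vec dx) : Policy H dx du →ₗ[ℝ] Vec du where
  toFun M := ∑ k, app (M.block k) (ζ k)
  map_add' M N := by simp [block_add, add_app, Finset.sum_add_distrib]
  map_smul' r M := by simp [block_smul, smul_app, Finset.smul_sum]

theorem act_apply (ζ : Fin H → Vec dx) (M : Policy H dx du) :
    act ζ M = ∑ k, app (M.block k) (ζ k) := rfl

@[fun_prop] theorem continuous_act_comp {X : Type*} [TopologicalSpace X] (M : Policy H dx du)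
    {ζ : X → Fin H → Vec dx} (hζ : Continuous ζ) : Continuous fun x => act (ζ x) M := by
  simp only [act_apply]
  fun_prop

end Policy

/-- The `H` surrogate disturbances preceding `ξ j`. -/
def window (ξ : Fin (2 * H + 1) → Vec dx) (j : Fin (H + 1)) : Fin H → Vec dx :=
  fun k => ξ ⟨k + j + 1, by omega⟩

/-- The `H` most recent surrogate disturbances. -/
def recent (ξ : Fin (2 * H + 1) → Vec dx) : Fin H → Vec dx :=
  fun k => ξ (Fin.castLE (by omega) k)

@[fun_prop] theorem continuous_window (j : Fin (H + 1)) :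
    Continuous fun ξ : Fin (2 * H + 1) → Vec dx => window ξ j := by
  unfold window
  fun_prop

@[fun_prop] theorem continuous_recent :
    Continuous fun ξ : Fin (2 * H + 1) → Vec dx => recent ξ := by
  unfold recent
  fun_prop

section Response

variable (A : Mat dx dx) (B : Mat dx du) (Kst : Mat du dx)

-- Exchanging the sums over `i` and `j` in the definition of `transfer`: the `j`-th term collects
-- what entered the system `j + 1` steps ago, a disturbance and the policy's response to its past.
theorem surrogateState_eq (M : Policy H dx du) (ξ : Fin (2 * H + 1) → Vec dx) :
    surrogateState A B Kst M ξ = ∑ j : Fin (H + 1),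
      app ((A - B * Kst) ^ (j : ℕ)) (app B (Policy.act (window ξ j) M) + ξ ⟨j, by omega⟩) := by
  simp only [surrogateState, transfer, add_app, sum_app, Finset.sum_add_distrib, app_add]
  rw [add_comm]
  congr 1
  · rw [Finset.sum_comm, Finset.sum_range]
    refine Finset.sum_congr rfl fun j _ => ?_
    rw [Policy.act_apply, app_sum, app_sum]
    refine (Fintype.sum_of_injective (fun k : Fin H => (⟨k + j + 1, by omega⟩ : Fin (2 * H + 1)))
      (fun k k' h => ?_) _ _ (fun i hi => ?_) fun k => ?_).symm
    · simpa [Fin.ext_iff] using h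
    · rw [dif_neg, zero_app]
      rintro ⟨h1, h2⟩
      exact hi ⟨⟨i - j - 1, by omega⟩, Fin.ext (by simp; omega)⟩
    · rw [dif_pos ⟨by simp, by simp; omega⟩, mul_app, mul_app]
      have hk : (⟨(k : ℕ) + j + 1 - j - 1, by omega⟩ : Fin H) = k := Fin.ext (by simp; omega)
      simp only [hk]
      rfl
  · refine (Fintype.sum_of_injective (fun j : Fin (H + 1) => (⟨j, by omega⟩ : Fin (2 * H + 1)))
      (fun k k' h => ?_) _ _ (fun i hi => ?_) fun k => ?_).symm
    · simpa [Fin.ext_iff] using h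
    · rw [if_neg fun h => hi ⟨⟨i, by omega⟩, rfl⟩, zero_app]
    · rw [if_pos (by simp; omega)]

theorem surrogateAction_eq (M : Policy H dx du) (ξ : Fin (2 * H + 1) → Vec dx) :
    surrogateAction A B Kst M ξ
      = - app Kst (surrogateState A B Kst M ξ) + Policy.act (recent ξ) M := rfl

/-- The linear part of `M ↦ y(M)`. -/
noncomputable def responseState (ξ : Fin (2 * H + 1) → Vec dx) : Policy H dx du →ₗ[ℝ] Vec dx :=
  ∑ j : Fin (H + 1), Matrix.toEuclideanLin ((A - B * Kst) ^ (j : ℕ)) ∘ₗ Matrix.toEuclideanLin B ∘ₗ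
    Policy.act (window ξ j)

/-- The linear part of `M ↦ v(M)`. -/
noncomputable def responseAction (ξ : Fin (2 * H + 1) → Vec dx) : Policy H dx du →ₗ[ℝ] Vec du :=
  -(Matrix.toEuclideanLin Kst ∘ₗ responseState A B Kst ξ) + Policy.act (recent ξ)

/-- The Jacobian of `M ↦ (y(M), v(M))`, as a continuous linear map. -/
noncomputable def response (ξ : Fin (2 * H + 1) → Vec dx) :
    Policy H dx du →L[ℝ] WithLp 2 (Vec dx × Vec du) :=
  (WithLp.prodContinuousLinearEquiv 2 ℝ (Vec dx) (Vec du)).symm.toContinuousLinearMap.comp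
    ((responseState A B Kst ξ).toContinuousLinearMap.prod
      (responseAction A B Kst ξ).toContinuousLinearMap)

theorem responseState_apply (N : Policy H dx du) (ξ : Fin (2 * H + 1) → Vec dx) :
    responseState A B Kst ξ N = ∑ j : Fin (H + 1),
      app ((A - B * Kst) ^ (j : ℕ)) (app B (Policy.act (window ξ j) N)) := by
  simp [responseState, app]

theorem responseAction_apply (N : Policy H dx du) (ξ : Fin (2 * H + 1) → Vec dx) :
    responseAction A B Kst ξ N = - app Kst (responseState A B Kst ξ N) + Policy.act (recent ξ) N :=
  rfl

theorem response_apply (N : Policy H dx du) (ξ : Fin (2 * H + 1) → Vec dx) :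
    response A B Kst ξ N
      = WithLp.toLp 2 (responseState A B Kst ξ N, responseAction A B Kst ξ N) := rfl

theorem surrogatePair_eq (M : Policy H dx du) (ξ : Fin (2 * H + 1) → Vec dx) :
    surrogatePair A B Kst M ξ = surrogatePair A B Kst 0 ξ + response A B Kst ξ M := by
  have hstate : surrogateState A B Kst M ξ
      = surrogateState A B Kst 0 ξ + responseState A B Kst ξ M := by
    simp only [surrogateState_eq, responseState_apply, map_zero, app_zero, zero_add,
      ← Finset.sum_add_distrib, ← app_add]
    exact Finset.sum_congr rfl fun j _ => congrArg _ (add_comm _ _)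
  have haction : surrogateAction A B Kst M ξ
      = surrogateAction A B Kst 0 ξ + responseAction A B Kst ξ M := by
    rw [surrogateAction_eq, surrogateAction_eq, hstate, responseAction_apply, app_add, map_zero]
    abel
  rw [response_apply, surrogatePair, surrogatePair, ← WithLp.toLp_add, Prod.mk_add_mk, ← hstate,
    ← haction]

theorem surrogatePair_sub (M N : Policy H dx du) (ξ : Fin (2 * H + 1) → Vec dx) :
    surrogatePair A B Kst M ξ - surrogatePair A B Kst N ξ = response A B Kst ξ (M - N) := by
  rw [surrogatePair_eq, surrogatePair_eq A B Kst N, map_sub]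
  abel

theorem jacobianCol_eq (ξ : Fin (2 * H + 1) → Vec dx) (p : Fin H × Fin du × Fin dx) :
    jacobianCol A B Kst ξ p = response A B Kst ξ (EuclideanSpace.single p 1) := by
  rw [jacobianCol, surrogatePair_sub, sub_zero]

theorem norm_response_sq (N : Policy H dx du) (ξ : Fin (2 * H + 1) → Vec dx) :
    ‖response A B Kst ξ N‖ ^ 2
      = ‖responseState A B Kst ξ N‖ ^ 2 + ‖responseAction A B Kst ξ N‖ ^ 2 :=
  WithLp.prod_norm_sq_eq_of_L2 _

@[fun_prop] theorem continuous_responseState (N : Policy H dx du) :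
    Continuous fun ξ => responseState A B Kst ξ N := by
  simp only [responseState_apply]
  fun_prop

@[fun_prop] theorem continuous_responseAction (N : Policy H dx du) :
    Continuous fun ξ => responseAction A B Kst ξ N := by
  simp only [responseAction_apply]
  fun_prop

@[fun_prop] theorem continuous_response :
    Continuous fun ξ => (response A B Kst ξ : Policy H dx du →L[ℝ] WithLp 2 (Vec dx × Vec du)) := by
  refine continuous_clm_apply.2 fun N => ?_
  simp only [response_apply]
  fun_prop

@[fun_prop] theorem continuous_surrogateState (M : Policy H dx du) :
    Continuous (surrogateState A B Kst M) := by
  unfold surrogateState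
  fun_prop

@[fun_prop] theorem continuous_surrogateAction (M : Policy H dx du) :
    Continuous (surrogateAction A B Kst M) := by
  unfold surrogateAction
  fun_prop

@[fun_prop] theorem continuous_surrogatePair (M : Policy H dx du) :
    Continuous (surrogatePair A B Kst M) := by
  unfold surrogatePair
  fun_prop

end Response

/-! ### Energy of a policy -/

/-- The law of the disturbances `ξ_0, …, ξ_{2H}` that drive the surrogate. -/
noncomputable abbrev surrogateLaw (H : ℕ) (ν : Measure (Vec dx)) :
    Measure (Fin (2 * H + 1) → Vec dx) :=
  Measure.pi fun _ => ν

/-- The mean square of the control `∑_k N^[k] ζ_k` under independent disturbances of law `ν`. It is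
comparable both to `‖N‖²` and to the mean square of the response, hence mediates between them. -/
noncomputable def Policy.energy (ν : Measure (Vec dx)) (N : Policy H dx du) : ℝ :=
  ∑ k, ∫ w, ‖app (N.block k) w‖ ^ 2 ∂ν

variable {ν : Measure (Vec dx)} {σ W : ℝ}

theorem Policy.energy_nonneg (N : Policy H dx du) : 0 ≤ N.energy ν :=
  Finset.sum_nonneg fun _ _ => integral_nonneg fun _ => sq_nonneg _

theorem NoiseLaw.energy_le (h : NoiseLaw ν σ W) (N : Policy H dx du) :
    N.energy ν ≤ ‖N‖ ^ 2 * ∫ w, ‖w‖ ^ 2 ∂ν := by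
  rw [Policy.norm_sq_eq, Finset.sum_mul]
  exact Finset.sum_le_sum fun k _ => h.integral_norm_app_sq_le _

theorem NoiseLaw.le_energy (h : NoiseLaw ν σ W) (N : Policy H dx du) :
    σ ^ 2 * ‖N‖ ^ 2 ≤ N.energy ν := by
  rw [Policy.norm_sq_eq, Finset.mul_sum]
  exact Finset.sum_le_sum fun k _ => h.sq_mul_sum_sq_le_integral_norm_app_sq _

theorem NoiseLaw.integral_norm_act_window_sq (h : NoiseLaw ν σ W) (N : Policy H dx du)
    (j : Fin (H + 1)) :
    ∫ ξ, ‖Policy.act (window ξ j) N‖ ^ 2 ∂(surrogateLaw H ν) = N.energy ν :=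
  h.integral_pi_norm_sum_app_sq
    (r := fun k : Fin H => (⟨k + j + 1, by omega⟩ : Fin (2 * H + 1)))
    (fun k k' hk => by simpa [Fin.ext_iff] using hk) N.block

theorem NoiseLaw.integral_norm_act_recent_sq (h : NoiseLaw ν σ W) (N : Policy H dx du) :
    ∫ ξ, ‖Policy.act (recent ξ) N‖ ^ 2 ∂(surrogateLaw H ν) = N.energy ν :=
  h.integral_pi_norm_sum_app_sq (Fin.castLE_injective (by omega)) N.block

theorem norm_sum_sq_le_of_norm_le_mul {ι E : Type*} [NormedAddCommGroup E] (s : Finset ι)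
    {v : ι → E} {r b : ι → ℝ} (hr : ∀ i ∈ s, 0 ≤ r i) (h : ∀ i ∈ s, ‖v i‖ ≤ r i * b i) :
    ‖∑ i ∈ s, v i‖ ^ 2 ≤ (∑ i ∈ s, r i) * ∑ i ∈ s, r i * b i ^ 2 := by
  calc ‖∑ i ∈ s, v i‖ ^ 2 ≤ (∑ i ∈ s, r i * b i) ^ 2 := by
        gcongr
        exact norm_sum_le_of_le s h
    _ ≤ _ := Finset.sum_sq_le_sum_mul_sum_of_sq_le_mul s hr
        (fun i hi => mul_nonneg (hr i hi) (sq_nonneg _)) fun i _ => le_of_eq (by ring)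

theorem norm_add_sq_le_two_mul {E : Type*} [SeminormedAddCommGroup E] (x y : E) :
    ‖x + y‖ ^ 2 ≤ 2 * ‖x‖ ^ 2 + 2 * ‖y‖ ^ 2 := by
  rw [← mul_add]
  exact (pow_le_pow_left₀ (norm_nonneg _) (norm_add_le x y) 2).trans add_sq_le

variable {A : Mat dx dx} {B : Mat dx du} {K : Mat du dx} {κ κB γ : ℝ}

theorem ExponentiallyStable.norm_feedback_le (hK : ExponentiallyStable A B κ γ K) (x : Vec dx) :
    ‖app K x‖ ≤ κ * ‖x‖ :=
  (norm_app_le K x).trans (by gcongr; exact hK.norm_le)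

theorem ExponentiallyStable.norm_feedback_sq_le (hK : ExponentiallyStable A B κ γ K) (x : Vec dx) :
    ‖app K x‖ ^ 2 ≤ κ ^ 2 * ‖x‖ ^ 2 := by
  rw [← mul_pow]
  gcongr
  exact hK.norm_feedback_le x

theorem ExponentiallyStable.norm_pow_app_app_le (hK : ExponentiallyStable A B κ γ K)
    (hγ1 : γ < 1) (hB : ‖B‖ ≤ κB) (j : ℕ) (u : Vec du) :
    ‖app ((A - B * K) ^ j) (app B u)‖ ≤ κ ^ 2 * (1 - γ) ^ j * κB * ‖u‖ := by
  have : 0 ≤ 1 - γ := by linarith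
  calc ‖app ((A - B * K) ^ j) (app B u)‖ ≤ ‖(A - B * K) ^ j‖ * (‖B‖ * ‖u‖) :=
        (norm_app_le _ _).trans (by gcongr; exact norm_app_le _ _)
    _ ≤ (κ ^ 2 * (1 - γ) ^ j) * (κB * ‖u‖) := by
        gcongr
        exact hK.norm_pow_le j
    _ = _ := by ring

-- Cauchy-Schwarz with the geometric weights `r j`, so that no factor `H` is lost.
theorem NoiseLaw.integral_responseState_le (h : NoiseLaw ν σ W) (hγ : 0 < γ) (hγ1 : γ < 1)
    (hB : ‖B‖ ≤ κB) (hK : ExponentiallyStable A B κ γ K) (N : Policy H dx du) :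
    ∫ ξ, ‖responseState A B K ξ N‖ ^ 2 ∂(surrogateLaw H ν)
      ≤ (κ ^ 2 * κB * γ⁻¹) ^ 2 * N.energy ν := by
  have : 0 ≤ 1 - γ := by linarith
  have hκB : 0 ≤ κB := (norm_nonneg _).trans hB
  set r : Fin (H + 1) → ℝ := fun j => κ ^ 2 * (1 - γ) ^ (j : ℕ) * κB with hr
  have hr0 : ∀ j, 0 ≤ r j := fun j => by positivity
  have hsum : ∑ j, r j ≤ κ ^ 2 * κB * γ⁻¹ := by
    calc ∑ j, r j = κ ^ 2 * κB * ∑ j : Fin (H + 1), (1 - γ) ^ (j : ℕ) := by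
          rw [Finset.mul_sum]
          exact Finset.sum_congr rfl fun j _ => by simp only [hr]; ring
      _ ≤ _ := by
          rw [← Finset.sum_range fun j => (1 - γ) ^ j]
          gcongr
          exact sum_range_one_sub_pow_le hγ hγ1 _
  have hpt : ∀ ξ, ‖responseState A B K ξ N‖ ^ 2
      ≤ (∑ j, r j) * ∑ j, r j * ‖Policy.act (window ξ j) N‖ ^ 2 := fun ξ => by
    rw [responseState_apply]
    exact norm_sum_sq_le_of_norm_le_mul _ (fun j _ => hr0 j)
      fun j _ => hK.norm_pow_app_app_le hγ1 hB j _
  calc _ ≤ ∫ ξ, (∑ j, r j) * ∑ j, r j * ‖Policy.act (window ξ j) N‖ ^ 2 ∂(surrogateLaw H ν) :=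
        integral_mono (h.integrable_pi (by fun_prop)) (h.integrable_pi (by fun_prop)) hpt
    _ = (∑ j, r j) * ((∑ j, r j) * N.energy ν) := by
        rw [integral_const_mul, integral_finsetSum _ fun j _ => h.integrable_pi (by fun_prop)]
        simp_rw [integral_const_mul, h.integral_norm_act_window_sq, Finset.sum_mul]
    _ = (∑ j, r j) ^ 2 * N.energy ν := by ring
    _ ≤ _ := by
        have := N.energy_nonneg (ν := ν)
        have : 0 ≤ ∑ j, r j := Finset.sum_nonneg fun j _ => hr0 j
        gcongr

theorem ExponentiallyStable.norm_response_sq_le (hK : ExponentiallyStable A B κ γ K)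
    (N : Policy H dx du) (ξ : Fin (2 * H + 1) → Vec dx) :
    ‖response A B K ξ N‖ ^ 2
      ≤ (1 + 2 * κ ^ 2) * ‖responseState A B K ξ N‖ ^ 2 + 2 * ‖Policy.act (recent ξ) N‖ ^ 2 := by
  have h1 := norm_add_sq_le_two_mul (-app K (responseState A B K ξ N)) (Policy.act (recent ξ) N)
  have h2 := hK.norm_feedback_sq_le (responseState A B K ξ N)
  rw [norm_neg, ← responseAction_apply] at h1
  rw [norm_response_sq]
  linarith

theorem NoiseLaw.integral_response_le (h : NoiseLaw ν σ W) (hκ : 1 ≤ κ) (hγ : 0 < γ)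
    (hγ1 : γ < 1) (hB : ‖B‖ ≤ κB) (hκB : 1 ≤ κB) (hK : ExponentiallyStable A B κ γ K)
    (N : Policy H dx du) :
    ∫ ξ, ‖response A B K ξ N‖ ^ 2 ∂(surrogateLaw H ν)
      ≤ (3 * κ ^ 3 * κB * γ⁻¹) ^ 2 * N.energy ν := by
  have hE := N.energy_nonneg (ν := ν)
  have hconst : (1 + 2 * κ ^ 2) * (κ ^ 2 * κB * γ⁻¹) ^ 2 + 2 ≤ (3 * κ ^ 3 * κB * γ⁻¹) ^ 2 := by
    have hg : 1 ≤ γ⁻¹ := (one_le_inv₀ hγ).2 hγ1.le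
    have h1 : 1 ≤ (κ ^ 3 * κB * γ⁻¹) ^ 2 :=
      one_le_pow₀ (one_le_mul_of_one_le_of_one_le
        (one_le_mul_of_one_le_of_one_le (one_le_pow₀ hκ) hκB) hg)
    have h2 : (κ ^ 2 * κB * γ⁻¹) ^ 2 ≤ (κ ^ 3 * κB * γ⁻¹) ^ 2 := by gcongr; norm_num
    linear_combination 2 * h1 + h2 + 4 * sq_nonneg (κ ^ 3 * κB * γ⁻¹)
  calc _ ≤ ∫ ξ, ((1 + 2 * κ ^ 2) * ‖responseState A B K ξ N‖ ^ 2
          + 2 * ‖Policy.act (recent ξ) N‖ ^ 2) ∂(surrogateLaw H ν) :=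
        integral_mono (h.integrable_pi (by fun_prop)) (h.integrable_pi (by fun_prop))
          (hK.norm_response_sq_le N)
    _ = (1 + 2 * κ ^ 2) * ∫ ξ, ‖responseState A B K ξ N‖ ^ 2 ∂(surrogateLaw H ν)
          + 2 * N.energy ν := by
        rw [integral_add (h.integrable_pi (by fun_prop)) (h.integrable_pi (by fun_prop)),
          integral_const_mul, integral_const_mul, h.integral_norm_act_recent_sq]
    _ ≤ (1 + 2 * κ ^ 2) * ((κ ^ 2 * κB * γ⁻¹) ^ 2 * N.energy ν) + 2 * N.energy ν := by
        gcongr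
        exact h.integral_responseState_le hγ hγ1 hB hK N
    _ = ((1 + 2 * κ ^ 2) * (κ ^ 2 * κB * γ⁻¹) ^ 2 + 2) * N.energy ν := by ring
    _ ≤ _ := by gcongr

-- The response determines the control: `act = K · responseState + responseAction`.
theorem ExponentiallyStable.norm_act_recent_sq_le (hK : ExponentiallyStable A B κ γ K)
    (hκ : 1 ≤ κ) (N : Policy H dx du) (ξ : Fin (2 * H + 1) → Vec dx) :
    ‖Policy.act (recent ξ) N‖ ^ 2 ≤ (2 * κ) ^ 2 * ‖response A B K ξ N‖ ^ 2 := by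
  have h1 := norm_add_sq_le_two_mul (app K (responseState A B K ξ N)) (responseAction A B K ξ N)
  have h2 := hK.norm_feedback_sq_le (responseState A B K ξ N)
  rw [responseAction_apply, add_neg_cancel_left, ← responseAction_apply] at h1
  have hκ2 : 1 ≤ κ ^ 2 := one_le_pow₀ hκ
  calc _ ≤ 2 * (κ ^ 2 * ‖responseState A B K ξ N‖ ^ 2)
        + 2 * (1 * ‖responseAction A B K ξ N‖ ^ 2) := by linarith
    _ ≤ 4 * (κ ^ 2 * ‖responseState A B K ξ N‖ ^ 2)
        + 4 * (κ ^ 2 * ‖responseAction A B K ξ N‖ ^ 2) := by gcongr <;> norm_num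
    _ = _ := by rw [norm_response_sq]; ring

theorem NoiseLaw.energy_le_integral_response (h : NoiseLaw ν σ W) (hκ : 1 ≤ κ)
    (hK : ExponentiallyStable A B κ γ K) (N : Policy H dx du) :
    N.energy ν ≤ (2 * κ) ^ 2 * ∫ ξ, ‖response A B K ξ N‖ ^ 2 ∂(surrogateLaw H ν) := by
  rw [← h.integral_norm_act_recent_sq, ← integral_const_mul]
  exact integral_mono (h.integrable_pi (by fun_prop)) (h.integrable_pi (by fun_prop))
    (hK.norm_act_recent_sq_le hκ N)

end Surrogate

/-! ### First-order properties of the costs -/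

section Cost

theorem strongConvexOn_add_fderiv_add_le {E : Type*} [NormedAddCommGroup E] [NormedSpace ℝ E]
    {f : E → ℝ} {m : ℝ} (hf : StrongConvexOn Set.univ m f) {x : E}
    (hd : DifferentiableAt ℝ f x) (y : E) :
    f x + fderiv ℝ f x (y - x) + m / 2 * ‖y - x‖ ^ 2 ≤ f y := by
  have hderiv : HasDerivAt (fun s : ℝ => f (x + s • (y - x))) (fderiv ℝ f x (y - x)) 0 := by
    have hline : HasDerivAt (fun s : ℝ => x + s • (y - x)) (y - x) 0 := by
      simpa using ((hasDerivAt_id (0 : ℝ)).smul_const (y - x)).const_add x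
    have hfx : HasFDerivAt f (fderiv ℝ f x) (x + (0 : ℝ) • (y - x)) := by
      simpa using hd.hasFDerivAt
    exact hfx.comp_hasDerivAt 0 hline
  have hlim : Filter.Tendsto (fun s : ℝ => f y - f x - (1 - s) * (m / 2 * ‖x - y‖ ^ 2))
      (nhdsWithin 0 (Set.Ioi 0)) (nhds (f y - f x - (1 - 0) * (m / 2 * ‖x - y‖ ^ 2))) :=
    (Continuous.tendsto (by fun_prop) 0).mono_left nhdsWithin_le_nhds
  have hle := le_of_tendsto_of_tendsto hderiv.tendsto_slope_zero_right hlim (by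
    filter_upwards [Ioo_mem_nhdsGT (zero_lt_one' ℝ)] with s hs
    have hconv := hf.2 (Set.mem_univ x) (Set.mem_univ y) (sub_nonneg.2 hs.2.le) hs.1.le (by ring)
    rw [show (1 - s) • x + s • y = x + s • (y - x) by module] at hconv
    simp only [zero_add, zero_smul, add_zero, smul_eq_mul] at hconv ⊢
    rw [inv_mul_le_iff₀ hs.1]
    linarith)
  rw [norm_sub_rev] at hle
  linarith

theorem norm_gradient {E : Type*} [NormedAddCommGroup E] [InnerProductSpace ℝ E]
    [CompleteSpace E] (f : E → ℝ) (x : E) : ‖gradient f x‖ = ‖fderiv ℝ f x‖ := by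
  rw [gradient, LinearIsometryEquiv.norm_map]

variable {dx du : ℕ} {c : Vec dx → Vec du → ℝ} {α G : ℝ}

/-- The cost as a function of the stacked state-control pair, which carries the Euclidean norm. -/
def pairCost (c : Vec dx → Vec du → ℝ) (z : WithLp 2 (Vec dx × Vec du)) : ℝ := c z.fst z.snd

namespace CostClass

theorem gradBound_nonneg (h : CostClass c α G) : 0 ≤ G := by
  have := (h.grad_bound 1 0 0 (by simp) (by simp)).1
  rw [mul_one] at this
  exact (norm_nonneg _).trans this

theorem differentiable_pairCost (h : CostClass c α G) : Differentiable ℝ (pairCost c) :=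
  h.differentiable

theorem continuous_pairCost (h : CostClass c α G) : Continuous (pairCost c) := by
  have : ContinuousSMul ℝ (WithLp 2 (Vec dx × Vec du)) := inferInstance
  apply Differentiable.continuous (𝕜 := ℝ)
  exact h.differentiable_pairCost

theorem continuous (h : CostClass c α G) : Continuous fun z : Vec dx × Vec du => c z.1 z.2 :=
  h.continuous_pairCost.comp (WithLp.prod_continuous_toLp 2 (Vec dx) (Vec du))

theorem abs_fderiv_le (h : CostClass c α G) {D : ℝ} {z : WithLp 2 (Vec dx × Vec du)}
    (hx : ‖z.fst‖ ≤ D) (hu : ‖z.snd‖ ≤ D) (v : WithLp 2 (Vec dx × Vec du)) :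
    |fderiv ℝ (pairCost c) z v| ≤ G * D * (‖v.fst‖ + ‖v.snd‖) := by
  set L := fderiv ℝ (pairCost c) z
  set e := (WithLp.prodContinuousLinearEquiv 2 ℝ (Vec dx) (Vec du)).symm.toContinuousLinearMap
  have hz : HasFDerivAt (pairCost c) L z := (h.differentiable_pairCost z).hasFDerivAt
  have hfst : HasFDerivAt (fun x => c x z.snd) (L.comp (e.comp (.inl ℝ (Vec dx) (Vec du))))
      z.fst :=
    HasFDerivAt.comp (g := pairCost c) z.fst hz
      (e.hasFDerivAt.comp z.fst (hasFDerivAt_prodMk_left (𝕜 := ℝ) z.fst z.snd))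
  have hsnd : HasFDerivAt (fun u => c z.fst u) (L.comp (e.comp (.inr ℝ (Vec dx) (Vec du))))
      z.snd :=
    HasFDerivAt.comp (g := pairCost c) z.snd hz
      (e.hasFDerivAt.comp z.snd (hasFDerivAt_prodMk_right (𝕜 := ℝ) z.fst z.snd))
  obtain ⟨hgx, hgu⟩ := h.grad_bound D z.fst z.snd hx hu
  rw [norm_gradient, hfst.fderiv] at hgx
  rw [norm_gradient, hsnd.fderiv] at hgu
  have hv : L v = L.comp (e.comp (.inl ℝ (Vec dx) (Vec du))) v.fst
      + L.comp (e.comp (.inr ℝ (Vec dx) (Vec du))) v.snd := by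
    simp only [ContinuousLinearMap.comp_apply, ← map_add, ContinuousLinearMap.inl_apply,
      ContinuousLinearMap.inr_apply, Prod.mk_add_mk, add_zero, zero_add]
    rfl
  rw [hv, mul_add]
  exact (abs_add_le _ _).trans
    (add_le_add (ContinuousLinearMap.le_of_opNorm_le _ hgx _)
      (ContinuousLinearMap.le_of_opNorm_le _ hgu _))

theorem norm_fderiv_le (h : CostClass c α G) {D : ℝ} {z : WithLp 2 (Vec dx × Vec du)}
    (hx : ‖z.fst‖ ≤ D) (hu : ‖z.snd‖ ≤ D) : ‖fderiv ℝ (pairCost c) z‖ ≤ 2 * G * D := by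
  have hGD : 0 ≤ G * D := mul_nonneg h.gradBound_nonneg ((norm_nonneg _).trans hx)
  refine ContinuousLinearMap.opNorm_le_bound _ (by linarith) fun v => ?_
  calc ‖fderiv ℝ (pairCost c) z v‖ ≤ G * D * (‖v.fst‖ + ‖v.snd‖) := h.abs_fderiv_le hx hu v
    _ ≤ G * D * (‖v‖ + ‖v‖) := by
        gcongr
        exacts [WithLp.norm_fst_le _ v, WithLp.norm_snd_le _ v]
    _ = 2 * G * D * ‖v‖ := by ring

theorem add_fderiv_add_le (h : CostClass c α G) (z z' : WithLp 2 (Vec dx × Vec du)) :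
    pairCost c z + fderiv ℝ (pairCost c) z (z' - z) + α / 2 * ‖z' - z‖ ^ 2 ≤ pairCost c z' :=
  strongConvexOn_add_fderiv_add_le h.strongConvex (h.differentiable_pairCost z) z'

-- By convexity, the size bound `D` is needed only at the point where the cost is larger.
theorem sub_le (h : CostClass c α G) (hα : 0 ≤ α) {D : ℝ} {x : Vec dx} {u : Vec du}
    (hx : ‖x‖ ≤ D) (hu : ‖u‖ ≤ D) (x' : Vec dx) (u' : Vec du) :
    c x u - c x' u' ≤ G * D * (‖x - x'‖ + ‖u - u'‖) := by
  set z : WithLp 2 (Vec dx × Vec du) := WithLp.toLp 2 (x, u)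
  set z' : WithLp 2 (Vec dx × Vec du) := WithLp.toLp 2 (x', u')
  have hconv : c x u + fderiv ℝ (pairCost c) z (z' - z) + α / 2 * ‖z' - z‖ ^ 2 ≤ c x' u' :=
    h.add_fderiv_add_le z z'
  have hgrad : |fderiv ℝ (pairCost c) z (z' - z)| ≤ G * D * (‖x - x'‖ + ‖u - u'‖) := by
    rw [norm_sub_rev x, norm_sub_rev u]
    exact h.abs_fderiv_le (z := z) hx hu (z' - z)
  have hquad : 0 ≤ α / 2 * ‖z' - z‖ ^ 2 := by positivity
  linarith [neg_abs_le (fderiv ℝ (pairCost c) z (z' - z))]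

end CostClass

end Cost

/-! ### Size of states and controls -/

section Size

variable {H dx du : ℕ} {A : Mat dx dx} {B : Mat dx du} {K : Mat du dx} {κ κB γ W : ℝ}

/-- A common bound on all states and controls. -/
noncomputable def sizeBound (κ κB γ W : ℝ) : ℝ := 4 * κ ^ 6 * κB ^ 2 * γ⁻¹ ^ 2 * W

theorem ExponentiallyStable.norm_sum_app_pow_le (hK : ExponentiallyStable A B κ γ K)
    (hγ : 0 < γ) (hγ1 : γ < 1) {n : ℕ} {b : Fin n → Vec dx} {R : ℝ} (hR : 0 ≤ R)
    (hb : ∀ j, ‖b j‖ ≤ R) :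
    ‖∑ j : Fin n, app ((A - B * K) ^ (j : ℕ)) (b j)‖ ≤ κ ^ 2 * γ⁻¹ * R := by
  have : 0 ≤ 1 - γ := by linarith
  calc _ ≤ ∑ j : Fin n, κ ^ 2 * (1 - γ) ^ (j : ℕ) * R :=
        norm_sum_le_of_le _ fun j _ => (norm_app_le _ _).trans <|
          mul_le_mul (hK.norm_pow_le j) (hb j) (norm_nonneg _) (by positivity)
    _ = κ ^ 2 * (∑ j ∈ Finset.range n, (1 - γ) ^ j) * R := by
        rw [Finset.sum_range, Finset.mul_sum, Finset.sum_mul]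
    _ ≤ _ := by
        gcongr
        exact sum_range_one_sub_pow_le hγ hγ1 n

theorem Policy.norm_act_le {M : Policy H dx du} (hM : M ∈ policySet H dx du κ κB γ)
    (hκ : 0 ≤ κ) (hκB : 0 ≤ κB) (hγ : 0 < γ) (hγ1 : γ < 1) (hW : 0 ≤ W) {ζ : Fin H → Vec dx}
    (hζ : ∀ k, ‖ζ k‖ ≤ W) : ‖Policy.act ζ M‖ ≤ κ ^ 3 * κB * γ⁻¹ * W := by
  have hρ : 0 ≤ 1 - γ := by linarith
  calc ‖Policy.act ζ M‖ ≤ ∑ k : Fin H, κ ^ 3 * κB * (1 - γ) ^ (k : ℕ) * W := by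
        refine norm_sum_le_of_le _ fun k _ => (norm_app_le _ _).trans ?_
        refine mul_le_mul ((hM k).trans ?_) (hζ k) (norm_nonneg _) (by positivity)
        gcongr ?_ * ?_
        exact pow_le_pow_of_le_one hρ (by linarith) (by omega)
    _ = κ ^ 3 * κB * (∑ k ∈ Finset.range H, (1 - γ) ^ k) * W := by
        rw [Finset.sum_range, Finset.mul_sum, Finset.sum_mul]
    _ ≤ _ := by
        gcongr
        exact sum_range_one_sub_pow_le hγ hγ1 H

theorem pow_three_mul_le_pow_six_mul (hκ : 1 ≤ κ) (hκB : 1 ≤ κB) (hγ : 0 < γ) (hγ1 : γ < 1) :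
    κ ^ 3 * κB * γ⁻¹ ≤ κ ^ 6 * κB ^ 2 * γ⁻¹ ^ 2 := by
  have hg : 1 ≤ γ⁻¹ := (one_le_inv₀ hγ).2 hγ1.le
  gcongr ?_ * ?_ * ?_
  · exact pow_le_pow_right₀ hκ (by norm_num)
  · exact le_self_pow₀ hκB (by norm_num)
  · exact le_self_pow₀ hg (by norm_num)

theorem ExponentiallyStable.norm_le_sizeBound (hK : ExponentiallyStable A B κ γ K) (hκ : 1 ≤ κ)
    (hκB : 1 ≤ κB) (hB : ‖B‖ ≤ κB) (hγ : 0 < γ) (hγ1 : γ < 1) (hW : 0 ≤ W) {n : ℕ}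
    {v : Fin n → Vec du} {ζ : Fin n → Vec dx} (hv : ∀ j, ‖v j‖ ≤ κ ^ 3 * κB * γ⁻¹ * W)
    (hζ : ∀ j, ‖ζ j‖ ≤ W) {v' : Vec du} (hv' : ‖v'‖ ≤ κ ^ 3 * κB * γ⁻¹ * W) {x : Vec dx}
    (hx : x = ∑ j : Fin n, app ((A - B * K) ^ (j : ℕ)) (app B (v j) + ζ j)) :
    ‖x‖ ≤ sizeBound κ κB γ W ∧ ‖- app K x + v'‖ ≤ sizeBound κ κB γ W := by
  have hg : 1 ≤ γ⁻¹ := (one_le_inv₀ hγ).2 hγ1.le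
  have hinput : ∀ j, ‖app B (v j) + ζ j‖ ≤ 2 * κ ^ 3 * κB ^ 2 * γ⁻¹ * W := fun j => by
    calc ‖app B (v j) + ζ j‖ ≤ ‖B‖ * ‖v j‖ + ‖ζ j‖ :=
          (norm_add_le _ _).trans (by gcongr; exact norm_app_le _ _)
      _ ≤ κB * (κ ^ 3 * κB * γ⁻¹ * W) + 1 * 1 * 1 * W := by
          rw [one_mul, one_mul, one_mul]
          gcongr
          exacts [hv j, hζ j]
      _ ≤ κB * (κ ^ 3 * κB * γ⁻¹ * W) + κ ^ 3 * κB ^ 2 * γ⁻¹ * W := by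
          gcongr
          exacts [one_le_pow₀ hκ, one_le_pow₀ hκB]
      _ = _ := by ring
  have hx5 : ‖x‖ ≤ 2 * κ ^ 5 * κB ^ 2 * γ⁻¹ ^ 2 * W := by
    rw [hx]
    exact (hK.norm_sum_app_pow_le hγ hγ1 (by positivity) hinput).trans (le_of_eq (by ring))
  have hx6 : 2 * κ ^ 5 * κB ^ 2 * γ⁻¹ ^ 2 * W ≤ 2 * κ ^ 6 * κB ^ 2 * γ⁻¹ ^ 2 * W := by
    gcongr
    norm_num
  have hpos : 0 ≤ κ ^ 6 * κB ^ 2 * γ⁻¹ ^ 2 * W := by positivity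
  have hv6 : ‖v'‖ ≤ κ ^ 6 * κB ^ 2 * γ⁻¹ ^ 2 * W :=
    hv'.trans (by gcongr ?_ * W; exact pow_three_mul_le_pow_six_mul hκ hκB hγ hγ1)
  have hKx : ‖app K x‖ ≤ κ * (2 * κ ^ 5 * κB ^ 2 * γ⁻¹ ^ 2 * W) :=
    (hK.norm_feedback_le x).trans (by gcongr)
  have hu := norm_add_le (- app K x) v'
  rw [norm_neg] at hu
  unfold sizeBound
  constructor <;> linarith

theorem ExponentiallyStable.surrogate_le_sizeBound (hK : ExponentiallyStable A B κ γ K)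
    (hκ : 1 ≤ κ) (hκB : 1 ≤ κB) (hB : ‖B‖ ≤ κB) (hγ : 0 < γ) (hγ1 : γ < 1)
    {M : Policy H dx du} (hM : M ∈ policySet H dx du κ κB γ) {ξ : Fin (2 * H + 1) → Vec dx}
    (hξ : ‖ξ‖ ≤ W) :
    ‖surrogateState A B K M ξ‖ ≤ sizeBound κ κB γ W ∧
      ‖surrogateAction A B K M ξ‖ ≤ sizeBound κ κB γ W := by
  have hW : 0 ≤ W := (norm_nonneg _).trans hξ
  have hξi : ∀ i, ‖ξ i‖ ≤ W := fun i => (norm_le_pi_norm ξ i).trans hξ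
  have hact : ∀ ζ : Fin H → Vec dx, (∀ k, ‖ζ k‖ ≤ W) →
      ‖Policy.act ζ M‖ ≤ κ ^ 3 * κB * γ⁻¹ * W := fun ζ hζ =>
    Policy.norm_act_le hM (by linarith) (by linarith) hγ hγ1 hW hζ
  exact hK.norm_le_sizeBound hκ hκB hB hγ hγ1 hW (fun j => hact (window ξ j) fun k => hξi _)
    (fun j => hξi ⟨j, by omega⟩) (hact (recent ξ) fun k => hξi _) (surrogateState_eq A B K M ξ)

end Size

/-! ### The surrogate cost -/

section SurrogateCost

variable {H dx du : ℕ} {ν : Measure (Vec dx)} {σ W : ℝ} {A : Mat dx dx} {B : Mat dx du}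
  {Kst : Mat du dx} {c : Vec dx → Vec du → ℝ} {α G : ℝ}

theorem surrogateCost_eq (M : Policy H dx du) : surrogateCost ν A B Kst c M
    = ∫ ξ, pairCost c (surrogatePair A B Kst M ξ) ∂(surrogateLaw H ν) :=
  rfl

/-- The derivative of `M ↦ c(y(M), v(M))` for given disturbances `ξ`. -/
noncomputable def surrogateDeriv (A : Mat dx dx) (B : Mat dx du) (Kst : Mat du dx)
    (c : Vec dx → Vec du → ℝ) (M : Policy H dx du) (ξ : Fin (2 * H + 1) → Vec dx) :
    Policy H dx du →L[ℝ] ℝ :=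
  (fderiv ℝ (pairCost c) (surrogatePair A B Kst M ξ)).comp (response A B Kst ξ)

theorem CostClass.hasFDerivAt_pairCost_surrogatePair (hc : CostClass c α G) (M : Policy H dx du)
    (ξ : Fin (2 * H + 1) → Vec dx) :
    HasFDerivAt (fun N => pairCost c (surrogatePair A B Kst N ξ))
      (surrogateDeriv A B Kst c M ξ) M := by
  have hpair : HasFDerivAt (fun N : Policy H dx du => surrogatePair A B Kst N ξ)
      (response A B Kst ξ) M := by
    rw [funext fun N => surrogatePair_eq A B Kst N ξ]
    exact (response A B Kst ξ).hasFDerivAt.const_add _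
  exact (hc.differentiable_pairCost _).hasFDerivAt.comp M hpair

theorem aestronglyMeasurable_surrogateDeriv (M : Policy H dx du) :
    AEStronglyMeasurable (surrogateDeriv A B Kst c M) (surrogateLaw H ν) := by
  have hfderiv : StronglyMeasurable fun ξ =>
      fderiv ℝ (pairCost c) (surrogatePair A B Kst M ξ) :=
    ((measurable_fderiv ℝ _).comp
      (continuous_surrogatePair A B Kst M).measurable).stronglyMeasurable
  have hresponse : StronglyMeasurable fun ξ =>
      (response A B Kst ξ : Policy H dx du →L[ℝ] WithLp 2 (Vec dx × Vec du)) :=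
    (continuous_response A B Kst).stronglyMeasurable
  exact ((ContinuousLinearMap.compL ℝ _ _ ℝ).isBoundedBilinearMap.continuous.comp_stronglyMeasurable
    (hfderiv.prodMk hresponse)).aestronglyMeasurable

theorem CostClass.norm_surrogateDeriv_le (hc : CostClass c α G) {M : Policy H dx du} {R : ℝ}
    (hM : ‖M‖ ≤ R) (ξ : Fin (2 * H + 1) → Vec dx) :
    ‖surrogateDeriv A B Kst c M ξ‖
      ≤ 2 * G * (‖surrogatePair A B Kst (0 : Policy H dx du) ξ‖
          + ‖(response A B Kst ξ : Policy H dx du →L[ℝ] _)‖ * R)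
        * ‖(response A B Kst ξ : Policy H dx du →L[ℝ] _)‖ := by
  have hpair : ‖surrogatePair A B Kst M ξ‖ ≤ ‖surrogatePair A B Kst (0 : Policy H dx du) ξ‖
      + ‖(response A B Kst ξ : Policy H dx du →L[ℝ] _)‖ * R := by
    rw [surrogatePair_eq]
    refine (norm_add_le _ _).trans ?_
    gcongr
    exact ContinuousLinearMap.le_opNorm_of_le _ hM
  refine (ContinuousLinearMap.opNorm_comp_le _ _).trans ?_
  gcongr
  exact hc.norm_fderiv_le ((WithLp.norm_fst_le _ _).trans hpair)
    ((WithLp.norm_snd_le _ _).trans hpair)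

namespace NoiseLaw

theorem integrable_pairCost (h : NoiseLaw ν σ W) (hc : CostClass c α G) (M : Policy H dx du) :
    Integrable (fun ξ => pairCost c (surrogatePair A B Kst M ξ)) (surrogateLaw H ν) :=
  h.integrable_pi (hc.continuous_pairCost.comp (continuous_surrogatePair A B Kst M))

theorem integrable_surrogateDeriv (h : NoiseLaw ν σ W) (hc : CostClass c α G)
    (M : Policy H dx du) :
    Integrable (surrogateDeriv A B Kst c M) (surrogateLaw H ν) :=
  (h.integrable_pi (by fun_prop)).mono' (aestronglyMeasurable_surrogateDeriv M)
    (.of_forall fun ξ => hc.norm_surrogateDeriv_le le_rfl ξ)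

theorem hasFDerivAt_surrogateCost (h : NoiseLaw ν σ W) (hc : CostClass c α G)
    (M : Policy H dx du) :
    HasFDerivAt (surrogateCost ν A B Kst c)
      (∫ ξ, surrogateDeriv A B Kst c M ξ ∂(surrogateLaw H ν)) M := by
  have hball : ∀ N ∈ Metric.ball M 1, ‖N‖ ≤ ‖M‖ + 1 := fun N hN => by
    rw [mem_ball_iff_norm] at hN
    linarith [norm_le_norm_add_norm_sub M N, norm_sub_rev N M]
  exact hasFDerivAt_integral_of_dominated_of_fderiv_le
    (F := fun M ξ => pairCost c (surrogatePair A B Kst M ξ)) (F' := surrogateDeriv A B Kst c)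
    (Metric.ball_mem_nhds M one_pos)
    (.of_forall fun N => (h.integrable_pairCost hc N).aestronglyMeasurable)
    (h.integrable_pairCost hc M) (aestronglyMeasurable_surrogateDeriv M)
    (.of_forall fun ξ N hN => hc.norm_surrogateDeriv_le (hball N hN) ξ)
    (h.integrable_pi (by fun_prop))
    (.of_forall fun ξ N _ => hc.hasFDerivAt_pairCost_surrogatePair N ξ)

theorem inner_gradient_surrogateCost (h : NoiseLaw ν σ W) (hc : CostClass c α G)
    (M N : Policy H dx du) :
    inner ℝ (gradient (surrogateCost ν A B Kst c) M) N
      = ∫ ξ, surrogateDeriv A B Kst c M ξ N ∂(surrogateLaw H ν) := by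
  rw [gradient, InnerProductSpace.toDual_symm_apply, (h.hasFDerivAt_surrogateCost hc M).fderiv,
    ContinuousLinearMap.integral_apply (h.integrable_surrogateDeriv hc M)]

-- `∫ ‖response N‖²` is the squared norm of `N` in the preconditioner, see `weightedSq_gram`.
theorem add_inner_gradient_add_le (h : NoiseLaw ν σ W) (hc : CostClass c α G)
    (M N : Policy H dx du) :
    surrogateCost ν A B Kst c M + inner ℝ (gradient (surrogateCost ν A B Kst c) M) (N - M)
      + α / 2 * ∫ ξ, ‖response A B Kst ξ (N - M)‖ ^ 2 ∂(surrogateLaw H ν)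
      ≤ surrogateCost ν A B Kst c N := by
  have hcost := h.integrable_pairCost (A := A) (B := B) (Kst := Kst) hc M
  have hderiv : Integrable (fun ξ => surrogateDeriv A B Kst c M ξ (N - M)) (surrogateLaw H ν) :=
    (h.integrable_surrogateDeriv hc M).apply_continuousLinearMap (N - M)
  have hfirst : Integrable (fun ξ => pairCost c (surrogatePair A B Kst M ξ)
      + surrogateDeriv A B Kst c M ξ (N - M)) (surrogateLaw H ν) := hcost.add hderiv
  have hquad : Integrable (fun ξ => α / 2 * ‖response A B Kst ξ (N - M)‖ ^ 2)
      (surrogateLaw H ν) := h.integrable_pi (by fun_prop)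
  rw [h.inner_gradient_surrogateCost hc, surrogateCost_eq, surrogateCost_eq, ← integral_const_mul,
    ← integral_add hcost hderiv, ← integral_add hfirst hquad]
  refine integral_mono (hfirst.add hquad) (h.integrable_pairCost hc N) fun ξ => ?_
  have := hc.add_fderiv_add_le (surrogatePair A B Kst M ξ) (surrogatePair A B Kst N ξ)
  rwa [surrogatePair_sub] at this

theorem abs_inner_gradient_le (h : NoiseLaw ν σ W) (hc : CostClass c α G) {κ κB γ : ℝ}
    (hK : ExponentiallyStable A B κ γ Kst) (hκ : 1 ≤ κ) (hκB : 1 ≤ κB) (hB : ‖B‖ ≤ κB)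
    (hγ : 0 < γ) (hγ1 : γ < 1) {M : Policy H dx du} (hM : M ∈ policySet H dx du κ κB γ)
    (N : Policy H dx du) :
    |inner ℝ (gradient (surrogateCost ν A B Kst c) M) N| ≤ 2 * G * sizeBound κ κB γ W *
      √(∫ ξ, ‖response A B Kst ξ N‖ ^ 2 ∂(surrogateLaw H ν)) := by
  have := h.isProb
  have hG := hc.gradBound_nonneg
  have hW := h.bound_nonneg
  have hD : 0 ≤ sizeBound κ κB γ W := by unfold sizeBound; positivity
  rw [h.inner_gradient_surrogateCost hc]
  calc _ ≤ ∫ ξ, |surrogateDeriv A B Kst c M ξ N| ∂(surrogateLaw H ν) :=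
        abs_integral_le_integral_abs
    _ ≤ ∫ ξ, 2 * G * sizeBound κ κB γ W * ‖response A B Kst ξ N‖ ∂(surrogateLaw H ν) := by
        refine integral_mono_ae
          ((h.integrable_surrogateDeriv hc M).apply_continuousLinearMap N).abs
          (h.integrable_pi (by fun_prop)) ?_
        filter_upwards [h.ae_pi_norm_le] with ξ hξ
        obtain ⟨hy, hv⟩ := hK.surrogate_le_sizeBound hκ hκB hB hγ hγ1 hM hξ
        exact ContinuousLinearMap.le_of_opNorm_le _
          (hc.norm_fderiv_le (z := surrogatePair A B Kst M ξ) hy hv) (response A B Kst ξ N)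
    _ = 2 * G * sizeBound κ κB γ W * ∫ ξ, ‖response A B Kst ξ N‖ ∂(surrogateLaw H ν) :=
        integral_const_mul _ _
    _ ≤ _ := by
        gcongr
        exact integral_norm_le_sqrt_integral_norm_sq (h.integrable_pi (by fun_prop))
          (h.integrable_pi (by fun_prop))

end NoiseLaw

end SurrogateCost

/-! ### Weighted norms and projections -/

section Weighted

variable {ι : Type*} [Fintype ι] {S : Matrix ι ι ℝ}

/-- The bilinear form `uᵀ S v`, whose diagonal is `weightedSq S`. -/
def weightedInner (S : Matrix ι ι ℝ) (u v : EuclideanSpace ℝ ι) : ℝ :=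
  dotProduct u.ofLp (S.mulVec v.ofLp)

theorem weightedInner_comm (hS : S.IsSymm) (u v : EuclideanSpace ℝ ι) :
    weightedInner S u v = weightedInner S v u := by
  unfold weightedInner
  rw [Matrix.dotProduct_mulVec, ← Matrix.mulVec_transpose, hS.eq, dotProduct_comm]

theorem weightedSq_add_smul (hS : S.IsSymm) (u v : EuclideanSpace ℝ ι) (r : ℝ) :
    weightedSq S (u + r • v)
      = weightedSq S u + 2 * r * weightedInner S u v + r ^ 2 * weightedSq S v := by
  have hcomm := weightedInner_comm hS u v
  unfold weightedInner at hcomm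
  unfold weightedInner weightedSq
  simp only [WithLp.ofLp_add, WithLp.ofLp_smul, Matrix.mulVec_add, Matrix.mulVec_smul,
    dotProduct_add, add_dotProduct, smul_dotProduct, dotProduct_smul, smul_eq_mul, ← hcomm]
  ring

theorem weightedSq_neg (v : EuclideanSpace ℝ ι) : weightedSq S (-v) = weightedSq S v := by
  simp [weightedSq, Matrix.mulVec_neg]

theorem weightedSq_sub_comm (u v : EuclideanSpace ℝ ι) :
    weightedSq S (u - v) = weightedSq S (v - u) := by
  rw [← neg_sub, weightedSq_neg]

theorem abs_weightedInner_le (hS : S.IsSymm) (hpos : ∀ v, 0 ≤ weightedSq S v)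
    (u v : EuclideanSpace ℝ ι) :
    |weightedInner S u v| ≤ √(weightedSq S u) * √(weightedSq S v) := by
  have hdiscrim := discrim_le_zero (a := weightedSq S v) (b := 2 * weightedInner S u v)
    (c := weightedSq S u) fun r => by
      have := hpos (u + r • v)
      rw [weightedSq_add_smul hS] at this
      linarith
  rw [← Real.sqrt_mul (hpos u)]
  refine Real.abs_le_sqrt ?_
  rw [discrim] at hdiscrim
  linarith

namespace IsProjection

variable {C : Set (EuclideanSpace ℝ ι)} {p q r : EuclideanSpace ℝ ι}

theorem weightedInner_nonneg (hS : S.IsSymm) (hC : Convex ℝ C) (hq : IsProjection S C p q)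
    (hr : r ∈ C) : 0 ≤ weightedInner S (q - p) (r - q) := by
  have hmin : ∀ θ ∈ Set.Ioo (0 : ℝ) 1,
      0 ≤ 2 * weightedInner S (q - p) (r - q) + θ * weightedSq S (r - q) := by
    intro θ ⟨h0, h1⟩
    have hle := hq.2 _ (hC.add_smul_sub_mem hq.1 hr ⟨h0.le, h1.le⟩)
    rw [show q + θ • (r - q) - p = q - p + θ • (r - q) by abel, weightedSq_add_smul hS] at hle
    refine (mul_nonneg_iff_of_pos_left h0).1 ?_
    linarith
  have hlim : Filter.Tendsto
      (fun θ : ℝ => 2 * weightedInner S (q - p) (r - q) + θ * weightedSq S (r - q))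
      (nhdsWithin 0 (Set.Ioi 0))
      (nhds (2 * weightedInner S (q - p) (r - q) + 0 * weightedSq S (r - q))) :=
    (Continuous.tendsto (by fun_prop) 0).mono_left nhdsWithin_le_nhds
  have := ge_of_tendsto hlim
    (Filter.eventually_of_mem (Ioo_mem_nhdsGT (zero_lt_one' ℝ)) hmin)
  linarith

theorem weightedSq_add_le (hS : S.IsSymm) (hC : Convex ℝ C) (hq : IsProjection S C p q)
    (hr : r ∈ C) : weightedSq S (r - q) + weightedSq S (q - p) ≤ weightedSq S (r - p) := by
  have hexp := weightedSq_add_smul hS (q - p) (r - q) 1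
  rw [one_smul, add_comm (q - p), sub_add_sub_cancel] at hexp
  linarith [hq.weightedInner_nonneg hS hC hr]

theorem weightedSq_sub_le {x n : EuclideanSpace ℝ ι} {η : ℝ} (hS : S.IsSymm)
    (hpos : ∀ v, 0 ≤ weightedSq S v) (hC : Convex ℝ C) (hq : IsProjection S C (x - η • n) q)
    (hr : r ∈ C) :
    weightedSq S (r - q)
      ≤ weightedSq S (r - x) + 2 * η * weightedInner S (r - x) n + η ^ 2 * weightedSq S n := by
  have := hq.weightedSq_add_le hS hC hr
  rw [← weightedSq_add_smul hS]
  rw [show r - (x - η • n) = r - x + η • n by abel] at this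
  linarith [hpos (q - (x - η • n))]

end IsProjection

end Weighted

section PolicySet

variable {H dx du : ℕ} {κ κB γ : ℝ}

theorem convex_policySet (κ κB γ : ℝ) : Convex ℝ (policySet H dx du κ κB γ) := by
  intro M hM N hN a b ha hb hab i
  rw [Policy.block_add, Policy.block_smul, Policy.block_smul]
  exact mem_closedBall_zero_iff.1 <| convex_closedBall (0 : Mat du dx) _
    (mem_closedBall_zero_iff.2 (hM i)) (mem_closedBall_zero_iff.2 (hN i)) ha hb hab

theorem zero_mem_policySet (hκ : 0 ≤ κ) (hκB : 0 ≤ κB) (hγ : γ ≤ 1) :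
    (0 : Policy H dx du) ∈ policySet H dx du κ κB γ := fun i => by
  have : 0 ≤ 1 - γ := by linarith
  rw [Policy.block_zero, norm_zero]
  positivity

end PolicySet

/-! ### The preconditioner -/

/-- The standing assumptions on the system, the stabilizing controller and the noise. -/
structure Setting {dx du : ℕ} (A : Mat dx dx) (B : Mat dx du) (Kst : Mat du dx) (κ κB γ : ℝ)
    (ν : Measure (Vec dx)) (σ W : ℝ) : Prop where
  one_le_κ : 1 ≤ κ
  γ_pos : 0 < γ
  γ_lt_one : γ < 1
  σ_pos : 0 < σ
  norm_B_le : ‖B‖ ≤ κB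
  two_le : 2 ≤ κB * (1 - γ)
  stable : ExponentiallyStable A B κ γ Kst
  noise : NoiseLaw ν σ W

section Gram

variable {H dx du : ℕ} {A : Mat dx dx} {B : Mat dx du} {Kst : Mat du dx} {κ κB γ : ℝ}
  {ν : Measure (Vec dx)} {σ W : ℝ} {c : Vec dx → Vec du → ℝ} {α G : ℝ}

namespace Setting

theorem two_le_κB (h : Setting A B Kst κ κB γ ν σ W) : 2 ≤ κB :=
  h.two_le.trans <| mul_le_of_le_one_right ((norm_nonneg _).trans h.norm_B_le)
    (by linarith [h.γ_pos])

theorem one_le_κB (h : Setting A B Kst κ κB γ ν σ W) : 1 ≤ κB :=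
  one_le_two.trans h.two_le_κB

theorem one_le_inv_γ (h : Setting A B Kst κ κB γ ν σ W) : 1 ≤ γ⁻¹ :=
  (one_le_inv₀ h.γ_pos).2 h.γ_lt_one.le

theorem sizeBound_nonneg (h : Setting A B Kst κ κB γ ν σ W) : 0 ≤ sizeBound κ κB γ W := by
  have := h.noise.bound_nonneg
  have := h.one_le_κ
  unfold sizeBound
  positivity

end Setting

theorem gram_isSymm : (gram H ν A B Kst).IsSymm := by
  ext p q
  simp only [Matrix.transpose_apply, gram, Matrix.of_apply]
  exact integral_congr_ae (.of_forall fun ξ => real_inner_comm _ _)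

theorem norm_response_sq_eq_sum (N : Policy H dx du) (ξ : Fin (2 * H + 1) → Vec dx) :
    ‖response A B Kst ξ N‖ ^ 2 = ∑ p, ∑ q,
      N p * N q * inner ℝ (jacobianCol A B Kst ξ p) (jacobianCol A B Kst ξ q) := by
  have hN : N = ∑ p, N p • EuclideanSpace.single p (1 : ℝ) := by
    ext q
    simp [Pi.single_apply]
  conv_lhs => rw [hN]
  simp only [← real_inner_self_eq_norm_sq, map_sum, map_smul, sum_inner, inner_sum,
    real_inner_smul_left, real_inner_smul_right, jacobianCol_eq, mul_assoc]
  exact Finset.sum_congr rfl fun p _ => Finset.sum_congr rfl fun q _ => by rw [real_inner_comm]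

theorem NoiseLaw.weightedSq_gram (h : NoiseLaw ν σ W) (N : Policy H dx du) :
    weightedSq (gram H ν A B Kst) N
      = ∫ ξ, ‖response A B Kst ξ N‖ ^ 2 ∂(surrogateLaw H ν) := by
  have hint : ∀ p q : Fin H × Fin du × Fin dx, Integrable (fun ξ => N p * N q *
      inner ℝ (jacobianCol A B Kst ξ p) (jacobianCol A B Kst ξ q)) (surrogateLaw H ν) :=
    fun p q => by
      simp only [jacobianCol_eq]
      exact h.integrable_pi (by fun_prop)
  simp_rw [norm_response_sq_eq_sum]
  rw [integral_finsetSum _ fun p _ => integrable_finsetSum _ fun q _ => hint p q]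
  unfold weightedSq dotProduct Matrix.mulVec
  refine Finset.sum_congr rfl fun p _ => ?_
  rw [integral_finsetSum _ fun q _ => hint p q, dotProduct, Finset.mul_sum]
  refine Finset.sum_congr rfl fun q _ => ?_
  rw [integral_const_mul, gram, Matrix.of_apply]
  ring

theorem NoiseLaw.weightedSq_gram_nonneg (h : NoiseLaw ν σ W) (N : Policy H dx du) :
    0 ≤ weightedSq (gram H ν A B Kst) N := by
  rw [h.weightedSq_gram]
  exact integral_nonneg fun _ => sq_nonneg _

theorem NoiseLaw.sqrt_integral_norm_sq_le (h : NoiseLaw ν σ W) : √(∫ w, ‖w‖ ^ 2 ∂ν) ≤ W :=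
  Real.sqrt_le_iff.2 ⟨h.bound_nonneg, h.integral_norm_sq_le⟩

namespace Setting

theorem sqrt_energy_le (h : Setting A B Kst κ κB γ ν σ W) (N : Policy H dx du) :
    √(N.energy ν) ≤ 2 * κ * √(weightedSq (gram H ν A B Kst) N) := by
  have hκ := h.one_le_κ
  have hle := h.noise.energy_le_integral_response hκ h.stable N
  rw [← h.noise.weightedSq_gram] at hle
  calc _ ≤ √((2 * κ) ^ 2 * weightedSq (gram H ν A B Kst) N) := Real.sqrt_le_sqrt hle
    _ = _ := by rw [Real.sqrt_mul (sq_nonneg _), Real.sqrt_sq (by linarith)]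

theorem sqrt_weightedSq_le (h : Setting A B Kst κ κB γ ν σ W) (N : Policy H dx du) :
    √(weightedSq (gram H ν A B Kst) N)
      ≤ 3 * κ ^ 3 * κB * γ⁻¹ * √(∫ w, ‖w‖ ^ 2 ∂ν) * ‖N‖ := by
  have hκ := h.one_le_κ
  have hg := h.one_le_inv_γ
  have hκB := h.one_le_κB
  have hle := h.noise.integral_response_le hκ h.γ_pos h.γ_lt_one h.norm_B_le hκB h.stable N
  rw [← h.noise.weightedSq_gram] at hle
  calc _ ≤ √((3 * κ ^ 3 * κB * γ⁻¹) ^ 2 * (‖N‖ ^ 2 * ∫ w, ‖w‖ ^ 2 ∂ν)) :=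
        Real.sqrt_le_sqrt (hle.trans (by gcongr; exact h.noise.energy_le N))
    _ = _ := by
      rw [Real.sqrt_mul (sq_nonneg _), Real.sqrt_mul (sq_nonneg _), Real.sqrt_sq (by positivity),
        Real.sqrt_sq (norm_nonneg _)]
      ring

theorem sqrt_weightedSq_le_bound (h : Setting A B Kst κ κB γ ν σ W) (N : Policy H dx du) :
    √(weightedSq (gram H ν A B Kst) N) ≤ 3 * κ ^ 3 * κB * γ⁻¹ * W * ‖N‖ := by
  have hκ := h.one_le_κ
  have hg := h.one_le_inv_γ
  have hκB := h.one_le_κB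
  refine (h.sqrt_weightedSq_le N).trans ?_
  gcongr
  exact h.noise.sqrt_integral_norm_sq_le

theorem mul_norm_le (h : Setting A B Kst κ κB γ ν σ W) (N : Policy H dx du) :
    σ * ‖N‖ ≤ 2 * κ * √(weightedSq (gram H ν A B Kst) N) := by
  have hle := h.noise.le_energy N
  rw [← mul_pow] at hle
  exact (Real.le_sqrt_of_sq_le hle).trans (h.sqrt_energy_le N)

theorem isUnit_gram (h : Setting A B Kst κ κB γ ν σ W) : IsUnit (gram H ν A B Kst) := by
  rw [← Matrix.mulVec_injective_iff_isUnit]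
  refine (injective_iff_map_eq_zero (Matrix.mulVecLin (gram H ν A B Kst))).2 fun v hv => ?_
  rw [Matrix.mulVecLin_apply] at hv
  have hnorm := h.mul_norm_le (WithLp.toLp 2 v)
  rw [weightedSq, hv, dotProduct_zero, Real.sqrt_zero, mul_zero] at hnorm
  have hzero : (WithLp.toLp 2 v : Policy H dx du) = 0 :=
    norm_le_zero_iff.1 (nonpos_of_mul_nonpos_right hnorm h.σ_pos)
  simpa using congrArg WithLp.ofLp hzero

theorem weightedInner_naturalGradient (h : Setting A B Kst κ κB γ ν σ W) (M N : Policy H dx du) :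
    weightedInner (gram H ν A B Kst) N (naturalGradient ν A B Kst c M)
      = inner ℝ (gradient (surrogateCost ν A B Kst c) M) N := by
  have hu : IsUnit (gram H ν A B Kst).det := (Matrix.isUnit_iff_isUnit_det _).1 h.isUnit_gram
  unfold weightedInner naturalGradient
  rw [Matrix.toLpLin_apply, Matrix.mulVec_mulVec, Matrix.mul_nonsing_inv _ hu, Matrix.one_mulVec,
    PiLp.inner_apply]
  rfl

theorem sqrt_weightedSq_naturalGradient_le (h : Setting A B Kst κ κB γ ν σ W)
    (hc : CostClass c α G) {M : Policy H dx du} (hM : M ∈ policySet H dx du κ κB γ) :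
    √(weightedSq (gram H ν A B Kst) (naturalGradient ν A B Kst c M))
      ≤ 2 * G * sizeBound κ κB γ W := by
  set n := naturalGradient ν A B Kst c M
  have hle := h.noise.abs_inner_gradient_le hc h.stable h.one_le_κ h.one_le_κB h.norm_B_le h.γ_pos
    h.γ_lt_one hM n
  have hself : inner ℝ (gradient (surrogateCost ν A B Kst c) M) n
      = √(weightedSq (gram H ν A B Kst) n) * √(weightedSq (gram H ν A B Kst) n) := by
    rw [← h.weightedInner_naturalGradient, Real.mul_self_sqrt (h.noise.weightedSq_gram_nonneg n)]
    rfl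
  rw [← h.noise.weightedSq_gram, hself, abs_of_nonneg (by positivity)] at hle
  rcases (Real.sqrt_nonneg (weightedSq (gram H ν A B Kst) n)).eq_or_lt with h0 | h0
  · rw [← h0]
    exact mul_nonneg (mul_nonneg zero_le_two hc.gradBound_nonneg) h.sizeBound_nonneg
  · exact le_of_mul_le_mul_right hle h0

end Setting

end Gram

/-! ### A lower bound on `μ⁻¹` -/

section TestDirection

variable {H dx du : ℕ} {κ κB γ : ℝ} {ν : Measure (Vec dx)} {σ W : ℝ}

theorem app_single (a : Fin du) (b : Fin dx) (r : ℝ) (w : Vec dx) :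
    app (Matrix.single a b r : Mat du dx) w = EuclideanSpace.single a (r * w b) := by
  ext a'
  rw [app_apply]
  by_cases h : a' = a
  · subst h
    simp [Matrix.single_apply]
  · simp [h, Ne.symm h]

theorem Policy.block_single (i k : Fin H) (a : Fin du) (b : Fin dx) (r : ℝ) :
    Policy.block (EuclideanSpace.single (i, a, b) r) k
      = if k = i then Matrix.single a b r else 0 := by
  ext a' b'
  rw [Policy.block_apply]
  by_cases hk : k = i
  · simp [hk, Matrix.single_apply, eq_comm]
  · simp [hk]

theorem norm_matrixSingle_le_one (a : Fin du) (b : Fin dx) :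
    ‖(Matrix.single a b 1 : Mat du dx)‖ ≤ 1 := by
  refine norm_le_of_forall_norm_app_le _ zero_le_one fun w => ?_
  rw [app_single, PiLp.norm_single, one_mul, one_mul]
  exact PiLp.norm_apply_le w b

theorem Policy.energy_single (i : Fin H) (a : Fin du) (b : Fin dx) :
    Policy.energy ν (EuclideanSpace.single (i, a, b) 1) = ∫ w, w b ^ 2 ∂ν := by
  rw [Policy.energy, Finset.sum_eq_single i]
  · simp [Policy.block_single, app_single]
  · intro k _ hk
    simp [Policy.block_single, hk]
  · simp

-- This is where `κB (1 - γ) ≥ 2` enters: `𝓜` contains a unit vector.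
theorem single_mem_policySet (hκ : 1 ≤ κ) (hκB : 1 ≤ κB * (1 - γ)) (h0κB : 0 ≤ κB) (hγ : γ ≤ 1)
    (hH : 0 < H) (a : Fin du) (b : Fin dx) :
    EuclideanSpace.single (⟨0, hH⟩, a, b) 1 ∈ policySet H dx du κ κB γ := by
  intro k
  have : 0 ≤ 1 - γ := by linarith
  rw [Policy.block_single]
  split_ifs with hk
  · subst hk
    calc _ ≤ (1 : ℝ) := norm_matrixSingle_le_one a b
      _ ≤ κ ^ 3 * (κB * (1 - γ)) := one_le_mul_of_one_le_of_one_le (one_le_pow₀ hκ) hκB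
      _ = _ := by ring
  · rw [norm_zero]
    positivity

theorem NoiseLaw.exists_integral_norm_sq_le [Nonempty (Fin dx)] (h : NoiseLaw ν σ W) :
    ∃ b : Fin dx, ∫ w, ‖w‖ ^ 2 ∂ν ≤ dx * ∫ w, w b ^ 2 ∂ν := by
  have hsum : ∫ w, ‖w‖ ^ 2 ∂ν = ∑ b : Fin dx, ∫ w, w b ^ 2 ∂ν := by
    rw [← integral_finsetSum _ fun b _ => h.integrable (by fun_prop)]
    simp_rw [EuclideanSpace.real_norm_sq_eq]
  obtain ⟨b, -, hb⟩ := Finset.exists_le_of_sum_le (s := (Finset.univ : Finset (Fin dx)))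
    (f := fun _ => ∫ w, ‖w‖ ^ 2 ∂ν) (g := fun b => dx * ∫ w, w b ^ 2 ∂ν) Finset.univ_nonempty
    (by simp [hsum, Finset.mul_sum])
  exact ⟨b, hb⟩

end TestDirection

section MuInv

variable {H dx du T : ℕ} {A : Mat dx dx} {B : Mat dx du} {Kst : Mat du dx} {κ κB γ : ℝ}
  {ν : Measure (Vec dx)} {σ W : ℝ} {c : Vec dx → Vec du → ℝ} {cs : ℕ → Vec dx → Vec du → ℝ}
  {α G : ℝ}

theorem muInv_nonneg : 0 ≤ muInv H ν A B Kst cs κ κB γ T := by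
  refine Real.sSup_nonneg ?_
  rintro r ⟨s, -, N, -, rfl⟩
  exact norm_nonneg _

theorem NoiseLaw.mul_weightedSq_sub_le (h : NoiseLaw ν σ W) (hc : CostClass c α G)
    (M N : Policy H dx du) :
    α * weightedSq (gram H ν A B Kst) (N - M)
      ≤ inner ℝ (gradient (surrogateCost ν A B Kst c) N) (N - M)
        - inner ℝ (gradient (surrogateCost ν A B Kst c) M) (N - M) := by
  have hMN := h.add_inner_gradient_add_le (A := A) (B := B) (Kst := Kst) hc M N
  have hNM := h.add_inner_gradient_add_le (A := A) (B := B) (Kst := Kst) hc N M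
  rw [← h.weightedSq_gram] at hMN hNM
  rw [weightedSq_sub_comm, ← neg_sub N M, inner_neg_right] at hNM
  linarith

namespace Setting

theorem norm_naturalGradient_le_muInv (h : Setting A B Kst κ κB γ ν σ W)
    (hc : ∀ t < T, CostClass (cs t) α G) {t : ℕ} (ht : t < T) {M : Policy H dx du}
    (hM : M ∈ policySet H dx du κ κB γ) :
    ‖naturalGradient ν A B Kst (cs t) M‖ ≤ muInv H ν A B Kst cs κ κB γ T := by
  refine le_csSup ⟨2 * κ * (2 * G * sizeBound κ κB γ W) / σ, ?_⟩ ⟨t, ht, M, hM, rfl⟩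
  rintro r ⟨s, hs, N, hN, rfl⟩
  rw [le_div_iff₀ h.σ_pos, mul_comm]
  refine (h.mul_norm_le _).trans ?_
  have := h.one_le_κ
  gcongr
  exact h.sqrt_weightedSq_naturalGradient_le (hc s hs) hN

theorem abs_inner_gradient_le_muInv (h : Setting A B Kst κ κB γ ν σ W)
    (hc : ∀ t < T, CostClass (cs t) α G) {t : ℕ} (ht : t < T) {M : Policy H dx du}
    (hM : M ∈ policySet H dx du κ κB γ) (N : Policy H dx du) :
    |inner ℝ (gradient (surrogateCost ν A B Kst (cs t)) M) N|
      ≤ √(weightedSq (gram H ν A B Kst) N) * (3 * κ ^ 3 * κB * γ⁻¹ * √(∫ w, ‖w‖ ^ 2 ∂ν)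
        * muInv H ν A B Kst cs κ κB γ T) := by
  have hκ := h.one_le_κ
  have hκB := h.one_le_κB
  have hγ := h.γ_pos
  rw [← h.weightedInner_naturalGradient]
  refine (abs_weightedInner_le gram_isSymm h.noise.weightedSq_gram_nonneg _ _).trans ?_
  gcongr
  refine (h.sqrt_weightedSq_le _).trans ?_
  gcongr
  exact h.norm_naturalGradient_le_muInv hc ht hM

-- Strong convexity makes the gradient vary by at least `α ‖Δ‖` between `0` and `Δ`.
theorem mul_sqrt_weightedSq_le_muInv (h : Setting A B Kst κ κB γ ν σ W)
    (hc : ∀ t < T, CostClass (cs t) α G) (hT : 0 < T) {Δ : Policy H dx du}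
    (hΔ : Δ ∈ policySet H dx du κ κB γ) :
    α * √(weightedSq (gram H ν A B Kst) Δ) ≤ 6 * κ ^ 3 * κB * γ⁻¹ * √(∫ w, ‖w‖ ^ 2 ∂ν)
      * muInv H ν A B Kst cs κ κB γ T := by
  have hκ := h.one_le_κ
  have hκB := h.one_le_κB
  have hγ := h.γ_pos
  have h0 : (0 : Policy H dx du) ∈ policySet H dx du κ κB γ :=
    zero_mem_policySet (by linarith) (by linarith) h.γ_lt_one.le
  have hconv := h.noise.mul_weightedSq_sub_le (A := A) (B := B) (Kst := Kst) (hc 0 hT) 0 Δ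
  have hgrad0 := (abs_le.1 (h.abs_inner_gradient_le_muInv hc hT h0 Δ)).1
  have hgradΔ := (abs_le.1 (h.abs_inner_gradient_le_muInv hc hT hΔ Δ)).2
  rw [sub_zero, ← Real.mul_self_sqrt (h.noise.weightedSq_gram_nonneg Δ)] at hconv
  have hmu := muInv_nonneg (H := H) (ν := ν) (A := A) (B := B) (Kst := Kst) (cs := cs) (κ := κ)
    (κB := κB) (γ := γ) (T := T)
  rcases (Real.sqrt_nonneg (weightedSq (gram H ν A B Kst) Δ)).eq_or_lt with hq | hq
  · rw [← hq, mul_zero]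
    positivity
  · refine le_of_mul_le_mul_left ?_ hq
    linarith

theorem exists_mem_policySet_sqrt_integral_le (h : Setting A B Kst κ κB γ ν σ W) (hH : 0 < H)
    (hdx : 0 < dx) (hdu : 0 < du) :
    ∃ Δ ∈ policySet H dx du κ κB γ, 0 < √(weightedSq (gram H ν A B Kst) Δ) ∧
      √(∫ w, ‖w‖ ^ 2 ∂ν) ≤ dx * (2 * κ * √(weightedSq (gram H ν A B Kst) Δ)) := by
  have hκ := h.one_le_κ
  have hdx1 : (1 : ℝ) ≤ dx := by exact_mod_cast hdx
  have : Nonempty (Fin dx) := ⟨⟨0, hdx⟩⟩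
  obtain ⟨b, hb⟩ := h.noise.exists_integral_norm_sq_le
  set Δ : Policy H dx du := EuclideanSpace.single (⟨0, hH⟩, ⟨0, hdu⟩, b) 1
  refine ⟨Δ, single_mem_policySet hκ (by linarith [h.two_le]) (by linarith [h.two_le_κB])
    h.γ_lt_one.le hH _ b, ?_, ?_⟩
  · have hnorm : ‖Δ‖ = 1 := by simp [Δ]
    have hle := h.mul_norm_le Δ
    rw [hnorm, mul_one] at hle
    exact pos_of_mul_pos_right (h.σ_pos.trans_le hle) (by positivity)
  · rw [← Policy.energy_single ⟨0, hH⟩ ⟨0, hdu⟩] at hb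
    calc √(∫ w, ‖w‖ ^ 2 ∂ν) ≤ √(dx ^ 2 * Δ.energy ν) := by
          refine Real.sqrt_le_sqrt (hb.trans ?_)
          have := Δ.energy_nonneg (ν := ν)
          gcongr
          exact le_self_pow₀ hdx1 two_ne_zero
      _ = dx * √(Δ.energy ν) := by rw [Real.sqrt_mul (by positivity), Real.sqrt_sq (by positivity)]
      _ ≤ _ := by gcongr; exact h.sqrt_energy_le Δ

theorem le_muInv (h : Setting A B Kst κ κB γ ν σ W) (hc : ∀ t < T, CostClass (cs t) α G)
    (hT : 0 < T) (hH : 0 < H) (hdx : 0 < dx) (hdu : 0 < du) :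
    α ≤ 12 * κ ^ 4 * κB * γ⁻¹ * dx * muInv H ν A B Kst cs κ κB γ T := by
  have hκ := h.one_le_κ
  have hκB := h.one_le_κB
  have hγ := h.γ_pos
  have hmu := muInv_nonneg (H := H) (ν := ν) (A := A) (B := B) (Kst := Kst) (cs := cs) (κ := κ)
    (κB := κB) (γ := γ) (T := T)
  obtain ⟨Δ, hΔ, hq, hnoise⟩ := h.exists_mem_policySet_sqrt_integral_le hH hdx hdu
  refine le_of_mul_le_mul_right ?_ hq
  calc α * √(weightedSq (gram H ν A B Kst) Δ)
    _ ≤ 6 * κ ^ 3 * κB * γ⁻¹ * √(∫ w, ‖w‖ ^ 2 ∂ν) * muInv H ν A B Kst cs κ κB γ T :=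
        h.mul_sqrt_weightedSq_le_muInv hc hT hΔ
    _ ≤ 6 * κ ^ 3 * κB * γ⁻¹ * (dx * (2 * κ * √(weightedSq (gram H ν A B Kst) Δ)))
          * muInv H ν A B Kst cs κ κB γ T := by gcongr
    _ = _ := by ring

end Setting

end MuInv

/-! ### Regret of the natural gradient iteration -/

theorem sum_range_inv_succ_le (T : ℕ) :
    ∑ t ∈ Finset.range T, ((t : ℝ) + 1)⁻¹ ≤ 1 + Real.log T := by
  have h := harmonic_le_one_add_log T
  rw [harmonic] at h
  push_cast at h
  exact h

section Run

variable {H dx du : ℕ} {A : Mat dx dx} {B : Mat dx du} {Kst : Mat du dx} {κ κB γ : ℝ}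
  {ν : Measure (Vec dx)} {σ W : ℝ} {c : ℕ → Vec dx → Vec du → ℝ} {α G a : ℝ} {T : ℕ} {η : ℕ → ℝ}
  {M : ℕ → Policy H dx du}

theorem IsNaturalGradientRun.mem (hrun : IsNaturalGradientRun ν A B Kst c κ κB γ T η M) {t : ℕ}
    (ht : t ≤ T) : M t ∈ policySet H dx du κ κB γ := by
  cases t with
  | zero => exact hrun.1
  | succ t => exact (hrun.2 t ht).1

theorem IsNaturalGradientRun.weightedSq_step_le
    (hrun : IsNaturalGradientRun ν A B Kst c κ κB γ T η M) (hν : NoiseLaw ν σ W) {t : ℕ}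
    (ht : t < T) : weightedSq (gram H ν A B Kst) (M (t + 1) - M t)
      ≤ η t ^ 2 * weightedSq (gram H ν A B Kst) (naturalGradient ν A B Kst (c t) (M t)) := by
  have h := (hrun.2 t ht).weightedSq_sub_le gram_isSymm hν.weightedSq_gram_nonneg
    (convex_policySet κ κB γ) (hrun.mem ht.le)
  rwa [sub_self, show weightedSq (gram H ν A B Kst) 0 = 0 by simp [weightedSq],
    show ∀ v, weightedInner (gram H ν A B Kst) 0 v = 0 by simp [weightedInner], mul_zero, zero_add,
    zero_add, weightedSq_sub_comm] at h

namespace Setting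

theorem sqrt_weightedSq_naturalGradient_le_muInv (h : Setting A B Kst κ κB γ ν σ W)
    (hc : ∀ t < T, CostClass (c t) α G) {t : ℕ} (ht : t < T) {N : Policy H dx du}
    (hN : N ∈ policySet H dx du κ κB γ) :
    √(weightedSq (gram H ν A B Kst) (naturalGradient ν A B Kst (c t) N))
      ≤ 3 * κ ^ 3 * κB * γ⁻¹ * W * muInv H ν A B Kst c κ κB γ T := by
  have hκ := h.one_le_κ
  have hκB := h.one_le_κB
  have hγ := h.γ_pos
  have hW := h.noise.bound_nonneg
  refine (h.sqrt_weightedSq_le_bound _).trans ?_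
  gcongr
  exact h.norm_naturalGradient_le_muInv hc ht hN

theorem weightedSq_naturalGradient_le_muInv (h : Setting A B Kst κ κB γ ν σ W)
    (hc : ∀ t < T, CostClass (c t) α G) {t : ℕ} (ht : t < T) {N : Policy H dx du}
    (hN : N ∈ policySet H dx du κ κB γ) :
    weightedSq (gram H ν A B Kst) (naturalGradient ν A B Kst (c t) N)
      ≤ 2 * G * sizeBound κ κB γ W
        * (3 * κ ^ 3 * κB * γ⁻¹ * W * muInv H ν A B Kst c κ κB γ T) := by
  have hsize := h.sqrt_weightedSq_naturalGradient_le (hc t ht) hN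
  rw [← Real.mul_self_sqrt (h.noise.weightedSq_gram_nonneg _)]
  exact mul_le_mul hsize (h.sqrt_weightedSq_naturalGradient_le_muInv hc ht hN)
    (Real.sqrt_nonneg _) ((Real.sqrt_nonneg _).trans hsize)

theorem sqrt_step_le (h : Setting A B Kst κ κB γ ν σ W)
    (hc : ∀ t < T, CostClass (c t) α G) (hη : ∀ t, 0 ≤ η t)
    (hrun : IsNaturalGradientRun ν A B Kst c κ κB γ T η M) {t : ℕ} (ht : t < T) :
    √(weightedSq (gram H ν A B Kst) (M (t + 1) - M t))
      ≤ η t * (3 * κ ^ 3 * κB * γ⁻¹ * W * muInv H ν A B Kst c κ κB γ T) :=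
  calc _ ≤ √(η t ^ 2 * weightedSq (gram H ν A B Kst) (naturalGradient ν A B Kst (c t) (M t))) :=
        Real.sqrt_le_sqrt (hrun.weightedSq_step_le h.noise ht)
    _ = η t * √(weightedSq (gram H ν A B Kst) (naturalGradient ν A B Kst (c t) (M t))) := by
        rw [Real.sqrt_mul (sq_nonneg _), Real.sqrt_sq (hη t)]
    _ ≤ _ := mul_le_mul_of_nonneg_left
        (h.sqrt_weightedSq_naturalGradient_le_muInv hc ht (hrun.mem ht.le)) (hη t)

-- In the norm of the preconditioner the cost is `α`-strongly convex, so the term `-α` pays for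
-- the growth of `η⁻¹` from one round to the next.
theorem two_mul_sub_le (h : Setting A B Kst κ κB γ ν σ W) {f : Vec dx → Vec du → ℝ} {s : ℝ}
    (hf : CostClass f α G) (hs : 0 < s) {x x' N : Policy H dx du}
    (hx : IsProjection (gram H ν A B Kst) (policySet H dx du κ κB γ)
      (x - s • naturalGradient ν A B Kst f x) x') (hN : N ∈ policySet H dx du κ κB γ) :
    2 * (surrogateCost ν A B Kst f x - surrogateCost ν A B Kst f N)
      ≤ s * weightedSq (gram H ν A B Kst) (naturalGradient ν A B Kst f x)
        + (s⁻¹ - α) * weightedSq (gram H ν A B Kst) (N - x)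
        - s⁻¹ * weightedSq (gram H ν A B Kst) (N - x') := by
  have hstep := hx.weightedSq_sub_le gram_isSymm h.noise.weightedSq_gram_nonneg
    (convex_policySet κ κB γ) hN
  have hconv := h.noise.add_inner_gradient_add_le (A := A) (B := B) (Kst := Kst) hf x N
  rw [← h.noise.weightedSq_gram, ← h.weightedInner_naturalGradient] at hconv
  set n := naturalGradient ν A B Kst f x
  set S := gram H ν A B Kst
  have hscaled : s⁻¹ * weightedSq S (N - x')
      ≤ s⁻¹ * weightedSq S (N - x) + 2 * weightedInner S (N - x) n + s * weightedSq S n :=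
    calc _ ≤ s⁻¹ * (weightedSq S (N - x) + 2 * s * weightedInner S (N - x) n
            + s ^ 2 * weightedSq S n) := by gcongr
      _ = _ := by field_simp
  linarith

theorem two_mul_sum_sub_le (h : Setting A B Kst κ κB γ ν σ W)
    (hc : ∀ t < T, CostClass (c t) α G) (hα : 0 < α) (ha : 1 ≤ a)
    (hrun : IsNaturalGradientRun ν A B Kst c κ κB γ T (fun t => a / (α * ((t : ℝ) + 1))) M)
    {N : Policy H dx du} (hN : N ∈ policySet H dx du κ κB γ) {n : ℕ} (hn : n ≤ T) :
    2 * ∑ t ∈ Finset.range n,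
        (surrogateCost ν A B Kst (c t) (M t) - surrogateCost ν A B Kst (c t) N)
      ≤ ∑ t ∈ Finset.range n, a / (α * ((t : ℝ) + 1))
          * weightedSq (gram H ν A B Kst) (naturalGradient ν A B Kst (c t) (M t))
        - α / a * n * weightedSq (gram H ν A B Kst) (N - M n) := by
  induction n with
  | zero => simp
  | succ n ih =>
    have hη : 0 < a / (α * ((n : ℝ) + 1)) := by positivity
    have hstep := h.two_mul_sub_le (hc n hn) hη (hrun.2 n hn) hN
    have hinv : (a / (α * ((n : ℝ) + 1)))⁻¹ = α / a * n + α / a := by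
      field_simp
    have hα' : α / a * weightedSq (gram H ν A B Kst) (N - M n)
        ≤ α * weightedSq (gram H ν A B Kst) (N - M n) :=
      mul_le_mul_of_nonneg_right (div_le_self hα.le ha) (h.noise.weightedSq_gram_nonneg _)
    rw [hinv] at hstep
    rw [Finset.sum_range_succ, Finset.sum_range_succ, mul_add]
    push_cast
    linarith [ih (by omega)]

theorem regret_le (h : Setting A B Kst κ κB γ ν σ W)
    (hc : ∀ t < T, CostClass (c t) α G) (hT : 0 < T) (hα : 0 < α) (ha : 1 ≤ a)
    (hrun : IsNaturalGradientRun ν A B Kst c κ κB γ T (fun t => a / (α * ((t : ℝ) + 1))) M)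
    {N : Policy H dx du} (hN : N ∈ policySet H dx du κ κB γ) :
    ∑ t ∈ Finset.range T,
        (surrogateCost ν A B Kst (c t) (M t) - surrogateCost ν A B Kst (c t) N)
      ≤ a / α * (G * sizeBound κ κB γ W) *
        (3 * κ ^ 3 * κB * γ⁻¹ * W * muInv H ν A B Kst c κ κB γ T) * (1 + Real.log T) := by
  have htel := h.two_mul_sum_sub_le hc hα ha hrun hN le_rfl
  have hlast : 0 ≤ α / a * T * weightedSq (gram H ν A B Kst) (N - M T) :=
    mul_nonneg (by positivity) (h.noise.weightedSq_gram_nonneg _)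
  set Γ := 2 * G * sizeBound κ κB γ W
    * (3 * κ ^ 3 * κB * γ⁻¹ * W * muInv H ν A B Kst c κ κB γ T)
  have hΓ0 : 0 ≤ Γ := (h.noise.weightedSq_gram_nonneg _).trans
    (h.weightedSq_naturalGradient_le_muInv hc hT (hrun.mem hT.le))
  have hsteps : ∑ t ∈ Finset.range T, a / (α * ((t : ℝ) + 1))
        * weightedSq (gram H ν A B Kst) (naturalGradient ν A B Kst (c t) (M t))
      ≤ a / α * Γ * (1 + Real.log T) :=
    calc _ ≤ ∑ t ∈ Finset.range T, a / (α * ((t : ℝ) + 1)) * Γ := by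
          gcongr with t ht
          exact h.weightedSq_naturalGradient_le_muInv hc (Finset.mem_range.1 ht)
            (hrun.mem (Finset.mem_range.1 ht).le)
      _ = a / α * Γ * ∑ t ∈ Finset.range T, ((t : ℝ) + 1)⁻¹ := by
          rw [Finset.mul_sum]
          exact Finset.sum_congr rfl fun t _ => by rw [div_mul_eq_div_div]; ring
      _ ≤ _ := by gcongr; exact sum_range_inv_succ_le T
  linarith

end Setting

end Run

/-! ### Trajectories -/

section Trajectory

variable {H dx du : ℕ}

/-- The control played in round `t` along the trajectory of the controller `π`. -/
noncomputable def control (A : Mat dx dx) (B : Mat dx du) (π : Controller dx du)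
    (w : ℕ → Vec dx) (t : ℕ) : Vec du :=
  π t (state A B π w t) w

/-- The part of the control that is not explained by the feedback `-K x`. Any controller is thus
seen as a perturbation of the stable system `A - B K`. -/
noncomputable def extraControl (A : Mat dx dx) (B : Mat dx du) (K : Mat du dx)
    (π : Controller dx du) (w : ℕ → Vec dx) (t : ℕ) : Vec du :=
  control A B π w t + app K (state A B π w t)

/-- The `H` disturbances before round `t`, the latest first, extended by zero before round `0`. -/
def past (H : ℕ) (w : ℕ → Vec dx) (t : ℕ) : Fin H → Vec dx :=
  fun i => if (i : ℕ) + 1 ≤ t then w (t - (i + 1)) else 0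

/-- The `2 H + 1` disturbances before round `t`, the latest first, which couple the surrogate to the
trajectory; meaningful for `2 H + 1 ≤ t`. -/
def lagged (H : ℕ) (w : ℕ → Vec dx) (t : ℕ) : Fin (2 * H + 1) → Vec dx :=
  fun i => w (t - 1 - i)

/-- The difference between the extra control of `π` in round `s` and that of the fixed policy
`N`. -/
noncomputable def deviation (A : Mat dx dx) (B : Mat dx du) (K : Mat du dx)
    (π : Controller dx du) (N : Policy H dx du) (w : ℕ → Vec dx) (s : ℕ) : Vec du :=
  extraControl A B K π w s - Policy.act (past H w s) N

/-- The distance in round `t` between the state and control of `π` and the surrogate state and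
action of the fixed policy `N`, driven by the same disturbances. -/
noncomputable def surrogateGap (A : Mat dx dx) (B : Mat dx du) (K : Mat du dx)
    (π : Controller dx du) (N : Policy H dx du) (w : ℕ → Vec dx) (t : ℕ) : ℝ :=
  ‖state A B π w t - surrogateState A B K N (lagged H w t)‖
    + ‖control A B π w t - surrogateAction A B K N (lagged H w t)‖

variable (A : Mat dx dx) (B : Mat dx du) (K : Mat du dx) (π : Controller dx du)
  (w : ℕ → Vec dx)

theorem control_eq (t : ℕ) :
    control A B π w t = - app K (state A B π w t) + extraControl A B K π w t := by
  rw [extraControl]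
  abel

theorem extraControl_eq (N : Policy H dx du) (t : ℕ) :
    extraControl A B K π w t = Policy.act (past H w t) N + deviation A B K π N w t := by
  rw [deviation]
  abel

theorem state_succ_eq (t : ℕ) : state A B π w (t + 1)
    = app (A - B * K) (state A B π w t) + app B (extraControl A B K π w t) + w t := by
  rw [state, extraControl, control, sub_app, mul_app, app_add]
  abel

theorem state_add (n t : ℕ) :
    state A B π w (t + n) = ∑ j ∈ Finset.range n, app ((A - B * K) ^ j)
        (app B (extraControl A B K π w (t + n - 1 - j)) + w (t + n - 1 - j))
      + app ((A - B * K) ^ n) (state A B π w t) := by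
  induction n with
  | zero => simp
  | succ n ih =>
    have hshift : ∀ j, app (A - B * K) (app ((A - B * K) ^ j)
          (app B (extraControl A B K π w (t + n - 1 - j)) + w (t + n - 1 - j)))
        = app ((A - B * K) ^ (j + 1))
          (app B (extraControl A B K π w (t + n - (j + 1))) + w (t + n - (j + 1))) := fun j => by
      rw [← mul_app, ← pow_succ', show t + n - 1 - j = t + n - (j + 1) by omega]
    rw [← add_assoc, state_succ_eq A B K, ih, Finset.sum_range_succ', app_add, app_sum, ← mul_app,
      ← pow_succ', Finset.sum_congr rfl fun j _ => hshift j]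
    simp only [pow_zero, one_app, Nat.sub_zero, Nat.add_sub_cancel]
    abel

theorem state_eq_sum (t : ℕ) : state A B π w t = ∑ j : Fin t, app ((A - B * K) ^ (j : ℕ))
    (app B (extraControl A B K π w (t - 1 - j)) + w (t - 1 - j)) := by
  have hunroll := state_add A B K π w t 0
  rw [zero_add, state.eq_1, app_zero, add_zero] at hunroll
  rw [hunroll, Finset.sum_range]

variable {w}

theorem norm_past_le {W : ℝ} (hw : ∀ s, ‖w s‖ ≤ W) (t : ℕ) (k : Fin H) : ‖past H w t k‖ ≤ W := by
  unfold past
  split_ifs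
  · exact hw _
  · rw [norm_zero]
    exact (norm_nonneg _).trans (hw 0)

theorem past_apply_of_le {t : ℕ} (ht : H ≤ t) (k : Fin H) : past H w t k = w (t - (k + 1)) :=
  if_pos (by omega)

@[fun_prop] theorem continuous_lagged (t : ℕ) :
    Continuous fun w : ℕ → Vec dx => lagged H w t :=
  continuous_pi fun _ => continuous_apply _

@[fun_prop] theorem continuous_past (t : ℕ) : Continuous fun w : ℕ → Vec dx => past H w t := by
  refine continuous_pi fun i => ?_
  unfold past
  split_ifs <;> fun_prop

variable {t : ℕ} (ht : 2 * H + 1 ≤ t)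

include ht

theorem window_lagged (j : Fin (H + 1)) : window (lagged H w t) j = past H w (t - 1 - j) := by
  funext k
  rw [past_apply_of_le (by omega), window, lagged]
  congr 1
  simp only
  omega

theorem recent_lagged : recent (lagged H w t) = past H w t := by
  funext k
  rw [past_apply_of_le (by omega), recent, lagged]
  congr 1
  simp only [Fin.val_castLE]
  omega

theorem surrogateState_lagged (N : Policy H dx du) :
    surrogateState A B K N (lagged H w t) = ∑ j ∈ Finset.range (H + 1), app ((A - B * K) ^ j)
      (app B (Policy.act (past H w (t - 1 - j)) N) + w (t - 1 - j)) := by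
  simp only [surrogateState_eq, Finset.sum_range, window_lagged ht, lagged]

theorem state_sub_surrogateState_lagged (N : Policy H dx du) :
    state A B π w t - surrogateState A B K N (lagged H w t)
      = ∑ j ∈ Finset.range (H + 1), app ((A - B * K) ^ j)
          (app B (deviation A B K π N w (t - 1 - j)))
        + app ((A - B * K) ^ (H + 1)) (state A B π w (t - 1 - H)) := by
  have hunroll := state_add A B K π w (H + 1) (t - 1 - H)
  rw [show t - 1 - H + (H + 1) = t by omega] at hunroll
  rw [hunroll, surrogateState_lagged A B K ht, add_sub_right_comm, ← Finset.sum_sub_distrib]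
  simp only [← app_sub, add_sub_add_right_eq_sub, deviation]

theorem control_sub_surrogateAction_lagged (N : Policy H dx du) :
    control A B π w t - surrogateAction A B K N (lagged H w t)
      = - app K (state A B π w t - surrogateState A B K N (lagged H w t))
        + deviation A B K π N w t := by
  rw [surrogateAction_eq, recent_lagged ht, control_eq A B K, extraControl_eq A B K π w N, app_sub]
  abel

variable {A B K} {κ κB γ : ℝ}

theorem ExponentiallyStable.norm_state_sub_surrogateState_le (hK : ExponentiallyStable A B κ γ K)
    (hB : ‖B‖ ≤ κB) (hγ : 0 < γ) (hγ1 : γ < 1) (N : Policy H dx du) :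
    ‖state A B π w t - surrogateState A B K N (lagged H w t)‖
      ≤ κ ^ 2 * κB * ∑ j ∈ Finset.range (H + 1),
          (1 - γ) ^ j * ‖deviation A B K π N w (t - 1 - j)‖
        + κ ^ 2 * (1 - γ) ^ H * ‖state A B π w (t - 1 - H)‖ := by
  have hρ : 0 ≤ 1 - γ := by linarith
  rw [state_sub_surrogateState_lagged A B K π ht, Finset.mul_sum]
  refine (norm_add_le _ _).trans (add_le_add (norm_sum_le_of_le _ fun j _ => ?_) ?_)
  · exact (hK.norm_pow_app_app_le hγ1 hB j _).trans (le_of_eq (by ring))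
  · refine (norm_app_le _ _).trans ?_
    gcongr
    refine (hK.norm_pow_le _).trans ?_
    gcongr ?_ * ?_
    exact pow_le_pow_of_le_one hρ (by linarith) (by omega)

theorem ExponentiallyStable.surrogateGap_le (hK : ExponentiallyStable A B κ γ K)
    (hκ : 1 ≤ κ) (hB : ‖B‖ ≤ κB) (hγ : 0 < γ) (hγ1 : γ < 1) (N : Policy H dx du) :
    surrogateGap A B K π N w t ≤ 2 * κ ^ 3 * κB * ∑ j ∈ Finset.range (H + 1),
          (1 - γ) ^ j * ‖deviation A B K π N w (t - 1 - j)‖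
        + 2 * κ ^ 3 * (1 - γ) ^ H * ‖state A B π w (t - 1 - H)‖ + ‖deviation A B K π N w t‖ := by
  have hstate := hK.norm_state_sub_surrogateState_le π (w := w) ht hB hγ hγ1 N
  have hcontrol : ‖control A B π w t - surrogateAction A B K N (lagged H w t)‖
      ≤ κ * ‖state A B π w t - surrogateState A B K N (lagged H w t)‖
        + ‖deviation A B K π N w t‖ := by
    rw [control_sub_surrogateAction_lagged A B K π ht]
    refine (norm_add_le _ _).trans ?_
    rw [norm_neg]
    gcongr
    exact hK.norm_feedback_le _
  have hκδ := mul_le_mul_of_nonneg_right hκ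
    (norm_nonneg (state A B π w t - surrogateState A B K N (lagged H w t)))
  unfold surrogateGap
  linear_combination hcontrol + hκδ + 2 * κ * hstate

end Trajectory

/-! ### Disturbance-action and linear controllers -/

section Controllers

variable {H dx du : ℕ} {A : Mat dx dx} {B : Mat dx du} {Kst K : Mat du dx}

theorem policyController_apply (M : ℕ → Policy H dx du) (t : ℕ) (x : Vec dx) (w : ℕ → Vec dx) :
    policyController Kst M t x w = - app Kst x + Policy.act (past H w t) (M t) := by
  rw [policyController, Policy.act_apply]
  congr 1
  refine Finset.sum_congr rfl fun i _ => ?_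
  unfold past
  split_ifs <;> simp

theorem extraControl_policyController (M : ℕ → Policy H dx du) (w : ℕ → Vec dx) (t : ℕ) :
    extraControl A B Kst (policyController Kst M) w t = Policy.act (past H w t) (M t) := by
  rw [extraControl, control, policyController_apply]
  abel

theorem deviation_policyController (M : ℕ → Policy H dx du) (N : Policy H dx du)
    (w : ℕ → Vec dx) (t : ℕ) : deviation A B Kst (policyController Kst M) N w t
      = Policy.act (past H w t) (M t - N) := by
  rw [deviation, extraControl_policyController, map_sub]

theorem extraControl_linearController (w : ℕ → Vec dx) (t : ℕ) :
    extraControl A B Kst (linearController K) w t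
      = app (Kst - K) (state A B (linearController K) w t) := by
  rw [extraControl, control, linearController, sub_app]
  abel

theorem state_linearController_add (w : ℕ → Vec dx) (n t : ℕ) :
    state A B (linearController K) w (t + n)
      = ∑ j ∈ Finset.range n, app ((A - B * K) ^ j) (w (t + n - 1 - j))
        + app ((A - B * K) ^ n) (state A B (linearController K) w t) := by
  rw [state_add A B K]
  simp only [extraControl_linearController, sub_self, zero_app, app_zero, zero_add]

/-- The disturbance-action policy imitating the linear controller `K`: its blocks are the
coefficients of `(Kst - K) x_t`, expanded in the last `H` disturbances. -/
noncomputable def comparator (H : ℕ) (A : Mat dx dx) (B : Mat dx du) (Kst K : Mat du dx) :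
    Policy H dx du :=
  WithLp.toLp 2 fun p => ((Kst - K) * (A - B * K) ^ (p.1 : ℕ)) p.2.1 p.2.2

theorem comparator_block (i : Fin H) :
    (comparator H A B Kst K).block i = (Kst - K) * (A - B * K) ^ (i : ℕ) := rfl

theorem deviation_linearController_comparator (w : ℕ → Vec dx) {s : ℕ} (hs : H ≤ s) :
    deviation A B Kst (linearController K) (comparator H A B Kst K) w s
      = app (Kst - K) (app ((A - B * K) ^ H) (state A B (linearController K) w (s - H))) := by
  have hact : Policy.act (past H w s) (comparator H A B Kst K)
      = app (Kst - K) (∑ j ∈ Finset.range H, app ((A - B * K) ^ j) (w (s - 1 - j))) := by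
    rw [Policy.act_apply, app_sum, Finset.sum_range]
    refine Finset.sum_congr rfl fun j _ => ?_
    rw [comparator_block, mul_app, past_apply_of_le hs, Nat.sub_sub, add_comm 1]
  have hunroll := state_linearController_add (A := A) (B := B) (K := K) w H (s - H)
  rw [Nat.sub_add_cancel hs] at hunroll
  rw [deviation, extraControl_linearController, hact, hunroll, ← app_sub, add_sub_cancel_left]

variable {κ κB γ : ℝ}

theorem ExponentiallyStable.norm_sub_le (hKst : ExponentiallyStable A B κ γ Kst)
    (hK : ExponentiallyStable A B κ γ K) : ‖Kst - K‖ ≤ 2 * κ := by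
  rw [two_mul]
  exact (_root_.norm_sub_le _ _).trans (add_le_add hKst.norm_le hK.norm_le)

theorem ExponentiallyStable.comparator_mem_policySet (hKst : ExponentiallyStable A B κ γ Kst)
    (hK : ExponentiallyStable A B κ γ K) (hκ : 0 ≤ κ) (hγ1 : γ < 1) (h2 : 2 ≤ κB * (1 - γ)) :
    comparator H A B Kst K ∈ policySet H dx du κ κB γ := fun i => by
  have : 0 ≤ 1 - γ := by linarith
  rw [comparator_block]
  calc _ ≤ ‖Kst - K‖ * ‖(A - B * K) ^ (i : ℕ)‖ := Matrix.l2_opNorm_mul _ _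
    _ ≤ (2 * κ) * (κ ^ 2 * (1 - γ) ^ (i : ℕ)) := by
        gcongr
        exacts [hKst.norm_sub_le hK, hK.norm_pow_le _]
    _ = 2 * (κ ^ 3 * (1 - γ) ^ (i : ℕ)) := by ring
    _ ≤ (κB * (1 - γ)) * (κ ^ 3 * (1 - γ) ^ (i : ℕ)) := by gcongr
    _ = _ := by ring

theorem ExponentiallyStable.norm_deviation_comparator_le (hKst : ExponentiallyStable A B κ γ Kst)
    (hK : ExponentiallyStable A B κ γ K) (hκ : 0 ≤ κ) (hγ1 : γ < 1) {w : ℕ → Vec dx} {s : ℕ}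
    (hs : H ≤ s) {D : ℝ} (hD : ‖state A B (linearController K) w (s - H)‖ ≤ D) :
    ‖deviation A B Kst (linearController K) (comparator H A B Kst K) w s‖
      ≤ 2 * κ ^ 3 * (1 - γ) ^ H * D := by
  have : 0 ≤ 1 - γ := by linarith
  rw [deviation_linearController_comparator w hs]
  calc _ ≤ ‖Kst - K‖ * (‖(A - B * K) ^ H‖ * ‖state A B (linearController K) w (s - H)‖) :=
        (norm_app_le _ _).trans (by gcongr; exact norm_app_le _ _)
    _ ≤ (2 * κ) * ((κ ^ 2 * (1 - γ) ^ H) * D) := by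
        gcongr
        exacts [hKst.norm_sub_le hK, hK.norm_pow_le H]
    _ = _ := by ring

end Controllers

/-! ### Bounded controllers -/

section BoundedController

variable {H dx du : ℕ} {A : Mat dx dx} {B : Mat dx du} {Kst K : Mat du dx} {κ κB γ : ℝ}
  {ν : Measure (Vec dx)} {σ W D : ℝ} {π : Controller dx du} {t : ℕ}

/-- A continuous controller whose states and controls up to round `t` are bounded by `D` whenever
the disturbances are bounded by `W`. -/
structure IsBoundedController (A : Mat dx dx) (B : Mat dx du) (W D : ℝ) (π : Controller dx du)
    (t : ℕ) : Prop where
  continuous : ∀ s, Continuous fun p : Vec dx × (ℕ → Vec dx) => π s p.1 p.2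
  norm_le : ∀ w : ℕ → Vec dx, (∀ r, ‖w r‖ ≤ W) → ∀ s ≤ t,
    ‖state A B π w s‖ ≤ D ∧ ‖control A B π w s‖ ≤ D

theorem continuous_state (hπ : ∀ s, Continuous fun p : Vec dx × (ℕ → Vec dx) => π s p.1 p.2)
    (s : ℕ) : Continuous fun w => state A B π w s := by
  induction s with
  | zero => exact continuous_const
  | succ s ih =>
    have : Continuous fun w => π s (state A B π w s) w :=
      (hπ s).comp (ih.prodMk continuous_id)
    simp only [state]
    fun_prop

theorem continuous_control (hπ : ∀ s, Continuous fun p : Vec dx × (ℕ → Vec dx) => π s p.1 p.2)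
    (s : ℕ) : Continuous fun w => control A B π w s :=
  (hπ s).comp ((continuous_state hπ s).prodMk continuous_id)

theorem continuous_deviation (hπ : ∀ s, Continuous fun p : Vec dx × (ℕ → Vec dx) => π s p.1 p.2)
    (N : Policy H dx du) (s : ℕ) : Continuous fun w => deviation A B K π N w s := by
  have hstate := continuous_state (A := A) (B := B) hπ s
  have hcontrol := continuous_control (A := A) (B := B) hπ s
  simp only [deviation, extraControl]
  fun_prop

theorem continuous_surrogateGap
    (hπ : ∀ s, Continuous fun p : Vec dx × (ℕ → Vec dx) => π s p.1 p.2) (N : Policy H dx du)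
    (t : ℕ) : Continuous fun w => surrogateGap A B K π N w t := by
  have hstate := continuous_state (A := A) (B := B) hπ t
  have hcontrol := continuous_control (A := A) (B := B) hπ t
  have hy := (continuous_surrogateState A B K N).comp (continuous_lagged (dx := dx) t)
  have hv := (continuous_surrogateAction A B K N).comp (continuous_lagged (dx := dx) t)
  exact (hstate.sub hy).norm.add (hcontrol.sub hv).norm

theorem Setting.isBoundedController_policyController (h : Setting A B Kst κ κB γ ν σ W)
    {M : ℕ → Policy H dx du} (hM : ∀ s ≤ t, M s ∈ policySet H dx du κ κB γ) :
    IsBoundedController A B W (sizeBound κ κB γ W) (policyController Kst M) t where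
  continuous s := by
    simp only [policyController_apply]
    fun_prop
  norm_le w hw s hs := by
    have hκ := h.one_le_κ
    have hκB := h.one_le_κB
    have hact : ∀ r ≤ s, ‖extraControl A B Kst (policyController Kst M) w r‖
        ≤ κ ^ 3 * κB * γ⁻¹ * W := fun r hr => by
      rw [extraControl_policyController]
      exact Policy.norm_act_le (hM r (hr.trans hs)) (by linarith) (by linarith) h.γ_pos h.γ_lt_one
        h.noise.bound_nonneg (norm_past_le hw r)
    rw [control_eq A B Kst]
    exact h.stable.norm_le_sizeBound hκ hκB h.norm_B_le h.γ_pos h.γ_lt_one h.noise.bound_nonneg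
      (fun j => hact (s - 1 - j) (by omega)) (fun j => hw (s - 1 - j)) (hact s le_rfl)
      (state_eq_sum A B Kst _ w s)

theorem Setting.isBoundedController_linearController (h : Setting A B Kst κ κB γ ν σ W)
    (hK : ExponentiallyStable A B κ γ K) (t : ℕ) :
    IsBoundedController A B W (sizeBound κ κB γ W) (linearController K) t where
  continuous s := by
    simp only [linearController]
    fun_prop
  norm_le w hw s _ := by
    have hκ := h.one_le_κ
    have hκB := h.one_le_κB
    have hg := h.one_le_inv_γ
    have hW := h.noise.bound_nonneg
    have hextra : ∀ r, ‖extraControl A B K (linearController K) w r‖ ≤ κ ^ 3 * κB * γ⁻¹ * W :=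
      fun r => by
        rw [extraControl_linearController, sub_self, zero_app, norm_zero]
        positivity
    rw [control_eq A B K]
    exact hK.norm_le_sizeBound hκ hκB h.norm_B_le h.γ_pos h.γ_lt_one hW
      (fun j => hextra (s - 1 - j)) (fun j => hw (s - 1 - j)) (hextra s) (state_eq_sum A B K _ w s)

end BoundedController

/-! ### Expected costs -/

section ExpectedCost

variable {H dx du : ℕ} {Ω : Type*} [MeasurableSpace Ω] {P : Measure Ω}
  {w : ℕ → Ω → Vec dx} {A : Mat dx dx} {B : Mat dx du} {Kst : Mat du dx} {κ κB γ : ℝ}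
  {ν : Measure (Vec dx)} {σ W α G D : ℝ} {c : Vec dx → Vec du → ℝ} {π π' : Controller dx du}
  {N N' : Policy H dx du} {t : ℕ}

/-- The expected cost of round `t` under the controller `π`, the cost of that round being `c`. -/
noncomputable def roundCost (P : Measure Ω) (w : ℕ → Ω → Vec dx) (A : Mat dx dx) (B : Mat dx du)
    (c : Vec dx → Vec du → ℝ) (π : Controller dx du) (t : ℕ) : ℝ :=
  ∫ ω, c (state A B π (fun s => w s ω) t) (control A B π (fun s => w s ω) t) ∂P

theorem integral_sum_one_sub_pow_mul_le (hγ : 0 < γ) (hγ1 : γ < 1) {e : ℕ → Ω → ℝ} {ε : ℝ}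
    (hε : 0 ≤ ε) (n : ℕ) (he : ∀ j < n, Integrable (e j) P) (heε : ∀ j < n, ∫ ω, e j ω ∂P ≤ ε) :
    ∫ ω, ∑ j ∈ Finset.range n, (1 - γ) ^ j * e j ω ∂P ≤ γ⁻¹ * ε := by
  have : 0 ≤ 1 - γ := by linarith
  rw [integral_finsetSum _ fun j hj => (he j (Finset.mem_range.1 hj)).const_mul _]
  calc _ ≤ ∑ j ∈ Finset.range n, (1 - γ) ^ j * ε := Finset.sum_le_sum fun j hj => by
        rw [integral_const_mul]
        gcongr
        exact heε j (Finset.mem_range.1 hj)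
    _ = (∑ j ∈ Finset.range n, (1 - γ) ^ j) * ε := (Finset.sum_mul ..).symm
    _ ≤ γ⁻¹ * ε := by
        gcongr
        exact sum_range_one_sub_pow_le hγ hγ1 n

variable [IsProbabilityMeasure P]

theorem integral_sub_integral_le_of_ae_sub_le {f g : Ω → ℝ} (hf : Integrable f P)
    (hg : Integrable g P) {b : ℝ} (hfg : ∀ᵐ ω ∂P, f ω - g ω ≤ b) :
    ∫ ω, f ω ∂P - ∫ ω, g ω ∂P ≤ b := by
  rw [← integral_sub hf hg]
  calc _ ≤ ∫ _, b ∂P := integral_mono_ae (hf.sub hg) (integrable_const b) hfg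
    _ = b := by simp

theorem CostClass.sub_le_four_mul (hc : CostClass c α G) (hα : 0 ≤ α) {x x' : Vec dx}
    {u u' : Vec du} (hz : ‖x‖ ≤ D ∧ ‖u‖ ≤ D) (hz' : ‖x'‖ ≤ D ∧ ‖u'‖ ≤ D) :
    c x u - c x' u' ≤ 4 * (G * D ^ 2) := by
  have hG := hc.gradBound_nonneg
  have hD : 0 ≤ D := (norm_nonneg x).trans hz.1
  calc _ ≤ G * D * (‖x - x'‖ + ‖u - u'‖) := hc.sub_le hα hz.1 hz.2 x' u'
    _ ≤ G * D * ((D + D) + (D + D)) := by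
        gcongr
        exacts [norm_sub_le_of_le hz.1 hz'.1, norm_sub_le_of_le hz.2 hz'.2]
    _ = _ := by ring

theorem CostClass.abs_sub_le (hc : CostClass c α G) (hα : 0 ≤ α) {x x' : Vec dx}
    {u u' : Vec du} (hz : ‖x‖ ≤ D ∧ ‖u‖ ≤ D) (hz' : ‖x'‖ ≤ D ∧ ‖u'‖ ≤ D) :
    |c x u - c x' u'| ≤ G * D * (‖x - x'‖ + ‖u - u'‖) := by
  refine abs_sub_le_iff.2 ⟨hc.sub_le hα hz.1 hz.2 x' u', ?_⟩
  rw [norm_sub_rev x, norm_sub_rev u]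
  exact hc.sub_le hα hz'.1 hz'.2 x u

theorem NoiseLaw.integrable_cost (h : NoiseLaw ν σ W) (hw : IsIID w ν P) (hc : CostClass c α G)
    (hπ : ∀ s, Continuous fun p : Vec dx × (ℕ → Vec dx) => π s p.1 p.2) (t : ℕ) :
    Integrable (fun ω => c (state A B π (fun s => w s ω) t) (control A B π (fun s => w s ω) t))
      P :=
  h.integrable_comp hw (g := fun w => c (state A B π w t) (control A B π w t))
    (hc.continuous.comp ((continuous_state hπ t).prodMk (continuous_control hπ t)))

theorem NoiseLaw.totalCost_eq_sum_roundCost (h : NoiseLaw ν σ W) (hw : IsIID w ν P) {T : ℕ}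
    {c : ℕ → Vec dx → Vec du → ℝ} (hc : ∀ t < T, CostClass (c t) α G)
    (hπ : ∀ s, Continuous fun p : Vec dx × (ℕ → Vec dx) => π s p.1 p.2) :
    totalCost P w A B c T π = ∑ t ∈ Finset.range T, roundCost P w A B (c t) π t :=
  integral_finsetSum _ fun t ht => h.integrable_cost hw (hc t (Finset.mem_range.1 ht)) hπ t

theorem NoiseLaw.roundCost_sub_roundCost_le (h : NoiseLaw ν σ W) (hw : IsIID w ν P)
    (hc : CostClass c α G) (hα : 0 ≤ α) (hπ : IsBoundedController A B W D π t)
    (hπ' : IsBoundedController A B W D π' t) :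
    roundCost P w A B c π t - roundCost P w A B c π' t ≤ 4 * (G * D ^ 2) := by
  refine integral_sub_integral_le_of_ae_sub_le (h.integrable_cost hw hc hπ.continuous t)
    (h.integrable_cost hw hc hπ'.continuous t) ?_
  filter_upwards [h.ae_forall_norm_le hw] with ω hω
  exact hc.sub_le_four_mul hα (hπ.norm_le _ hω t le_rfl) (hπ'.norm_le _ hω t le_rfl)

theorem Setting.surrogateCost_sub_surrogateCost_le (h : Setting A B Kst κ κB γ ν σ W)
    (hc : CostClass c α G) (hα : 0 ≤ α) (hN : N ∈ policySet H dx du κ κB γ)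
    (hN' : N' ∈ policySet H dx du κ κB γ) :
    surrogateCost ν A B Kst c N - surrogateCost ν A B Kst c N'
      ≤ 4 * (G * sizeBound κ κB γ W ^ 2) := by
  have := h.noise.isProb
  refine integral_sub_integral_le_of_ae_sub_le (h.noise.integrable_pairCost hc N)
    (h.noise.integrable_pairCost hc N') ?_
  filter_upwards [h.noise.ae_pi_norm_le] with ξ hξ
  have hsize {N : Policy H dx du} (hN : N ∈ policySet H dx du κ κB γ) :=
    h.stable.surrogate_le_sizeBound h.one_le_κ h.one_le_κB h.norm_B_le h.γ_pos h.γ_lt_one hN hξ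
  exact hc.sub_le_four_mul hα (hsize hN) (hsize hN')

theorem IsIID.map_lagged (hw : IsIID w ν P) (ht : 2 * H + 1 ≤ t) :
    P.map (fun ω => lagged H (fun s => w s ω) t) = surrogateLaw H ν :=
  (hw.precomp (r := fun i : Fin (2 * H + 1) => t - 1 - (i : ℕ))
    fun i j hij => Fin.ext (by simp only at hij; omega)).map_pi_eq

theorem IsIID.surrogateCost_eq_integral_lagged (hw : IsIID w ν P) (hc : CostClass c α G)
    (ht : 2 * H + 1 ≤ t) (N : Policy H dx du) :
    surrogateCost ν A B Kst c N
      = ∫ ω, c (surrogateState A B Kst N (lagged H (fun s => w s ω) t))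
          (surrogateAction A B Kst N (lagged H (fun s => w s ω) t)) ∂P := by
  have hcont : Continuous fun ξ => c (surrogateState A B Kst N ξ) (surrogateAction A B Kst N ξ) :=
    hc.continuous.comp ((continuous_surrogateState A B Kst N).prodMk
      (continuous_surrogateAction A B Kst N))
  rw [surrogateCost, show (Measure.pi fun _ => ν) = _ from (hw.map_lagged ht).symm]
  exact integral_map (measurable_pi_iff.2 fun i => hw.measurable _).aemeasurable
    hcont.aestronglyMeasurable

theorem NoiseLaw.integrable_surrogateCost_lagged (h : NoiseLaw ν σ W) (hw : IsIID w ν P)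
    (hc : CostClass c α G) (N : Policy H dx du) (t : ℕ) :
    Integrable (fun ω => c (surrogateState A B Kst N (lagged H (fun s => w s ω) t))
      (surrogateAction A B Kst N (lagged H (fun s => w s ω) t))) P :=
  h.integrable_comp hw (g := fun w => c (surrogateState A B Kst N (lagged H w t))
    (surrogateAction A B Kst N (lagged H w t)))
    (hc.continuous.comp (by fun_prop : Continuous fun w => (surrogateState A B Kst N
      (lagged H w t), surrogateAction A B Kst N (lagged H w t))))

theorem NoiseLaw.integral_norm_act_past_le (h : NoiseLaw ν σ W) (hw : IsIID w ν P) (ht : H ≤ t)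
    (N : Policy H dx du) :
    ∫ ω, ‖Policy.act (past H (fun s => w s ω) t) N‖ ∂P ≤ √(N.energy ν) := by
  have hsq : ∫ ω, ‖Policy.act (past H (fun s => w s ω) t) N‖ ^ 2 ∂P = N.energy ν := by
    have hpast := hw.precomp (r := fun i : Fin H => t - ((i : ℕ) + 1))
      fun i j hij => Fin.ext (by simp only at hij; omega)
    simp only [Policy.act_apply, past_apply_of_le ht]
    exact h.integral_norm_sum_app_sq hpast N.block
  rw [← hsq]
  exact integral_norm_le_sqrt_integral_norm_sq
    (h.integrable_comp hw (g := fun w => ‖Policy.act (past H w t) N‖) (by fun_prop))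
    (h.integrable_comp hw (g := fun w => ‖Policy.act (past H w t) N‖ ^ 2) (by fun_prop))

section Coupling

variable (h : Setting A B Kst κ κB γ ν σ W) (hw : IsIID w ν P) (ht : 2 * H + 1 ≤ t) {ε : ℝ}
  (hε : ∀ s, t - 1 - H ≤ s → s ≤ t → ∫ ω, ‖deviation A B Kst π N (fun s => w s ω) s‖ ∂P ≤ ε)

include h hw ht hε

theorem Setting.integral_surrogateGap_le (hπ : IsBoundedController A B W D π t) :
    ∫ ω, surrogateGap A B Kst π N (fun s => w s ω) t ∂P
      ≤ 3 * κ ^ 3 * κB * γ⁻¹ * ε + 2 * κ ^ 3 * (1 - γ) ^ H * D := by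
  have hκ := h.one_le_κ
  have hκB := h.one_le_κB
  have hρ : 0 ≤ 1 - γ := by linarith [h.γ_lt_one]
  have hint : ∀ s, Integrable (fun ω => ‖deviation A B Kst π N (fun s => w s ω) s‖) P := fun s =>
    h.noise.integrable_comp hw (g := fun w => ‖deviation A B Kst π N w s‖)
      (continuous_deviation hπ.continuous N s).norm
  have hε0 : 0 ≤ ε := (integral_nonneg fun _ => norm_nonneg _).trans (hε t (by omega) le_rfl)
  have hsum : Integrable (fun ω => ∑ j ∈ Finset.range (H + 1),
      (1 - γ) ^ j * ‖deviation A B Kst π N (fun s => w s ω) (t - 1 - j)‖) P :=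
    integrable_finsetSum _ fun j _ => (hint _).const_mul _
  have hsum' : Integrable (fun ω => 2 * κ ^ 3 * κB * ∑ j ∈ Finset.range (H + 1),
      (1 - γ) ^ j * ‖deviation A B Kst π N (fun s => w s ω) (t - 1 - j)‖
        + 2 * κ ^ 3 * (1 - γ) ^ H * D) P := (hsum.const_mul _).add (integrable_const _)
  have hgeom := integral_sum_one_sub_pow_mul_le h.γ_pos h.γ_lt_one hε0 (H + 1)
    (fun j _ => hint (t - 1 - j)) (fun j hj => hε _ (by omega) (by omega))
  calc _ ≤ ∫ ω, (2 * κ ^ 3 * κB * ∑ j ∈ Finset.range (H + 1),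
          (1 - γ) ^ j * ‖deviation A B Kst π N (fun s => w s ω) (t - 1 - j)‖
          + 2 * κ ^ 3 * (1 - γ) ^ H * D + ‖deviation A B Kst π N (fun s => w s ω) t‖) ∂P := by
        refine integral_mono_ae (h.noise.integrable_comp hw
          (continuous_surrogateGap hπ.continuous N t))
          (hsum'.add (hint t)) ?_
        filter_upwards [h.noise.ae_forall_norm_le hw] with ω hω
        refine (h.stable.surrogateGap_le π ht hκ h.norm_B_le h.γ_pos h.γ_lt_one N).trans ?_
        gcongr
        exact (hπ.norm_le _ hω (t - 1 - H) (by omega)).1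
    _ ≤ 2 * κ ^ 3 * κB * (γ⁻¹ * ε) + 2 * κ ^ 3 * (1 - γ) ^ H * D + 1 * ε := by
        rw [integral_add hsum' (hint t), integral_add (hsum.const_mul _) (integrable_const _),
          integral_const_mul, integral_const, probReal_univ, one_smul, one_mul]
        gcongr
        exact hε t (by omega) le_rfl
    _ ≤ 2 * κ ^ 3 * κB * (γ⁻¹ * ε) + 2 * κ ^ 3 * (1 - γ) ^ H * D + κ ^ 3 * κB * γ⁻¹ * ε := by
        gcongr
        exact one_le_mul_of_one_le_of_one_le
          (one_le_mul_of_one_le_of_one_le (one_le_pow₀ hκ) hκB) h.one_le_inv_γ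
    _ = _ := by ring

theorem Setting.abs_roundCost_sub_surrogateCost_le (hc : CostClass c α G) (hα : 0 ≤ α)
    (hN : N ∈ policySet H dx du κ κB γ)
    (hπ : IsBoundedController A B W (sizeBound κ κB γ W) π t) :
    |roundCost P w A B c π t - surrogateCost ν A B Kst c N|
      ≤ G * sizeBound κ κB γ W *
        (3 * κ ^ 3 * κB * γ⁻¹ * ε + 2 * κ ^ 3 * (1 - γ) ^ H * sizeBound κ κB γ W) := by
  have hG := hc.gradBound_nonneg
  have hD := h.sizeBound_nonneg
  have hgap : Integrable (fun ω => surrogateGap A B Kst π N (fun s => w s ω) t) P :=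
    h.noise.integrable_comp hw (continuous_surrogateGap hπ.continuous N t)
  rw [roundCost, hw.surrogateCost_eq_integral_lagged hc ht N, ← integral_sub
    (h.noise.integrable_cost hw hc hπ.continuous t)
    (h.noise.integrable_surrogateCost_lagged hw hc N t), ← Real.norm_eq_abs]
  calc _ ≤ ∫ ω, G * sizeBound κ κB γ W * surrogateGap A B Kst π N (fun s => w s ω) t ∂P := by
        refine norm_integral_le_of_norm_le (hgap.const_mul (G * sizeBound κ κB γ W)) ?_
        filter_upwards [h.noise.ae_forall_norm_le hw] with ω hω
        have hξ : ‖lagged H (fun s => w s ω) t‖ ≤ W :=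
          (pi_norm_le_iff_of_nonneg h.noise.bound_nonneg).2 fun i => hω _
        exact hc.abs_sub_le hα (hπ.norm_le _ hω t le_rfl) (h.stable.surrogate_le_sizeBound
          h.one_le_κ h.one_le_κB h.norm_B_le h.γ_pos h.γ_lt_one hN hξ)
    _ = G * sizeBound κ κB γ W * ∫ ω, surrogateGap A B Kst π N (fun s => w s ω) t ∂P :=
        integral_const_mul _ _
    _ ≤ _ := by
        gcongr
        exact h.integral_surrogateGap_le hw ht hε hπ

end Coupling

end ExpectedCost

/-! ### Late rounds -/

section LateRounds

variable {H dx du : ℕ} {Ω : Type*} [MeasurableSpace Ω] {P : Measure Ω} [IsProbabilityMeasure P]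
  {w : ℕ → Ω → Vec dx} {A : Mat dx dx} {B : Mat dx du} {Kst K : Mat du dx} {κ κB γ : ℝ}
  {ν : Measure (Vec dx)} {σ W α G a : ℝ} {c : ℕ → Vec dx → Vec du → ℝ} {T : ℕ} {η : ℕ → ℝ}
  {M : ℕ → Policy H dx du} {s t r : ℕ}

namespace Setting

theorem pow_three_le (h : Setting A B Kst κ κB γ ν σ W) : κ ^ 3 ≤ κ ^ 6 * κB * γ⁻¹ := by
  have hκ := h.one_le_κ
  have hκB := h.one_le_κB
  have hg := h.one_le_inv_γ
  calc κ ^ 3 = κ ^ 3 * 1 * 1 := by ring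
    _ ≤ κ ^ 6 * κB * γ⁻¹ := by gcongr; norm_num

theorem integral_norm_deviation_comparator_le (h : Setting A B Kst κ κB γ ν σ W)
    (hw : IsIID w ν P) (hK : ExponentiallyStable A B κ γ K) (hs : H ≤ s) :
    ∫ ω, ‖deviation A B Kst (linearController K) (comparator H A B Kst K) (fun s => w s ω) s‖ ∂P
      ≤ 2 * κ ^ 3 * (1 - γ) ^ H * sizeBound κ κB γ W := by
  have hκ := h.one_le_κ
  have hbounded := h.isBoundedController_linearController hK s
  calc _ ≤ ∫ _, 2 * κ ^ 3 * (1 - γ) ^ H * sizeBound κ κB γ W ∂P := by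
        refine integral_mono_ae (h.noise.integrable_comp hw
          (continuous_deviation hbounded.continuous _ s)).norm (integrable_const _) ?_
        filter_upwards [h.noise.ae_forall_norm_le hw] with ω hω
        exact h.stable.norm_deviation_comparator_le hK (by linarith) h.γ_lt_one hs
          (hbounded.norm_le _ hω (s - H) (by omega)).1
    _ = _ := by simp

theorem surrogateCost_comparator_sub_roundCost_le (h : Setting A B Kst κ κB γ ν σ W)
    (hw : IsIID w ν P) (hc : CostClass (c t) α G) (hα : 0 ≤ α)
    (hK : ExponentiallyStable A B κ γ K) (ht : 2 * H + 1 ≤ t) :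
    surrogateCost ν A B Kst (c t) (comparator H A B Kst K)
        - roundCost P w A B (c t) (linearController K) t
      ≤ 8 * (κ ^ 6 * κB * γ⁻¹) * (1 - γ) ^ H * (G * sizeBound κ κB γ W ^ 2) := by
  have hκ := h.one_le_κ
  have hρ : 0 ≤ 1 - γ := by linarith [h.γ_lt_one]
  have hG := hc.gradBound_nonneg
  set D := sizeBound κ κB γ W
  have hmem := h.stable.comparator_mem_policySet (H := H) hK (by linarith) h.γ_lt_one h.two_le
  have hclose := (abs_sub_le_iff.1 (h.abs_roundCost_sub_surrogateCost_le hw ht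
    (fun s hs _ => h.integral_norm_deviation_comparator_le hw hK (by omega)) hc hα hmem
    (h.isBoundedController_linearController hK t))).2
  calc _ ≤ _ := hclose
    _ = (6 * (κ ^ 6 * κB * γ⁻¹) + 2 * κ ^ 3) * (1 - γ) ^ H * (G * D ^ 2) := by ring
    _ ≤ (6 * (κ ^ 6 * κB * γ⁻¹) + 2 * (κ ^ 6 * κB * γ⁻¹)) * (1 - γ) ^ H * (G * D ^ 2) := by
        gcongr
        exact h.pow_three_le
    _ = _ := by ring

theorem integral_norm_act_step_le (h : Setting A B Kst κ κB γ ν σ W) (hw : IsIID w ν P)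
    (hc : ∀ t < T, CostClass (c t) α G) (hη : ∀ t, 0 ≤ η t)
    (hrun : IsNaturalGradientRun ν A B Kst c κ κB γ T η M) (hr : r < T) (hs : H ≤ s) :
    ∫ ω, ‖Policy.act (past H (fun s => w s ω) s) (M (r + 1) - M r)‖ ∂P
      ≤ 2 * κ * (η r * (3 * κ ^ 3 * κB * γ⁻¹ * W * muInv H ν A B Kst c κ κB γ T)) := by
  have hκ := h.one_le_κ
  calc _ ≤ √((M (r + 1) - M r).energy ν) := h.noise.integral_norm_act_past_le hw hs _
    _ ≤ 2 * κ * √(weightedSq (gram H ν A B Kst) (M (r + 1) - M r)) := h.sqrt_energy_le _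
    _ ≤ _ := by gcongr; exact h.sqrt_step_le hc hη hrun hr

theorem integral_norm_deviation_policyController_le_sum (h : Setting A B Kst κ κB γ ν σ W)
    (hw : IsIID w ν P) (M : ℕ → Policy H dx du) (hst : s ≤ t) :
    ∫ ω, ‖deviation A B Kst (policyController Kst M) (M t) (fun s => w s ω) s‖ ∂P
      ≤ ∑ r ∈ Finset.Ico s t,
          ∫ ω, ‖Policy.act (past H (fun s => w s ω) s) (M (r + 1) - M r)‖ ∂P := by
  have hint (r : ℕ) :
      Integrable (fun ω => ‖Policy.act (past H (fun s => w s ω) s) (M (r + 1) - M r)‖) P :=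
    h.noise.integrable_comp hw (g := fun w => ‖Policy.act (past H w s) (M (r + 1) - M r)‖)
      (by fun_prop)
  rw [← integral_finsetSum _ fun r _ => hint r]
  refine integral_mono_of_nonneg (Filter.Eventually.of_forall fun _ => norm_nonneg _)
    (integrable_finsetSum _ fun r _ => hint r) (Filter.Eventually.of_forall fun ω => ?_)
  simp only
  rw [deviation_policyController, ← neg_sub, map_neg, norm_neg, ← Finset.sum_Ico_sub M hst,
    map_sum]
  exact norm_sum_le _ _

theorem integral_norm_deviation_policyController_le (h : Setting A B Kst κ κB γ ν σ W)
    (hw : IsIID w ν P) (hc : ∀ t < T, CostClass (c t) α G) (hα : 0 < α) (ha : 0 ≤ a)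
    (hrun : IsNaturalGradientRun ν A B Kst c κ κB γ T (fun t => a / (α * ((t : ℝ) + 1))) M)
    (ht : 2 * H + 1 ≤ t) (htT : t < T) (hs : t - 1 - H ≤ s) (hst : s ≤ t) :
    ∫ ω, ‖deviation A B Kst (policyController Kst M) (M t) (fun s => w s ω) s‖ ∂P
      ≤ (H + 1) * (4 * κ * (a / α)
          * (3 * κ ^ 3 * κB * γ⁻¹ * W * muInv H ν A B Kst c κ κB γ T) * ((t : ℝ) + 1)⁻¹) := by
  have hκ := h.one_le_κ
  have hκB := h.one_le_κB
  have hg := h.one_le_inv_γ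
  have hW := h.noise.bound_nonneg
  have hmu := muInv_nonneg (H := H) (ν := ν) (A := A) (B := B) (Kst := Kst) (cs := c) (κ := κ)
    (κB := κB) (γ := γ) (T := T)
  set Λ := 3 * κ ^ 3 * κB * γ⁻¹ * W * muInv H ν A B Kst c κ κB γ T
  have hstep : ∀ r ∈ Finset.Ico s t,
      ∫ ω, ‖Policy.act (past H (fun s => w s ω) s) (M (r + 1) - M r)‖ ∂P
        ≤ 4 * κ * (a / α) * Λ * ((t : ℝ) + 1)⁻¹ := fun r hr => by
    obtain ⟨hsr, hrt⟩ := Finset.mem_Ico.1 hr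
    have hinv : ((r : ℝ) + 1)⁻¹ ≤ 2 * ((t : ℝ) + 1)⁻¹ := by
      have hrt' : ((t + 1 : ℕ) : ℝ) ≤ ((r + 1) * 2 : ℕ) := by exact_mod_cast (by omega)
      push_cast at hrt'
      rw [← div_eq_mul_inv, inv_le_comm₀ (by positivity) (by positivity), inv_div]
      linarith
    calc _ ≤ 2 * κ * (a / (α * ((r : ℝ) + 1)) * Λ) :=
          h.integral_norm_act_step_le hw hc (fun t => by positivity) hrun (by omega) (by omega)
      _ = 2 * κ * (a / α) * Λ * ((r : ℝ) + 1)⁻¹ := by rw [div_mul_eq_div_div]; ring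
      _ ≤ 2 * κ * (a / α) * Λ * (2 * ((t : ℝ) + 1)⁻¹) := by gcongr
      _ = _ := by ring
  have hcard : ((t - s : ℕ) : ℝ) ≤ H + 1 := by exact_mod_cast (by omega : t - s ≤ H + 1)
  calc _ ≤ _ := h.integral_norm_deviation_policyController_le_sum hw M hst
    _ ≤ ∑ r ∈ Finset.Ico s t, 4 * κ * (a / α) * Λ * ((t : ℝ) + 1)⁻¹ := Finset.sum_le_sum hstep
    _ = (t - s : ℕ) * (4 * κ * (a / α) * Λ * ((t : ℝ) + 1)⁻¹) := by simp
    _ ≤ _ := by gcongr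

theorem roundCost_policyController_sub_surrogateCost_le (h : Setting A B Kst κ κB γ ν σ W)
    (hw : IsIID w ν P) (hc : ∀ t < T, CostClass (c t) α G) (hα : 0 < α) (ha : 0 ≤ a)
    (hrun : IsNaturalGradientRun ν A B Kst c κ κB γ T (fun t => a / (α * ((t : ℝ) + 1))) M)
    (ht : 2 * H + 1 ≤ t) (htT : t < T) :
    roundCost P w A B (c t) (policyController Kst M) t - surrogateCost ν A B Kst (c t) (M t)
      ≤ 144 * κ ^ 13 * κB ^ 4 * γ⁻¹ ^ 4 * (H + 1)
            * (a * (G * W ^ 2 / α * muInv H ν A B Kst c κ κB γ T)) * ((t : ℝ) + 1)⁻¹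
        + 2 * (κ ^ 6 * κB * γ⁻¹) * (1 - γ) ^ H * (G * sizeBound κ κB γ W ^ 2) := by
  have hρ : 0 ≤ 1 - γ := by linarith [h.γ_lt_one]
  have hG := (hc t htT).gradBound_nonneg
  have hM : ∀ s ≤ t, M s ∈ policySet H dx du κ κB γ := fun s hs => hrun.mem (by omega)
  have hclose := (abs_sub_le_iff.1 (h.abs_roundCost_sub_surrogateCost_le hw ht
    (fun s => h.integral_norm_deviation_policyController_le hw hc hα ha hrun ht htT) (hc t htT)
    hα.le (hM t le_rfl) (h.isBoundedController_policyController hM))).1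
  set E := 144 * κ ^ 13 * κB ^ 4 * γ⁻¹ ^ 4 * (H + 1)
    * (a * (G * W ^ 2 / α * muInv H ν A B Kst c κ κB γ T)) * ((t : ℝ) + 1)⁻¹
  calc _ ≤ _ := hclose
    _ = E + 2 * κ ^ 3 * (1 - γ) ^ H * (G * sizeBound κ κB γ W ^ 2) := by
        simp only [E, sizeBound]
        ring
    _ ≤ _ := by
        gcongr
        exact h.pow_three_le

end Setting

end LateRounds

/-! ### The regret of the learner -/

section Regret

variable {H dx du : ℕ} {Ω : Type*} [MeasurableSpace Ω] {P : Measure Ω} [IsProbabilityMeasure P]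
  {w : ℕ → Ω → Vec dx} {A : Mat dx dx} {B : Mat dx du} {Kst K : Mat du dx} {κ κB γ : ℝ}
  {ν : Measure (Vec dx)} {σ W α G a : ℝ} {c : ℕ → Vec dx → Vec du → ℝ} {T : ℕ}
  {M : ℕ → Policy H dx du}

namespace Setting

-- The first `2 H + 1` rounds, in which the disturbances feeding the surrogate are not all
-- available yet, are estimated trivially.
theorem roundCost_policyController_sub_linearController_le (h : Setting A B Kst κ κB γ ν σ W)
    (hw : IsIID w ν P) (hc : ∀ t < T, CostClass (c t) α G) (hα : 0 < α) (ha : 0 ≤ a)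
    (hH : (1 - γ) ^ H ≤ (T : ℝ)⁻¹)
    (hrun : IsNaturalGradientRun ν A B Kst c κ κB γ T (fun t => a / (α * ((t : ℝ) + 1))) M)
    (hK : ExponentiallyStable A B κ γ K) {t : ℕ} (htT : t < T) :
    roundCost P w A B (c t) (policyController Kst M) t
        - roundCost P w A B (c t) (linearController K) t
      ≤ (surrogateCost ν A B Kst (c t) (M t)
          - surrogateCost ν A B Kst (c t) (comparator H A B Kst K))
        + (if t < 2 * H + 1 then 8 * (G * sizeBound κ κB γ W ^ 2) else 0)
        + 144 * κ ^ 13 * κB ^ 4 * γ⁻¹ ^ 4 * (H + 1)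
            * (a * (G * W ^ 2 / α * muInv H ν A B Kst c κ κB γ T)) * ((t : ℝ) + 1)⁻¹
        + 10 * (κ ^ 6 * κB * γ⁻¹) * (G * sizeBound κ κB γ W ^ 2) * (T : ℝ)⁻¹ := by
  have hκ := h.one_le_κ
  have hκB := h.one_le_κB
  have hg := h.one_le_inv_γ
  have hG := (hc t htT).gradBound_nonneg
  have hmu := muInv_nonneg (H := H) (ν := ν) (A := A) (B := B) (Kst := Kst) (cs := c) (κ := κ)
    (κB := κB) (γ := γ) (T := T)
  have hM : ∀ s ≤ t, M s ∈ policySet H dx du κ κB γ := fun s hs => hrun.mem (by omega)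
  set Q := G * sizeBound κ κB γ W ^ 2
  set E := 144 * κ ^ 13 * κB ^ 4 * γ⁻¹ ^ 4 * (H + 1)
    * (a * (G * W ^ 2 / α * muInv H ν A B Kst c κ κB γ T)) * ((t : ℝ) + 1)⁻¹
  have hE : 0 ≤ E := by positivity
  have hQ : 0 ≤ 10 * (κ ^ 6 * κB * γ⁻¹) * Q * (T : ℝ)⁻¹ := by positivity
  split_ifs with hearly
  · have hround := h.noise.roundCost_sub_roundCost_le hw (hc t htT) hα.le
      (h.isBoundedController_policyController hM) (h.isBoundedController_linearController hK t)
    have hsurrogate := h.surrogateCost_sub_surrogateCost_le (hc t htT) hα.le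
      (h.stable.comparator_mem_policySet hK (by linarith) h.γ_lt_one h.two_le) (hM t le_rfl)
    linarith
  · have hlearner := h.roundCost_policyController_sub_surrogateCost_le hw hc hα ha hrun
      (not_lt.1 hearly) htT
    have hlinear := h.surrogateCost_comparator_sub_roundCost_le hw (hc t htT) hα.le hK
      (not_lt.1 hearly)
    have htrunc : 10 * (κ ^ 6 * κB * γ⁻¹) * Q * (1 - γ) ^ H
        ≤ 10 * (κ ^ 6 * κB * γ⁻¹) * Q * (T : ℝ)⁻¹ := by gcongr
    linarith

theorem totalCost_sub_totalCost_le (h : Setting A B Kst κ κB γ ν σ W)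
    (hw : IsIID w ν P) (hc : ∀ t < T, CostClass (c t) α G) (hα : 0 < α) (ha : 1 ≤ a)
    (hT : 0 < T) (hH : (1 - γ) ^ H ≤ (T : ℝ)⁻¹)
    (hrun : IsNaturalGradientRun ν A B Kst c κ κB γ T (fun t => a / (α * ((t : ℝ) + 1))) M)
    (hK : ExponentiallyStable A B κ γ K) :
    totalCost P w A B c T (policyController Kst M) - totalCost P w A B c T (linearController K)
      ≤ 12 * κ ^ 9 * κB ^ 3 * γ⁻¹ ^ 3
            * (a * (G * W ^ 2 / α * muInv H ν A B Kst c κ κB γ T)) * (1 + Real.log T)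
        + (2 * H + 1) * (8 * (G * sizeBound κ κB γ W ^ 2))
        + 144 * κ ^ 13 * κB ^ 4 * γ⁻¹ ^ 4 * (H + 1)
            * (a * (G * W ^ 2 / α * muInv H ν A B Kst c κ κB γ T)) * (1 + Real.log T)
        + 10 * (κ ^ 6 * κB * γ⁻¹) * (G * sizeBound κ κB γ W ^ 2) := by
  have hκ := h.one_le_κ
  have hκB := h.one_le_κB
  have hg := h.one_le_inv_γ
  have hG := (hc 0 hT).gradBound_nonneg
  have hmu := muInv_nonneg (H := H) (ν := ν) (A := A) (B := B) (Kst := Kst) (cs := c) (κ := κ)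
    (κB := κB) (γ := γ) (T := T)
  have hregret := h.regret_le hc hT hα ha hrun
    (h.stable.comparator_mem_policySet hK (by linarith) h.γ_lt_one h.two_le)
  have hrounds := Finset.sum_le_sum fun t ht =>
    h.roundCost_policyController_sub_linearController_le hw hc hα (by linarith) hH hrun hK
      (Finset.mem_range.1 ht)
  rw [h.noise.totalCost_eq_sum_roundCost hw hc
      (h.isBoundedController_policyController fun s hs => hrun.mem hs).continuous,
    h.noise.totalCost_eq_sum_roundCost hw hc
      (h.isBoundedController_linearController hK T).continuous, ← Finset.sum_sub_distrib]
  refine hrounds.trans ?_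
  rw [Finset.sum_add_distrib, Finset.sum_add_distrib, Finset.sum_add_distrib, ← Finset.mul_sum,
    ← Finset.sum_filter, Finset.sum_const, Finset.sum_const, Finset.card_range, nsmul_eq_mul,
    nsmul_eq_mul]
  have hearly : (((Finset.range T).filter (· < 2 * H + 1)).card : ℝ) ≤ 2 * H + 1 := by
    have hsub : (Finset.range T).filter (· < 2 * H + 1) ⊆ Finset.range (2 * H + 1) :=
      fun t ht => Finset.mem_range.2 (Finset.mem_filter.1 ht).2
    exact_mod_cast (Finset.card_le_card hsub).trans_eq (Finset.card_range _)
  gcongr ?_ + ?_ * _ + _ * ?_ + ?_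
  · refine hregret.trans_eq ?_
    rw [sizeBound]
    ring
  · exact sum_range_inv_succ_le T
  · exact le_of_eq (by field_simp)

end Setting

end Regret

/-! ### The memory length -/

section Memory

variable {κ γ : ℝ} {T : ℕ}

theorem half_le_log (hT : 2 ≤ T) : 1 / 2 ≤ Real.log T := by
  have hlog : Real.log 2 ≤ Real.log T := Real.log_le_log (by norm_num) (by exact_mod_cast hT)
  linarith [Real.log_two_gt_d9]

theorem memory_pos (hκ : 1 ≤ κ) (hγ : 0 < γ) (hT : 2 ≤ T) : 0 < memory κ γ T := by
  have hT' : (2 : ℝ) ≤ T := by exact_mod_cast hT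
  have hκ2 : 1 ≤ κ ^ 2 := one_le_pow₀ hκ
  exact Nat.ceil_pos.2 (mul_pos (inv_pos.2 hγ) (Real.log_pos (by nlinarith)))

theorem memory_add_one_le (hκ : 1 ≤ κ) (hγ : 0 < γ) (hγ1 : γ < 1) (hT : 2 ≤ T) :
    (memory κ γ T : ℝ) + 1 ≤ 5 * γ⁻¹ * κ * Real.log T := by
  have hL := half_le_log hT
  have hg : 1 ≤ γ⁻¹ := (one_le_inv₀ hγ).2 hγ1.le
  have hlogκ0 := Real.log_nonneg hκ
  have hlogκ : Real.log κ ≤ κ - 1 := Real.log_le_sub_one_of_pos (by linarith)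
  have hlog : Real.log (T * κ ^ 2) = Real.log T + 2 * Real.log κ := by
    rw [Real.log_mul (by positivity) (by positivity), Real.log_pow]
    norm_num
  have hceil : (memory κ γ T : ℝ) < γ⁻¹ * Real.log (T * κ ^ 2) + 1 :=
    Nat.ceil_lt_add_one (by rw [hlog]; positivity)
  calc (memory κ γ T : ℝ) + 1 ≤ γ⁻¹ * Real.log (T * κ ^ 2) + γ⁻¹ * 2 := by linarith
    _ = γ⁻¹ * (Real.log T + 2 * Real.log κ + 2) := by rw [hlog]; ring
    _ ≤ γ⁻¹ * (5 * κ * Real.log T) := by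
        gcongr
        nlinarith
    _ = _ := by ring

theorem one_sub_pow_memory_le (hκ : 1 ≤ κ) (hγ : 0 < γ) (hγ1 : γ < 1) (hT : 0 < T) :
    (1 - γ) ^ memory κ γ T ≤ (T : ℝ)⁻¹ := by
  have hT0 : (0 : ℝ) < T := by exact_mod_cast hT
  have hlog : Real.log T ≤ γ * memory κ γ T :=
    calc Real.log T ≤ Real.log (T * κ ^ 2) :=
          Real.log_le_log hT0 (le_mul_of_one_le_right hT0.le (one_le_pow₀ hκ))
      _ = γ * (γ⁻¹ * Real.log (T * κ ^ 2)) := (mul_inv_cancel_left₀ hγ.ne' _).symm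
      _ ≤ γ * memory κ γ T := by gcongr; exact Nat.le_ceil _
  calc (1 - γ) ^ memory κ γ T ≤ Real.exp (-γ) ^ memory κ γ T := by
        gcongr
        exact Real.one_sub_le_exp_neg γ
    _ = Real.exp (-(γ * memory κ γ T)) := by rw [← Real.exp_nat_mul]; congr 1; ring
    _ ≤ Real.exp (-Real.log T) := Real.exp_le_exp.2 (neg_le_neg hlog)
    _ = (T : ℝ)⁻¹ := by rw [Real.exp_neg, Real.exp_log hT0]

end Memory

/-! ### Collecting the error terms -/

section Collect

variable {g κB κ d L Y m Q : ℝ}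

theorem monomial_le (hg : 1 ≤ g) (hκB : 1 ≤ κB) (hκ : 1 ≤ κ) {i j k : ℕ} (hi : i ≤ 22)
    (hj : j ≤ 6) (hk : k ≤ 6) : κ ^ i * κB ^ j * g ^ k ≤ g ^ 6 * κB ^ 6 * κ ^ 22 :=
  calc κ ^ i * κB ^ j * g ^ k ≤ κ ^ 22 * κB ^ 6 * g ^ 6 := by gcongr
    _ = _ := by ring

theorem quadratic_le_mul_pow (hL : 1 / 2 ≤ L) {b₀ b₁ b₂ : ℝ} (h₀ : 0 ≤ b₀) (h₁ : 0 ≤ b₁)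
    (h₂ : 0 ≤ b₂) {n : ℕ} (hn : 2 ≤ n) :
    b₀ + b₁ * L + b₂ * L ^ 2 ≤ (b₀ + b₁ + b₂) * 2 ^ n * L ^ n := by
  have hpow : ∀ k ≤ 2, L ^ k ≤ (2 * L) ^ n := fun k hk =>
    calc L ^ k ≤ (2 * L) ^ k := by gcongr; linarith
      _ ≤ (2 * L) ^ n := pow_le_pow_right₀ (by linarith) (hk.trans hn)
  calc b₀ + b₁ * L + b₂ * L ^ 2 = b₀ * L ^ 0 + b₁ * L ^ 1 + b₂ * L ^ 2 := by ring
    _ ≤ b₀ * (2 * L) ^ n + b₁ * (2 * L) ^ n + b₂ * (2 * L) ^ n := by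
        gcongr <;> exact hpow _ (by norm_num)
    _ = _ := by rw [mul_pow]; ring

theorem error_terms_le (hg : 1 ≤ g) (hκB : 1 ≤ κB) (hκ : 1 ≤ κ) (hd : 1 ≤ d) (hL : 1 / 2 ≤ L)
    (hY : 0 ≤ Y) (hm0 : 0 ≤ m) (hm : m + 1 ≤ 5 * g * κ * L)
    (hQ : Q ≤ 192 * (κ ^ 16 * κB ^ 5 * g ^ 5) * d * Y) {n : ℕ} (hn : 2 ≤ n) :
    12 * κ ^ 9 * κB ^ 3 * g ^ 3 * Y * (1 + L) + (2 * m + 1) * (8 * Q)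
        + 144 * κ ^ 13 * κB ^ 4 * g ^ 4 * (m + 1) * Y * (1 + L) + 10 * (κ ^ 6 * κB * g) * Q
      ≤ 18744 * 2 ^ n * (g ^ 6 * κB ^ 6 * κ ^ 22 * d) * Y * L ^ n := by
  have : 0 ≤ L := by linarith
  set Z := g ^ 6 * κB ^ 6 * κ ^ 22
  have hZd : Z ≤ Z * d := le_mul_of_one_le_right (by positivity) hd
  have hregret : 12 * κ ^ 9 * κB ^ 3 * g ^ 3 * Y * (1 + L) ≤ 12 * (Z * d * Y) * (1 + L) :=
    calc _ = 12 * ((κ ^ 9 * κB ^ 3 * g ^ 3) * Y) * (1 + L) := by ring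
      _ ≤ _ := by
        gcongr 12 * (?_ * Y) * (1 + L)
        refine (monomial_le hg hκB hκ ?_ ?_ ?_).trans hZd <;> norm_num
  have hearly : (2 * m + 1) * (8 * Q) ≤ 15360 * (Z * d * Y) * L :=
    calc _ ≤ (2 * (5 * g * κ * L)) * (8 * (192 * (κ ^ 16 * κB ^ 5 * g ^ 5) * d * Y)) :=
          mul_le_mul_of_nonneg (by linarith) (by linarith) (by positivity) (by positivity)
      _ = 15360 * ((κ ^ 17 * κB ^ 5 * g ^ 6) * d * Y) * L := by ring
      _ ≤ _ := by
        gcongr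
        apply monomial_le hg hκB hκ <;> norm_num
  have hlate : 144 * κ ^ 13 * κB ^ 4 * g ^ 4 * (m + 1) * Y * (1 + L)
      ≤ 720 * (Z * d * Y) * L * (1 + L) :=
    calc _ ≤ 144 * κ ^ 13 * κB ^ 4 * g ^ 4 * (5 * g * κ * L) * Y * (1 + L) := by gcongr
      _ = 720 * ((κ ^ 14 * κB ^ 4 * g ^ 5) * Y) * L * (1 + L) := by ring
      _ ≤ _ := by
        gcongr 720 * (?_ * Y) * L * (1 + L)
        refine (monomial_le hg hκB hκ ?_ ?_ ?_).trans hZd <;> norm_num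
  have htrunc : 10 * (κ ^ 6 * κB * g) * Q ≤ 1920 * (Z * d * Y) :=
    calc _ ≤ 10 * (κ ^ 6 * κB * g) * (192 * (κ ^ 16 * κB ^ 5 * g ^ 5) * d * Y) := by gcongr
      _ = _ := by ring
  calc _ ≤ (Z * d * Y) * (1932 + 16092 * L + 720 * L ^ 2) := by linarith
    _ ≤ (Z * d * Y) * ((1932 + 16092 + 720) * 2 ^ n * L ^ n) := by
        gcongr
        exact quadratic_le_mul_pow hL (by norm_num) (by norm_num) (by norm_num) hn
    _ = _ := by ring

end Collect

section Final

variable {H dx du : ℕ} {A : Mat dx dx} {B : Mat dx du} {Kst : Mat du dx} {κ κB γ : ℝ}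
  {ν : Measure (Vec dx)} {σ W α G : ℝ} {c : ℕ → Vec dx → Vec du → ℝ} {T : ℕ}

theorem Setting.gradBound_mul_sizeBound_sq_le (h : Setting A B Kst κ κB γ ν σ W)
    (hc : ∀ t < T, CostClass (c t) α G) (hα : 0 < α) (hT : 0 < T) (hH : 0 < H) (hdx : 0 < dx)
    (hdu : 0 < du) :
    G * sizeBound κ κB γ W ^ 2 ≤ 192 * (κ ^ 16 * κB ^ 5 * γ⁻¹ ^ 5) * dx
      * (G * W ^ 2 / α * muInv H ν A B Kst c κ κB γ T) := by
  have hκ := h.one_le_κ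
  have hκB := h.one_le_κB
  have hg := h.one_le_inv_γ
  have hG := (hc 0 hT).gradBound_nonneg
  calc _ = 16 * κ ^ 12 * κB ^ 4 * γ⁻¹ ^ 4 * (G * W ^ 2 / α) * α := by
        rw [sizeBound]
        field_simp
        ring
    _ ≤ 16 * κ ^ 12 * κB ^ 4 * γ⁻¹ ^ 4 * (G * W ^ 2 / α)
          * (12 * κ ^ 4 * κB * γ⁻¹ * dx * muInv H ν A B Kst c κ κB γ T) := by
        gcongr
        exact h.le_muInv hc hT hH hdx hdu
    _ = _ := by ring

theorem policyController_eq_linearController (hd : dx = 0 ∨ du = 0) (Kst K : Mat du dx)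
    (M : ℕ → Policy H dx du) : policyController Kst M = linearController K := by
  funext t x w
  rcases hd with rfl | rfl
  · have hzero : ∀ y : Vec 0, y = 0 := fun y => Subsingleton.elim _ _
    simp [policyController, linearController, hzero x, hzero (w _)]
  · exact Subsingleton.elim _ _

theorem Setting.totalCost_sub_totalCost_le_mul_log_pow {Ω : Type*} [MeasurableSpace Ω]
    {P : Measure Ω} [IsProbabilityMeasure P] {w : ℕ → Ω → Vec dx} {K : Mat du dx} {a : ℝ}
    (h : Setting A B Kst κ κB γ ν σ W) (hw : IsIID w ν P) (hc : ∀ t < T, CostClass (c t) α G)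
    (hα : 0 < α) (ha : 1 ≤ a) (hT : 2 ≤ T) {M : ℕ → Policy (memory κ γ T) dx du}
    (hrun : IsNaturalGradientRun ν A B Kst c κ κB γ T (fun t => a / (α * ((t : ℝ) + 1))) M)
    (hK : ExponentiallyStable A B κ γ K) {n : ℕ} (hn : 2 ≤ n) :
    totalCost P w A B c T (policyController Kst M) - totalCost P w A B c T (linearController K)
      ≤ a * (18744 * 2 ^ n * (γ⁻¹ ^ 6 * κB ^ 6 * κ ^ 22 * ((max dx du : ℕ) : ℝ)))
        * (G * W ^ 2 / α * muInv (memory κ γ T) ν A B Kst c κ κB γ T) * Real.log T ^ n := by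
  have hκ := h.one_le_κ
  have hκB := h.one_le_κB
  have hg := h.one_le_inv_γ
  have hT0 : 0 < T := by omega
  have hG := (hc 0 hT0).gradBound_nonneg
  have hL := half_le_log hT
  have hmu := muInv_nonneg (H := memory κ γ T) (ν := ν) (A := A) (B := B) (Kst := Kst) (cs := c)
    (κ := κ) (κB := κB) (γ := γ) (T := T)
  set Y := G * W ^ 2 / α * muInv (memory κ γ T) ν A B Kst c κ κB γ T
  have hY : 0 ≤ Y := by positivity
  by_cases hd : dx = 0 ∨ du = 0
  · rw [policyController_eq_linearController hd Kst K M, sub_self]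
    positivity
  obtain ⟨hdx, hdu⟩ := not_or.1 hd
  have hd1 : (1 : ℝ) ≤ (max dx du : ℕ) := by exact_mod_cast (by omega : 1 ≤ max dx du)
  have hQ : G * sizeBound κ κB γ W ^ 2
      ≤ 192 * (κ ^ 16 * κB ^ 5 * γ⁻¹ ^ 5) * (max dx du : ℕ) * (a * Y) :=
    (h.gradBound_mul_sizeBound_sq_le hc hα hT0 (memory_pos hκ h.γ_pos hT)
      (Nat.pos_of_ne_zero hdx) (Nat.pos_of_ne_zero hdu)).trans (by
        have hdmax : (dx : ℝ) ≤ (max dx du : ℕ) := by exact_mod_cast le_max_left dx du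
        exact mul_le_mul (by gcongr) (le_mul_of_one_le_left hY ha) hY (by positivity))
  calc _ ≤ _ := h.totalCost_sub_totalCost_le hw hc hα ha hT0
        (one_sub_pow_memory_le hκ h.γ_pos h.γ_lt_one hT0) hrun hK
    _ ≤ _ := error_terms_le hg hκB hκ hd1 hL (by positivity) (Nat.cast_nonneg _)
        (memory_add_one_le hκ h.γ_pos h.γ_lt_one hT) hQ hn
    _ = _ := by ring

end Final

end OnlineControl

theorem theorem2_general (n : ℕ) (hn : 2 ≤ n) :
    ∃ p : MvPolynomial (Fin 4) ℝ,
      ∀ (dx du : ℕ) (A : Mat dx dx) (B : Mat dx du) (Kst : Mat du dx)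
        (κ κB γ σ W α G : ℝ),
      1 ≤ κ → 0 < γ → γ < 1 → 0 < σ → 0 < α →
      ‖B‖ ≤ κB → 2 ≤ κB * (1 - γ) →
      ExponentiallyStable A B κ γ Kst →
      ∀ (ν : MeasureTheory.Measure (Vec dx)), NoiseLaw ν σ W →
      ∀ (Ω : Type*) [MeasurableSpace Ω] (P : MeasureTheory.Measure Ω)
        [MeasureTheory.IsProbabilityMeasure P] (w : ℕ → Ω → Vec dx),
      (∀ t, Measurable (w t)) → (∀ t, P.map (w t) = ν) → ProbabilityTheory.iIndepFun w P →
      ∀ (T : ℕ), 2 ≤ T →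
      ∀ (c : ℕ → Vec dx → Vec du → ℝ), (∀ t < T, CostClass (c t) α G) →
      ∀ (a : ℝ), 1 ≤ a →
      ∀ (M : ℕ → Policy (memory κ γ T) dx du),
      IsNaturalGradientRun ν A B Kst c κ κB γ T (fun t => a / (α * ((t : ℝ) + 1))) M →
      ∀ (K : Mat du dx), ExponentiallyStable A B κ γ K →
        totalCost P w A B c T (policyController Kst M)
            - totalCost P w A B c T (linearController K)
          ≤ a * MvPolynomial.eval ![γ⁻¹, κB, κ, ((max dx du : ℕ) : ℝ)] p
            * (G * W ^ 2 / α * muInv (memory κ γ T) ν A B Kst c κ κB γ T)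
            * Real.log T ^ n := by
  refine ⟨MvPolynomial.C (18744 * 2 ^ n) * (MvPolynomial.X 0 ^ 6 * MvPolynomial.X 1 ^ 6
    * MvPolynomial.X 2 ^ 22 * MvPolynomial.X 3), ?_⟩
  intro dx du A B Kst κ κB γ σ W α G hκ hγ hγ1 hσ hα hB h2 hKst ν hν Ω _ P _ w hw hlaw hind T hT
    c hc a ha M hrun K hK
  have h : Setting A B Kst κ κB γ ν σ W := ⟨hκ, hγ, hγ1, hσ, hB, h2, hKst, hν⟩
  simpa using h.totalCost_sub_totalCost_le_mul_log_pow ⟨hw, hlaw, hind⟩ hc hα ha hT hrun hK hn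

theorem theorem2 :
    -- the factor hidden in the O-notation: a polynomial in `γ⁻¹, κ_B, κ, d`
    ∃ p : MvPolynomial (Fin 4) ℝ,
      ∀ (dx du : ℕ) (A : Mat dx dx) (B : Mat dx du) (Kst : Mat du dx)
        (κ κB γ σ W α G : ℝ),
      1 ≤ κ → 0 < γ → γ < 1 → 0 < σ → 0 < α →
      ‖B‖ ≤ κB → 2 ≤ κB * (1 - γ) →
      DiagStronglyStable A B κ γ Kst →
      ∀ (ν : MeasureTheory.Measure (Vec dx)), NoiseLaw ν σ W →
      ∀ (Ω : Type*) [MeasurableSpace Ω] (P : MeasureTheory.Measure Ω)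
        [MeasureTheory.IsProbabilityMeasure P] (w : ℕ → Ω → Vec dx),
      (∀ t, Measurable (w t)) → (∀ t, P.map (w t) = ν) → ProbabilityTheory.iIndepFun w P →
      ∀ (T : ℕ), 2 ≤ T →
      ∀ (c : ℕ → Vec dx → Vec du → ℝ), (∀ t < T, CostClass (c t) α G) →
      -- step sizes of order `1 / (α t)`, the rounds being counted from `0`
      ∀ (a : ℝ), 1 ≤ a →
      ∀ (M : ℕ → Policy (memory κ γ T) dx du),
      IsNaturalGradientRun ν A B Kst c κ κB γ T (fun t => a / (α * ((t : ℝ) + 1))) M →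
      ∀ (K : Mat du dx), DiagStronglyStable A B κ γ K →
        totalCost P w A B c T (policyController Kst M)
            - totalCost P w A B c T (linearController K)
          ≤ a * MvPolynomial.eval ![γ⁻¹, κB, κ, ((max dx du : ℕ) : ℝ)] p
            * (G * W ^ 2 / α * muInv (memory κ γ T) ν A B Kst c κ κB γ T)
            * Real.log T ^ 7 := by
  obtain ⟨p, hp⟩ := theorem2_general 7 (by norm_num)
  exact ⟨p, fun dx du A B Kst κ κB γ σ W α G hκ hγ hγ1 hσ hα hB h2 hKst ν hν Ω _ P _ w hw hlaw hind
    T hT c hc a ha M hrun K hK => hp dx du A B Kst κ κB γ σ W α G hκ hγ hγ1 hσ hα hB h2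
    hKst.exponentiallyStable ν hν Ω P w hw hlaw hind T hT c hc a ha M hrun K
    hK.exponentiallyStable⟩
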